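/- Let $d\ge 1$. For a unitary $U$ on $\mathbb C^d\otimes\mathbb C^d$ (system $\otimes$ environment $E$) the unistochastic channel of $U$ is $\Xi_U(\rho)=\mathrm{Tr}_E\big[U(\rho\otimes \tfrac{I_E}{d})U^\dagger\big]$. For a linear map $\Psi$ on operators on $\mathbb C^N$ write $\sigma_\Psi=\frac1N\sum_{a,b}\Psi(|a\rangle\langle b|)\otimes|a\rangle\langle b|$ for its normalised Choi–Jamiołkowski matrix. For $\Psi=\Xi_U^{\otimes t}$, indices are $t$-tuples, and $(\sigma_\Psi)^{a_1\dots a_t\,i_1\dots i_t}_{b_1\dots b_t\,j_1\dots j_t}=\frac1{d^t}\langle i_1\dots i_t|\Psi(|a_1\dots a_t\rangle\langle b_1\dots b_t|)|j_1\dots j_t\rangle$. Let $\mathrm{Cl}(\sigma)$ be the number of cycles of $\sigma\in S_t$, fixed points included, and let $\mathrm{Wg}(\cdot,D)$ be the unitary Weingarten function: $(\mathrm{Wg}(\sigma\tau^{-1},D))_{\sigma,\tau\in S_t}$ is the inverse (for $t>D$ the Moore–Penrose inverse) of the Gram matrix $(D^{\mathrm{Cl}(\sigma\tau^{-1})})_{\sigma,\tau\in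 S_t}$. (1) For all $d\ge1$, $t\ge 0$ and all $a_n,b_n,i_n,j_n\in\{1,\dots,d\}$, with $U$ Haar distributed on $U(d^2)$, $$\int (\sigma_{\Xi_U^{\otimes t}})^{a_1\dots a_t\,i_1\dots i_t}_{b_1\dots b_t\,j_1\dots j_t}\,dU=\frac1{d^{2t}}\sum_{\sigma,\tau\in S_t}\mathrm{Wg}(\sigma\tau^{-1},d^2)\,d^{\,\mathrm{Cl}(\sigma)+\mathrm{Cl}(\tau)}\prod_{n=1}^t\delta_{a_n,b_{\sigma(n)}}\,\delta_{i_n,j_{\tau(n)}} .$$ (2) Let $\mathcal P_n=\{i^l\bigotimes_{a=1}^n\sigma_x^{j_a}\sigma_z^{k_a}\}$ be the $n$-qubit Pauli group and $\mathcal C_n=\{C\in SU(2^n): CPC^\dagger\in\mathcal P_n\ \forall P\in\mathcal P_n\}$ the Clifford group. Let $\mathcal R_1$ be the set of unitary channels $\rho\mapsto C\rho C^\dagger$, $C\in\mathcal C_1$. Let $\mathcal R_2'$ be the set of those single-qubit maps with Choi matrix $\frac12\sum_{i=0}^1|\psi_i\rangle\langle\psi_i|$, $|\psi_i\rangle=(A\otimes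 B)\,\mathrm{CNOT}_{2\to1}^{k}(\sigma_x^{j}\otimes I)|0i\rangle$, for some $j,k\in\{0,1\}$ and $A,B\in\{I,H,SH\}$ (with $H$ the Hadamard gate and $S=\mathrm{diag}(1,i)$), that are mixed unitary, i.e. convex combinations of unitary channels. Let $\Delta(\rho)=\mathrm{Tr}(\rho)\,I/2$ be the maximally depolarising channel. Then $|\mathcal R_1|=24$, $|\mathcal R_2'|=18$, the set $\mathcal S=\mathcal R_1\cup\mathcal R_2'\cup\{\Delta\}$ has exactly $43$ elements, and $\{\Xi_C: C\in\mathcal C_2\}=\mathcal S$. Put $w=1$ on $\mathcal R_1$, $w=12$ on $\mathcal R_2'$ and $w(\Delta)=240$. For each $\Phi\in\mathcal S$ there are, up to global phase, exactly $24\,w(\Phi)$ elements $C\in\mathcal C_2$ with $\Xi_C=\Phi$. Moreover $\mathcal S$ with the weights $w$ is a weighted unistochastic $3$-design in dimension $d=2$: for every operator $\rho$ on $(\mathbb C^2)^{\otimes3}$, $$\frac{1}{\sum_{\Phi\in\mathcal S}w(\Phi)}\sum_{\Phi\in\mathcal S}w(\Phi)\,\Phi^{\otimes3}(\rho)=\int_{U(4)}\mathrm{Tr}_E\Big[U^{\otimes3}\big(\rho\otimes\tfrac{I_E}{2^3}\big)U^{\dagger\otimes3}\Big]dU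 .$$ -/

import Mathlib

open MeasureTheory Matrix
open scoped Kronecker

noncomputable section

namespace Unistochastic

/-! ### Haar measure on the unitary group -/

section Haar

variable (n : Type) [Fintype n] [DecidableEq n]

/-- The unitary group is compact. -/
instance compactSpace_unitaryGroup : CompactSpace (Matrix.unitaryGroup n ℂ) := by
  have hsub : (Matrix.unitaryGroup n ℂ : Set (Matrix n n ℂ)) ⊆
      Set.univ.pi fun _ => Set.univ.pi fun _ => Metric.closedBall (0 : ℂ) 1 := by
    intro U hU i _ j _
    simpa using entry_norm_bound_of_unitary hU i j
  have hK : IsCompact (Set.univ.pi fun _ : n => Set.univ.pi fun _ : n =>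
      Metric.closedBall (0 : ℂ) 1) :=
    isCompact_univ_pi fun _ => isCompact_univ_pi fun _ => isCompact_closedBall 0 1
  have hcl : IsClosed (Matrix.unitaryGroup n ℂ : Set (Matrix n n ℂ)) := by
    have h : (Matrix.unitaryGroup n ℂ : Set (Matrix n n ℂ)) = {U | U * star U = 1} := by
      ext U
      exact Matrix.mem_unitaryGroup_iff
    rw [h]
    exact isClosed_eq (continuous_id.mul continuous_star) continuous_const
  exact isCompact_iff_compactSpace.mp (hK.of_isClosed_subset hcl hsub)

/-- The Borel σ-algebra on the unitary group. -/
instance measurableSpace_unitaryGroup : MeasurableSpace (Matrix.unitaryGroup n ℂ) :=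
  borel _

instance borelSpace_unitaryGroup : BorelSpace (Matrix.unitaryGroup n ℂ) := ⟨rfl⟩

/-- The normalised Haar measure on the unitary group: the Haar measure giving the whole
(compact) group mass one. -/
def unitaryHaar : Measure (Matrix.unitaryGroup n ℂ) := Measure.haarMeasure ⊤

instance isProbabilityMeasure_unitaryHaar : IsProbabilityMeasure (unitaryHaar n) :=
  ⟨Measure.haarMeasure_self⟩

end Haar

/-! ### Channels -/

/-- Linear maps on `n × n` complex matrices. -/
abbrev SuperOp (n : Type) : Type := Matrix n n ℂ →ₗ[ℂ] Matrix n n ℂ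

section Channels

variable {n e : Type} [Fintype n] [DecidableEq n] [Fintype e] [DecidableEq e]

/-- Partial trace over the second tensor factor (the environment). -/
def traceEnv (M : Matrix (n × e) (n × e) ℂ) : Matrix n n ℂ :=
  Matrix.of fun i j => ∑ l, M (i, l) (j, l)

/-- The map `ρ ↦ Tr_E [U (ρ ⊗ I_E / dim E) U†]`. -/
def unistochastic (U : Matrix (n × e) (n × e) ℂ) : SuperOp n where
  toFun ρ := traceEnv (U * (ρ ⊗ₖ ((Fintype.card e : ℂ)⁻¹ • (1 : Matrix e e ℂ))) * Uᴴ)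
  map_add' ρ ρ' := by
    ext i j
    simp [traceEnv, Matrix.add_kronecker, Matrix.mul_add, Matrix.add_mul, Finset.sum_add_distrib]
  map_smul' c ρ := by
    ext i j
    simp [traceEnv, Matrix.smul_kronecker, Finset.mul_sum]

/-- The map `ρ ↦ U ρ U†`. -/
def unitaryChannel (U : Matrix n n ℂ) : SuperOp n where
  toFun ρ := U * ρ * Uᴴ
  map_add' ρ ρ' := by simp [Matrix.mul_add, Matrix.add_mul]
  map_smul' c ρ := by simp

/-- The maximally depolarising channel `ρ ↦ Tr(ρ) I / dim`. -/
def depolarising (n : Type) [Fintype n] [DecidableEq n] : SuperOp n where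
  toFun ρ := (ρ.trace * (Fintype.card n : ℂ)⁻¹) • (1 : Matrix n n ℂ)
  map_add' ρ ρ' := by simp [add_mul, add_smul]
  map_smul' c ρ := by simp [mul_assoc, smul_smul]

/-- The normalised Choi–Jamiołkowski matrix `(1 / dim) ∑_{a,b} Φ(|a⟩⟨b|) ⊗ |a⟩⟨b|`: its entry in
row `(i, a)` and column `(j, b)` is `⟨i| Φ(|a⟩⟨b|) |j⟩ / dim`. -/
def choi (Φ : SuperOp n) : Matrix (n × n) (n × n) ℂ :=
  Matrix.of fun p q => (Fintype.card n : ℂ)⁻¹ * Φ (Matrix.single p.2 q.2 1) p.1 q.1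

/-- The `t`-th tensor power `Φ^{⊗ t}`, acting on matrices indexed by `Fin t → n`: the linear map
with `⊗ₖ |aₖ⟩⟨bₖ| ↦ ⊗ₖ Φ(|aₖ⟩⟨bₖ|)`. -/
def tensorPow (t : ℕ) (Φ : SuperOp n) : SuperOp (Fin t → n) where
  toFun X := Matrix.of fun i j =>
    ∑ a, ∑ b, X a b * ∏ k, Φ (Matrix.single (a k) (b k) 1) (i k) (j k)
  map_add' X Y := by
    ext i j
    simp [add_mul, Finset.sum_add_distrib]
  map_smul' c X := by
    ext i j
    simp [Finset.mul_sum, mul_assoc]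

/-- `U^{⊗ t}`, with the `t` system factors collected in front of the `t` environment factors. -/
def unitaryTensorPow (t : ℕ) (U : Matrix (n × e) (n × e) ℂ) :
    Matrix ((Fin t → n) × (Fin t → e)) ((Fin t → n) × (Fin t → e)) ℂ :=
  Matrix.of fun p q => ∏ k, U (p.1 k, p.2 k) (q.1 k, q.2 k)

/-- Convex combinations of unitary channels. -/
def IsMixedUnitary (Φ : SuperOp n) : Prop :=
  ∃ (m : ℕ) (p : Fin m → ℝ) (U : Fin m → Matrix.unitaryGroup n ℂ),
    (∀ r, 0 ≤ p r) ∧ ∑ r, p r = 1 ∧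
      Φ = ∑ r, (p r : ℂ) • unitaryChannel (U r : Matrix n n ℂ)

end Channels

/-- A finite set `S` of unistochastic channels in dimension `d`, with positive weights `w`, is a
weighted unistochastic `t`-design if for every operator `ρ` on `t` copies of the system
`(∑ w)⁻¹ ∑_{Φ ∈ S} w(Φ) Φ^{⊗ t}(ρ) = ∫ Tr_E [U^{⊗ t} (ρ ⊗ I_E / d^t) U^{† ⊗ t}] dU`,
with `U` Haar distributed on the unitary group of dimension `d²` (the integral being taken
entry by entry). -/
def IsWeightedUnistochasticDesign {d : ℕ} (t : ℕ) (S : Finset (SuperOp (Fin d)))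
    (w : SuperOp (Fin d) → ℝ) : Prop :=
  S.Nonempty ∧
  (∀ Φ ∈ S, 0 < w Φ ∧
    ∃ U : Matrix.unitaryGroup (Fin d × Fin d) ℂ,
      Φ = unistochastic (U : Matrix (Fin d × Fin d) (Fin d × Fin d) ℂ)) ∧
  ∀ (ρ : Matrix (Fin t → Fin d) (Fin t → Fin d) ℂ) (i j : Fin t → Fin d),
    ((∑ Φ ∈ S, w Φ : ℝ) : ℂ)⁻¹ * ∑ Φ ∈ S, (w Φ : ℂ) * tensorPow t Φ ρ i j =
      ∫ U : Matrix.unitaryGroup (Fin d × Fin d) ℂ,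
        unistochastic (unitaryTensorPow t (U : Matrix (Fin d × Fin d) (Fin d × Fin d) ℂ)) ρ i j
          ∂(unitaryHaar (Fin d × Fin d))

/-! ### Weingarten function -/

/-- The number of cycles of a permutation, fixed points included. -/
def numCycles {t : ℕ} (σ : Equiv.Perm (Fin t)) : ℕ := Multiset.card σ.partition.parts

/-- The Gram matrix `(D ^ Cl(σ τ⁻¹))_{σ,τ}` of the permutation operators on `(ℂ^D)^{⊗ t}`. -/
def permGram (t D : ℕ) : Matrix (Equiv.Perm (Fin t)) (Equiv.Perm (Fin t)) ℂ :=
  Matrix.of fun σ τ => (D : ℂ) ^ numCycles (σ * τ⁻¹)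

/-- The unitary Weingarten function: `(Wg(σ τ⁻¹, D))_{σ,τ}` is the Moore–Penrose inverse of the
Gram matrix `(D ^ Cl(σ τ⁻¹))_{σ,τ}` (its inverse as soon as `t ≤ D`). As the Gram matrix is
Hermitian, its Moore–Penrose inverse is obtained by applying `x ↦ x⁻¹`, with `0⁻¹ = 0`, to it in
the functional calculus. -/
def Wg {t : ℕ} (σ : Equiv.Perm (Fin t)) (D : ℕ) : ℂ :=
  (cfc (fun x : ℝ => x⁻¹) (permGram t D)) σ 1

/-! ### Clifford groups -/

/-- Pauli matrix `σ_x`. -/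
def pauliX : Matrix (Fin 2) (Fin 2) ℂ := !![0, 1; 1, 0]

/-- Pauli matrix `σ_z`. -/
def pauliZ : Matrix (Fin 2) (Fin 2) ℂ := !![1, 0; 0, -1]

/-- The Pauli group on `n` qubits: the operators `i^l ⊗_a σ_x^{j_a} σ_z^{k_a}`. -/
def pauliGroup (n : ℕ) : Set (Matrix (Fin n → Fin 2) (Fin n → Fin 2) ℂ) :=
  {P | ∃ (l : Fin 4) (j k : Fin n → Fin 2),
    P = Complex.I ^ (l : ℕ) •
      Matrix.of fun x y => ∏ a, (pauliX ^ (j a : ℕ) * pauliZ ^ (k a : ℕ)) (x a) (y a)}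

/-- The Clifford group on `n` qubits: `C ∈ SU(2^n)` with `C P C† ∈ 𝒫_n` for all `P ∈ 𝒫_n`. -/
def cliffordGroup (n : ℕ) : Set (Matrix (Fin n → Fin 2) (Fin n → Fin 2) ℂ) :=
  {C | C ∈ Matrix.specialUnitaryGroup (Fin n → Fin 2) ℂ ∧
    ∀ P ∈ pauliGroup n, C * P * Cᴴ ∈ pauliGroup n}

/-- The one-qubit Clifford group, as matrices indexed by `Fin 2`. -/
def cliffordOne : Set (Matrix (Fin 2) (Fin 2) ℂ) :=
  Matrix.reindex (Equiv.funUnique (Fin 1) (Fin 2)) (Equiv.funUnique (Fin 1) (Fin 2)) ''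
    cliffordGroup 1

/-- The two-qubit Clifford group, as matrices indexed by `Fin 2 × Fin 2`. -/
def cliffordTwo : Set (Matrix (Fin 2 × Fin 2) (Fin 2 × Fin 2) ℂ) :=
  Matrix.reindex (finTwoArrowEquiv (Fin 2)) (finTwoArrowEquiv (Fin 2)) '' cliffordGroup 2

/-- The unitary channels of the one-qubit Clifford group. -/
def cliffordChannels : Set (SuperOp (Fin 2)) := unitaryChannel '' cliffordOne

/-! ### The rank-two channels -/

/-- Hadamard gate. -/
def gateH : Matrix (Fin 2) (Fin 2) ℂ := ((Real.sqrt 2 : ℝ) : ℂ)⁻¹ • !![1, 1; 1, -1]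

/-- Phase gate `diag(1, i)`. -/
def gateS : Matrix (Fin 2) (Fin 2) ℂ := !![1, 0; 0, Complex.I]

/-- `CNOT_{2 → 1}`, `|x y⟩ ↦ |x ⊕ y, y⟩`. -/
def cnotTwoOne : Matrix (Fin 2 × Fin 2) (Fin 2 × Fin 2) ℂ :=
  Matrix.of fun p q => if p = (q.1 + q.2, q.2) then 1 else 0

/-- `|ψ_i⟩ = (A ⊗ B) CNOT_{2 → 1}^k (σ_x^j ⊗ I) |0 i⟩`. -/
def rankTwoVec (A B : Matrix (Fin 2) (Fin 2) ℂ) (j k i : Fin 2) : Fin 2 × Fin 2 → ℂ :=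
  ((A ⊗ₖ B) * cnotTwoOne ^ (k : ℕ) * ((pauliX ^ (j : ℕ)) ⊗ₖ (1 : Matrix (Fin 2) (Fin 2) ℂ))) *ᵥ
    Pi.single (0, i) 1

/-- The channels with Choi state `½ (|ψ_0⟩⟨ψ_0| + |ψ_1⟩⟨ψ_1|)`, where
`|ψ_i⟩ = (A ⊗ B) CNOT_{2 → 1}^k (σ_x^j ⊗ I) |0 i⟩`, `j, k ∈ {0, 1}`, `A, B ∈ {I, H, S H}`. -/
def rankTwoChannels : Set (SuperOp (Fin 2)) :=
  {Φ | ∃ A ∈ ({1, gateH, gateS * gateH} : Set (Matrix (Fin 2) (Fin 2) ℂ)),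
    ∃ B ∈ ({1, gateH, gateS * gateH} : Set (Matrix (Fin 2) (Fin 2) ℂ)),
    ∃ j k : Fin 2,
      choi Φ = (1 / 2 : ℂ) • ∑ i : Fin 2,
        Matrix.vecMulVec (rankTwoVec A B j k i) (star (rankTwoVec A B j k i))}

/-- The mixed unitary channels among the rank-two channels. -/
def rankTwoMixedUnitary : Set (SuperOp (Fin 2)) :=
  {Φ | Φ ∈ rankTwoChannels ∧ IsMixedUnitary Φ}

end Unistochastic

end

/-! Part (1) is Weingarten calculus. A Haar twirl of operators on t copies commutes with every `U^{⊗
t}`, so by Schur-Weyl duality (`mem_span_permMat`) it is a combination of permutation operators. Its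
traces against permutations equal those of the untwirled operator, so the coefficients solve a
linear system with the Gram matrix `G`. Any pseudo-inverse `W` with `G W G = G` solves it:
coefficient vectors killed by `G` give the zero operator, being orthogonal to themselves
(`haarTwirl_eq`). This covers the range t > D, where `G` can be singular. Tracing out the
environment sums over environment strings, and those invariant under a permutation number d to the
number of its cycles (`card_invariant_functions`).

For part (2), a two-qubit Clifford unitary is determined up to phase by the images of the four
generators X⊗1, Z⊗1, 1⊗X, 1⊗Z, and every choice of signed Paulis with the right commutation
relations occurs (`Tableau.exists_specialUnitary`). The channel only sees the first pair: it sends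
X, Z and Y = iXZ to the partial traces of their images, each a signed Pauli or zero. A channel is
thus encoded by three Bloch columns, and either 3, 1 or 0 of them are nonzero; these cases are the
local Cliffords, the rank-two mixed unitaries and the depolarising channel. A given code comes from
1, 12 or 240 anticommuting first pairs respectively, and each first pair extends by 24 second pairs,
whence the weights and the fibre sizes (`ncard_fiber`).

For the design property, the Bloch coefficients have weighted moments of degree 1, 2, 3 equal to 0,
32 times a Kronecker delta, and 4 times a product of Levi-Civita symbols, against total weight 480.
The contractions of Pauli matrices turn these into swaps and three-cycles. On the Haar side, the
explicit Weingarten function for t = 3, D = 4 gives the same expression plus a multiple of a product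
of two antisymmetrisers, which vanish since three qubits carry no totally antisymmetric tensor
(`sum_weingartenThree`, `sum_sign_indicator`, `sum_pairCount_prod_blochMap`). -/

noncomputable section

set_option linter.unusedSectionVars false

namespace Unistochastic

/-! ### Schur-Weyl duality: the commutant of the tensor powers of unitaries. -/

section Commutant

variable {n : Type} [Fintype n] [DecidableEq n] {t : ℕ}

/-- The tensor power `M^{⊗ t}`. -/
def tpow {R : Type*} [CommSemiring R] (t : ℕ) (M : Matrix n n R) :
    Matrix (Fin t → n) (Fin t → n) R :=
  Matrix.of fun p q => ∏ k, M (p k) (q k)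

theorem tpow_mul {R : Type*} [CommSemiring R] (M N : Matrix n n R) :
    tpow t (M * N) = tpow t M * tpow t N := by
  ext p q
  simp only [tpow, Matrix.of_apply, Matrix.mul_apply]
  rw [Finset.prod_univ_sum, Fintype.piFinset_univ]
  exact Finset.sum_congr rfl fun r _ => Finset.prod_mul_distrib

theorem tpow_one : tpow t (1 : Matrix n n ℂ) = 1 := by
  ext p q
  simp only [tpow, Matrix.of_apply, Matrix.one_apply, Finset.prod_ite_zero, funext_iff]
  simp

theorem tpow_conjTranspose (M : Matrix n n ℂ) : tpow t Mᴴ = (tpow t M)ᴴ := by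
  ext p q
  simp [tpow, Matrix.conjTranspose_apply, star_prod]

/-- The operator permuting the tensor factors. -/
def permMat (n : Type) [Fintype n] [DecidableEq n] (σ : Equiv.Perm (Fin t)) :
    Matrix (Fin t → n) (Fin t → n) ℂ :=
  Matrix.of fun p q => if p = q ∘ σ then 1 else 0

theorem permMat_mul_apply (σ : Equiv.Perm (Fin t)) (X : Matrix (Fin t → n) (Fin t → n) ℂ)
    (p q : Fin t → n) : (permMat n σ * X) p q = X (p ∘ σ.symm) q := by
  have h : ∀ r : Fin t → n, p = r ∘ σ ↔ p ∘ σ.symm = r := fun r =>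
    ⟨fun h => by subst h; ext; simp, fun h => by subst h; ext; simp⟩
  simp [Matrix.mul_apply, permMat, h]

theorem mul_permMat_apply (σ : Equiv.Perm (Fin t)) (X : Matrix (Fin t → n) (Fin t → n) ℂ)
    (p q : Fin t → n) : (X * permMat n σ) p q = X p (q ∘ σ) := by
  simp [Matrix.mul_apply, permMat]

theorem permMat_mul (σ τ : Equiv.Perm (Fin t)) :
    permMat n σ * permMat n τ = permMat n (τ * σ) := by
  ext p q
  rw [permMat_mul_apply]
  simp only [permMat, Matrix.of_apply]
  refine if_congr ⟨fun h => ?_, fun h => ?_⟩ rfl rfl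
  · ext k
    simpa using congrFun h (σ k)
  · subst h
    ext k
    simp

theorem permMat_one : permMat n (1 : Equiv.Perm (Fin t)) = 1 := by
  ext p q
  simp [permMat, Matrix.one_apply]

theorem permMat_commute_iff (σ : Equiv.Perm (Fin t)) (T : Matrix (Fin t → n) (Fin t → n) ℂ) :
    Commute (permMat n σ) T ↔ ∀ p q, T (p ∘ σ) (q ∘ σ) = T p q := by
  rw [Commute, SemiconjBy]
  constructor
  · intro h p q
    have := congrFun (congrFun h (p ∘ σ)) q
    rw [permMat_mul_apply, mul_permMat_apply] at this
    rw [← this]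
    congr 1
    ext
    simp
  · intro h
    ext p q
    rw [permMat_mul_apply, mul_permMat_apply, ← h]
    congr 1
    ext
    simp

theorem permMat_commute_tpow (σ : Equiv.Perm (Fin t)) (M : Matrix n n ℂ) :
    Commute (permMat n σ) (tpow t M) := by
  rw [permMat_commute_iff]
  intro p q
  exact Equiv.prod_comp σ fun k => M (p k) (q k)

/-- The entries of `A M^{⊗ t} - M^{⊗ t} A`, for a matrix `M` of polynomials. -/
def commPoly {ι : Type*} (A : Matrix (Fin t → n) (Fin t → n) ℂ)
    (M : Matrix n n (MvPolynomial ι ℂ)) (p q : Fin t → n) : MvPolynomial ι ℂ :=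
  (A.map MvPolynomial.C * tpow t M - tpow t M * A.map MvPolynomial.C :
    Matrix (Fin t → n) (Fin t → n) (MvPolynomial ι ℂ)) p q

theorem eval_commPoly {ι : Type*} (A : Matrix (Fin t → n) (Fin t → n) ℂ)
    (M : Matrix n n (MvPolynomial ι ℂ)) (p q : Fin t → n) (x : ι → ℂ) :
    MvPolynomial.eval x (commPoly A M p q) =
      (A * tpow t (M.map (MvPolynomial.eval x)) - tpow t (M.map (MvPolynomial.eval x)) * A) p q := by
  simp [commPoly, Matrix.mul_apply, tpow]

theorem commPoly_eq_zero_iff {ι : Type*} (A : Matrix (Fin t → n) (Fin t → n) ℂ)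
    (M : Matrix n n (MvPolynomial ι ℂ)) (x : ι → ℂ) :
    Commute A (tpow t (M.map (MvPolynomial.eval x))) ↔
      ∀ p q, MvPolynomial.eval x (commPoly A M p q) = 0 := by
  simp only [eval_commPoly, Commute, SemiconjBy]
  rw [← sub_eq_zero, ← Matrix.ext_iff]
  rfl

/-- Commutation with a tensor power is a system of polynomial equations in the parameters, and a
polynomial vanishing on a product of infinite sets is zero. This is the Zariski-density tool behind
the passage from unitary to arbitrary matrices. -/
theorem commute_tpow_of_set {ι : Type*} (A : Matrix (Fin t → n) (Fin t → n) ℂ)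
    (M : Matrix n n (MvPolynomial ι ℂ)) (s : Set ℂ) (hs : s.Infinite)
    (h : ∀ x : ι → ℂ, (∀ i, x i ∈ s) → Commute A (tpow t (M.map (MvPolynomial.eval x))))
    (x : ι → ℂ) : Commute A (tpow t (M.map (MvPolynomial.eval x))) := by
  rw [commPoly_eq_zero_iff]
  intro p q
  have : commPoly A M p q = 0 := by
    refine MvPolynomial.funext_set (fun _ => s) (fun _ => hs) fun y hy => ?_
    rw [map_zero]
    exact (commPoly_eq_zero_iff A M y).1 (h y fun i => hy i trivial) p q
  rw [this, map_zero]

theorem infinite_unitCircle : {z : ℂ | star z * z = 1}.Infinite := by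
  have : Infinite (Set.Ioo (0 : ℝ) 1) := (Set.Ioo_infinite one_pos).to_subtype
  refine (Set.infinite_range_of_injective
    (f := fun x : Set.Ioo (0 : ℝ) 1 => (Circle.exp x : ℂ)) fun x y hxy => ?_).mono ?_
  · have hpi := Real.pi_gt_three
    have h := congrArg Complex.arg hxy
    simp only at h
    rw [Circle.arg_exp (by linarith [x.2.1]) (by linarith [x.2.2]),
      Circle.arg_exp (by linarith [y.2.1]) (by linarith [y.2.2])] at h
    exact Subtype.ext h
  · rintro _ ⟨x, rfl⟩
    change (starRingEnd ℂ) _ * _ = _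
    rw [Complex.conj_mul', Circle.norm_coe]
    simp

/-- In an eigenbasis `V`, the matrices `V diag(x) V*` are unitary when every `x i` lies on the unit
circle, so commutation extends by density to all diagonals, in particular to the eigenvalues of `H`.
-/
theorem commute_tpow_isHermitian {A : Matrix (Fin t → n) (Fin t → n) ℂ}
    (hA : ∀ U ∈ Matrix.unitaryGroup n ℂ, Commute A (tpow t U)) {H : Matrix n n ℂ}
    (hH : H.IsHermitian) : Commute A (tpow t H) := by
  set V : Matrix n n ℂ := (hH.eigenvectorUnitary : Matrix n n ℂ)
  have hV : V ∈ Matrix.unitaryGroup n ℂ := hH.eigenvectorUnitary.2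
  let M : Matrix n n (MvPolynomial n ℂ) :=
    V.map MvPolynomial.C * Matrix.diagonal MvPolynomial.X * (star V).map MvPolynomial.C
  have hM : ∀ x : n → ℂ, M.map (MvPolynomial.eval x) = V * Matrix.diagonal x * star V := by
    intro x
    ext i j
    simp [M, Matrix.mul_apply, Matrix.diagonal_apply]
  have key := commute_tpow_of_set A M _ infinite_unitCircle (fun x hx => ?_)
    (fun i => (hH.eigenvalues i : ℂ))
  · rw [hM] at key
    convert key using 2
    conv_lhs => rw [hH.spectral_theorem, Unitary.conjStarAlgAut_apply]
    rfl
  · rw [hM]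
    refine hA _ (mul_mem (mul_mem hV ?_) (Unitary.star_mem hV))
    rw [Matrix.mem_unitaryGroup_iff', Matrix.star_eq_conjTranspose, Matrix.diagonal_conjTranspose,
      Matrix.diagonal_mul_diagonal, ← Matrix.diagonal_one]
    congr 1
    ext i
    exact hx i

/-- Hermitian matrices are the real points of a linear parametrisation whose complex points are all
matrices, so density applies a second time. -/
theorem commute_tpow {A : Matrix (Fin t → n) (Fin t → n) ℂ}
    (hA : ∀ U ∈ Matrix.unitaryGroup n ℂ, Commute A (tpow t U)) (N : Matrix n n ℂ) :
    Commute A (tpow t N) := by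
  let M : Matrix n n (MvPolynomial (n × n) ℂ) := Matrix.of fun i j =>
    MvPolynomial.X (i, j) + MvPolynomial.X (j, i) +
      MvPolynomial.C Complex.I * (MvPolynomial.X (i, j) - MvPolynomial.X (j, i))
  -- For real `x` the matrix with entries `x_ij + x_ji + i (x_ij - x_ji)` is Hermitian; the complex
  -- point given here is the one at which it equals `N`.
  have key := commute_tpow_of_set A M (Set.range ((↑) : ℝ → ℂ))
    (Set.infinite_range_of_injective Complex.ofReal_injective) (fun x hx => ?_)
    (fun ij => (1 / 4 : ℂ) * (N ij.1 ij.2 + N ij.2 ij.1) -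
      Complex.I / 4 * (N ij.1 ij.2 - N ij.2 ij.1))
  · convert key using 2
    ext i j
    simp only [M, Matrix.map_apply, Matrix.of_apply, map_add, map_mul, map_sub,
      MvPolynomial.eval_X, MvPolynomial.eval_C]
    linear_combination (1/2 : ℂ) * (N i j - N j i) * Complex.I_sq
  · refine commute_tpow_isHermitian hA ?_
    choose y hy using hx
    ext i j
    simp [M, ← hy]
    ring

/-- The commutator of `A` with the tensor power of a generic matrix is identically zero as a
polynomial. An entry of a symmetric `T` depends only on the monomial at that position of the generic
tensor power, so a linear functional on polynomials replaces those monomials by the entries of `T`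
and carries the identity over to `T`. -/
theorem commute_of_symmetric {A : Matrix (Fin t → n) (Fin t → n) ℂ}
    (hA : ∀ U ∈ Matrix.unitaryGroup n ℂ, Commute A (tpow t U))
    {T : Matrix (Fin t → n) (Fin t → n) ℂ}
    (hT : ∀ σ : Equiv.Perm (Fin t), Commute (permMat n σ) T) : Commute A T := by
  let mon : (Fin t → n) → (Fin t → n) → (n × n →₀ ℕ) := fun r q =>
    ∑ k, Finsupp.single (r k, q k) 1
  have hmon : ∀ r q r' q', mon r q = mon r' q' → T r q = T r' q' := by
    intro r q r' q' h
    -- Equal monomials mean that each index pair occurs equally often, so a permutation of the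
    -- tensor factors matches the two strings of pairs.
    have hc : ∀ c : n × n, Nonempty ({k // (r k, q k) = c} ≃ {k // (r' k, q' k) = c}) := by
      intro c
      refine ⟨Fintype.equivOfCardEq ?_⟩
      have := DFunLike.congr_fun h c
      simp only [mon, Finsupp.coe_finsetSum, Finset.sum_apply, Finsupp.single_apply,
        Finset.sum_boole, Nat.cast_id] at this
      rw [Fintype.card_subtype, Fintype.card_subtype, this]
    let e : Equiv.Perm (Fin t) := Equiv.ofFiberEquiv (f := fun k => (r k, q k))
      (g := fun k => (r' k, q' k)) fun c => (hc c).some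
    have he : ∀ k, (r' (e k), q' (e k)) = (r k, q k) := fun k =>
      Equiv.ofFiberEquiv_map (f := fun k => (r k, q k)) (g := fun k => (r' k, q' k)) _ k
    have h1 := (permMat_commute_iff e T).1 (hT e) r' q'
    rw [← h1]
    congr 1 <;> ext k <;> [exact (congrArg Prod.fst (he k)).symm; exact (congrArg Prod.snd (he k)).symm]
  classical
  let φ : (n × n →₀ ℕ) → ℂ := fun m =>
    if h : ∃ rq : (Fin t → n) × (Fin t → n), mon rq.1 rq.2 = m then T h.choose.1 h.choose.2 else 0
  have hφ : ∀ r q, φ (mon r q) = T r q := by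
    intro r q
    have h : ∃ rq : (Fin t → n) × (Fin t → n), mon rq.1 rq.2 = mon r q := ⟨(r, q), rfl⟩
    simp only [φ, dif_pos h]
    exact hmon _ _ _ _ h.choose_spec
  let X : Matrix n n (MvPolynomial (n × n) ℂ) := Matrix.of fun i j => MvPolynomial.X (i, j)
  have hX : ∀ p q, commPoly A X p q = 0 := by
    intro p q
    refine MvPolynomial.funext fun x => ?_
    rw [map_zero]
    exact (commPoly_eq_zero_iff A X x).1 (commute_tpow hA _) p q
  have htp : ∀ r q, tpow t X r q = MvPolynomial.monomial (mon r q) 1 := by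
    intro r q
    simp only [tpow, X, Matrix.of_apply, MvPolynomial.X, mon]
    rw [MvPolynomial.monomial_sum_one]
  let L : MvPolynomial (n × n) ℂ →ₗ[ℂ] ℂ :=
    (MvPolynomial.basisMonomials (n × n) ℂ).constr ℂ φ
  have hL : ∀ r q, ∀ c, L (MvPolynomial.C c * tpow t X r q) = c * T r q := by
    intro r q c
    have h1 : L (MvPolynomial.monomial (mon r q) 1) = φ (mon r q) := by
      simpa using (MvPolynomial.basisMonomials (n × n) ℂ).constr_basis ℂ φ (mon r q)
    rw [htp, ← MvPolynomial.smul_eq_C_mul, map_smul, h1, hφ, smul_eq_mul]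
  rw [Commute, SemiconjBy, ← sub_eq_zero]
  ext p q
  have := congrArg L (hX p q)
  simp only [commPoly, Matrix.sub_apply, Matrix.mul_apply, map_zero, map_sub, map_sum,
    Matrix.map_apply, hL] at this
  simp only [mul_comm (tpow t X _ _), hL] at this
  simpa [Matrix.mul_apply, mul_comm] using this

/-- A direct form of the double commutant argument. Averaging a linear projection onto the span `B`
over the symmetric group makes it equivariant for left multiplication by permutations. Read column
by column, it acts through symmetric operators, with which `A` commutes; hence it sends `A` to `A`
times the image of 1, that is to `A`, which therefore lies in `B`. -/
theorem mem_span_permMat {A : Matrix (Fin t → n) (Fin t → n) ℂ}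
    (hA : ∀ U ∈ Matrix.unitaryGroup n ℂ, Commute A (tpow t U)) :
    A ∈ Submodule.span ℂ (Set.range fun σ : Equiv.Perm (Fin t) => permMat n σ) := by
  set B := Submodule.span ℂ (Set.range fun σ : Equiv.Perm (Fin t) => permMat n σ) with hB
  have hmulB : ∀ σ, ∀ X ∈ B, permMat n σ * X ∈ B := by
    intro σ X hX
    induction hX using Submodule.span_induction with
    | mem x h =>
      obtain ⟨τ, rfl⟩ := h
      simp only [permMat_mul]
      exact Submodule.subset_span ⟨_, rfl⟩
    | zero => simp
    | add x y _ _ hx hy => rw [mul_add]; exact add_mem hx hy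
    | smul a x _ hx => rw [mul_smul_comm]; exact B.smul_mem _ hx
  obtain ⟨π₀, hπ₀⟩ := LinearMap.exists_leftInverse_of_injective B.subtype B.ker_subtype
  have hπ₀' : ∀ X (hX : X ∈ B), π₀ X = ⟨X, hX⟩ := fun X hX =>
    DFunLike.congr_fun hπ₀ ⟨X, hX⟩
  -- The Maschke average of the projection `π₀`.
  let π : Matrix (Fin t → n) (Fin t → n) ℂ → Matrix (Fin t → n) (Fin t → n) ℂ := fun X =>
    (Fintype.card (Equiv.Perm (Fin t)) : ℂ)⁻¹ •
      ∑ σ : Equiv.Perm (Fin t), permMat n σ * (π₀ (permMat n σ⁻¹ * X) : Matrix _ _ ℂ)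
  have hadd : ∀ X Y, π (X + Y) = π X + π Y := by
    intro X Y
    simp [π, mul_add, Finset.sum_add_distrib]
  have hsmul : ∀ (c : ℂ) X, π (c • X) = c • π X := by
    intro c X
    simp only [π, mul_smul_comm, map_smul, Submodule.coe_smul, ← Finset.smul_sum]
    rw [smul_comm]
  let π' : Matrix (Fin t → n) (Fin t → n) ℂ →ₗ[ℂ] Matrix (Fin t → n) (Fin t → n) ℂ :=
    { toFun := π, map_add' := hadd, map_smul' := hsmul }
  have hmem : ∀ X, π' X ∈ B := fun X =>
    B.smul_mem _ (sum_mem fun σ _ => hmulB σ _ (π₀ _).2)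
  have heq : ∀ τ X, π' (permMat n τ * X) = permMat n τ * π' X := by
    intro τ X
    change π _ = _ * π _
    simp only [π, mul_smul_comm, Finset.mul_sum]
    congr 1
    refine Fintype.sum_equiv (Equiv.mulRight τ⁻¹) _ _ fun σ => ?_
    simp only [Equiv.coe_mulRight, ← mul_assoc, permMat_mul]
    have h1 : (σ * τ⁻¹)⁻¹ = τ * σ⁻¹ := by group
    have h2 : σ * τ⁻¹ * τ = σ := by group
    rw [h1, h2]
  have hone : π' 1 = 1 := by
    have h1 : ∀ σ : Equiv.Perm (Fin t), permMat n σ⁻¹ ∈ B := fun σ =>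
      Submodule.subset_span ⟨_, rfl⟩
    change π _ = _
    simp [π, hπ₀' _ (h1 _), permMat_mul, permMat_one, ← Nat.cast_smul_eq_nsmul ℂ, smul_smul]
  have hcol : ∀ (Y X : Matrix (Fin t → n) (Fin t → n) ℂ) (r c' : Fin t → n),
      π' (Y * X) r c' = ∑ c, ∑ s, (∑ u, Y u s * π' (Matrix.single u c 1) r c') * X s c := by
    intro Y X r c'
    have h : Y * X = ∑ c, ∑ s, ∑ u, (Y u s * X s c) • Matrix.single u c (1 : ℂ) := by
      ext p q
      simp [Matrix.mul_apply, Matrix.sum_apply, Matrix.single_apply, ite_and]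
    rw [h]
    simp only [map_sum, map_smul, Matrix.sum_apply, Matrix.smul_apply, smul_eq_mul,
      Finset.sum_mul]
    refine Finset.sum_congr rfl fun c _ => Finset.sum_congr rfl fun s _ =>
      Finset.sum_congr rfl fun u _ => by ring
  -- `T c c'` is the operator through which column `c` of the argument contributes to column `c'` of
  -- the projection; equivariance of `π'` makes it symmetric.
  let T : (Fin t → n) → (Fin t → n) → Matrix (Fin t → n) (Fin t → n) ℂ := fun c c' =>
    Matrix.of fun r s => π' (Matrix.single s c 1) r c'
  have hT : ∀ c c' Y s r, π' (Y * Matrix.single s c 1) r c' = (T c c' * Y) r s := by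
    intro c c' Y s r
    rw [hcol, Matrix.mul_apply]
    simp [Matrix.single_apply, T, ite_and, mul_comm]
  have hTc : ∀ c c', Commute A (T c c') := by
    intro c c'
    refine commute_of_symmetric hA fun σ => ?_
    rw [Commute, SemiconjBy]
    ext r s
    rw [← hT, heq]
    simp [Matrix.mul_apply, T]
  have hAπ : π' A = A := by
    have h : π' (A * 1) = A * π' 1 := by
      have h1 : (1 : Matrix (Fin t → n) (Fin t → n) ℂ) = ∑ s, Matrix.single s s 1 := by
        ext p q
        simp [Matrix.sum_apply, Matrix.single_apply, Matrix.one_apply, ite_and]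
      rw [h1, Finset.mul_sum, map_sum, map_sum, Finset.mul_sum]
      refine Finset.sum_congr rfl fun s _ => ?_
      ext r c'
      rw [hT, ← (hTc s c').eq]
      simp [Matrix.mul_apply, T]
    rwa [mul_one, hone, mul_one] at h
  exact hAπ ▸ hmem A

end Commutant

/-! ### Counting cycles by invariant strings. -/

section Cycles

variable {t : ℕ}

/-- A string is invariant exactly when it is constant on each cycle, so invariant strings are
functions on the set of cycles. -/
theorem card_invariant_functions (n : Type) [Fintype n] [DecidableEq n]
    (σ : Equiv.Perm (Fin t)) :
    Fintype.card {f : Fin t → n // f ∘ σ = f} = Fintype.card n ^ numCycles σ := by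
  classical
  -- Cycle labels: a fixed point is its own label, any other point gets its cycle as a permutation.
  -- The sum type is needed because `cycleOf` is the identity at every fixed point and would not
  -- separate them.
  let g : Fin t → Equiv.Perm (Fin t) ⊕ Fin t := fun x =>
    if σ x = x then Sum.inr x else Sum.inl (σ.cycleOf x)
  have hg : ∀ x y, g x = g y ↔ σ.SameCycle x y := by
    intro x y
    constructor
    · intro h
      by_cases hx : σ x = x <;> by_cases hy : σ y = y
      · have : x = y := by simpa [g, hx, hy] using h
        rw [this]
      · simp [g, hx, hy] at h
      · simp [g, hx, hy] at h
      · have h' : σ.cycleOf x = σ.cycleOf y := by simpa [g, hx, hy] using h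
        by_contra hne
        have h1 := Equiv.Perm.cycleOf_apply_of_not_sameCycle (f := σ) (x := x) (y := y) hne
        rw [h', Equiv.Perm.cycleOf_apply_self] at h1
        exact hy h1
    · intro h
      by_cases hx : σ x = x
      · have hxy : x = y := by
          obtain ⟨i, hi⟩ := h
          rw [← hi, Function.IsFixedPt.perm_zpow hx i]
        rw [hxy]
      · have hy : σ y ≠ y := fun hy => hx ((h.apply_eq_self_iff).2 hy)
        simp [g, hx, hy, h.cycleOf_eq]
  have hrange : Fintype.card (Set.range g) = numCycles σ := by
    have h1 : (Set.range g).toFinset =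
        (σ.cycleFactorsFinset.map Function.Embedding.inl) ∪
          ((Finset.univ.filter fun x => σ x = x).map Function.Embedding.inr) := by
      ext z
      simp only [Set.mem_toFinset, Set.mem_range, Finset.mem_union, Finset.mem_map,
        Finset.mem_filter, Finset.mem_univ, true_and]
      constructor
      · rintro ⟨x, rfl⟩
        by_cases hx : σ x = x
        · exact Or.inr ⟨x, hx, by simp [g, hx]⟩
        · refine Or.inl ⟨σ.cycleOf x, ?_, by simp [g, hx]⟩
          rw [Equiv.Perm.cycleOf_mem_cycleFactorsFinset_iff]
          simpa using hx
      · rintro (⟨c, hc, rfl⟩ | ⟨x, hx, rfl⟩)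
        · obtain ⟨x, hx⟩ := (Equiv.Perm.mem_cycleFactorsFinset_iff.1 hc).1.nonempty_support
          refine ⟨x, ?_⟩
          have hx' : σ x ≠ x := by
            have := Equiv.Perm.mem_cycleFactorsFinset_support_le hc hx
            simpa using this
          have : c = σ.cycleOf x := Equiv.Perm.cycle_is_cycleOf hx hc
          simp [g, hx', this]
        · exact ⟨x, by simp [g, hx]⟩
    rw [← Set.toFinset_card, h1, Finset.card_union_of_disjoint, Finset.card_map, Finset.card_map]
    · rw [numCycles, Equiv.Perm.parts_partition, Multiset.card_add, Multiset.card_replicate,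
        Equiv.Perm.cycleType_def, Multiset.card_map]
      congr 1
      rw [← Finset.card_compl]
      congr 1
      ext x
      simp
    · rw [Finset.disjoint_left]
      simp
  rw [← hrange, ← Fintype.card_fun]
  have hinv : ∀ f : Fin t → n, f ∘ σ = f → ∀ x y, σ.SameCycle x y → f x = f y := by
    intro f hf x y ⟨i, hi⟩
    rw [← hi]
    have hf' : ∀ z, f (σ z) = f z := fun z => congrFun hf z
    induction i using Int.induction_on generalizing y with
    | zero => simp
    | succ i ih =>
      rw [add_comm, _root_.zpow_add, zpow_one, Equiv.Perm.mul_apply, hf']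
      exact ih _ rfl
    | pred i ih =>
      rw [sub_eq_neg_add, _root_.zpow_add, Equiv.Perm.mul_apply, ih _ rfl,
        ← hf' ((σ ^ (-1 : ℤ)) _)]
      simp
  refine Fintype.card_congr
    { toFun := fun f z => f.1 z.2.choose
      invFun := fun h => ⟨fun x => h ⟨g x, x, rfl⟩, ?_⟩
      left_inv := ?_
      right_inv := ?_ }
  · ext x
    simp only [Function.comp_apply]
    congr 2
    exact (hg _ _).2 (Equiv.Perm.sameCycle_apply_left.2 (Equiv.Perm.SameCycle.refl σ x))
  · rintro ⟨f, hf⟩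
    ext x
    refine hinv f hf _ _ ((hg _ _).1 ?_)
    exact (⟨g x, x, rfl⟩ : Set.range g).2.choose_spec
  · intro h
    ext z
    exact congrArg h (Subtype.ext z.2.choose_spec)

theorem numCycles_inv (σ : Equiv.Perm (Fin t)) : numCycles σ⁻¹ = numCycles σ := by
  rw [numCycles, numCycles, Equiv.Perm.parts_partition, Equiv.Perm.parts_partition,
    Equiv.Perm.cycleType_inv, Equiv.Perm.support_inv]

theorem numCycles_conj (σ τ : Equiv.Perm (Fin t)) : numCycles (τ * σ * τ⁻¹) = numCycles σ := by
  rw [numCycles, numCycles, Equiv.Perm.parts_partition, Equiv.Perm.parts_partition,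
    Equiv.Perm.cycleType_conj, Equiv.Perm.card_support_conj]

theorem numCycles_mul_comm (σ τ : Equiv.Perm (Fin t)) : numCycles (τ * σ) = numCycles (σ * τ) := by
  rw [← numCycles_conj (σ * τ) τ]
  congr 1
  group

end Cycles

/-! ### The Gram matrix and its pseudo-inverse. -/

section Weingarten

variable {t : ℕ} (D : ℕ)

theorem permGram_isHermitian : (permGram t D).IsHermitian := by
  ext σ τ
  simp only [permGram, Matrix.conjTranspose_apply, Matrix.of_apply, star_pow, star_natCast]
  rw [← numCycles_inv, show (τ * σ⁻¹)⁻¹ = σ * τ⁻¹ by group]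

theorem permGram_isSelfAdjoint : IsSelfAdjoint (permGram t D) := permGram_isHermitian D

/-- The functional calculus turns this into `x * x⁻¹ * x = x`, which holds at 0 too because `0⁻¹ =
0`; no invertibility of the Gram matrix is needed. -/
theorem permGram_cfc_permGram :
    permGram t D * cfc (fun x : ℝ => x⁻¹) (permGram t D) * permGram t D = permGram t D := by
  -- The spectrum is finite, so even `x⁻¹` is continuous on it when 0 is an eigenvalue.
  have hc : ∀ f : ℝ → ℝ, ContinuousOn f (spectrum ℝ (permGram t D)) := fun f => by
    rw [(permGram_isHermitian D).spectrum_real_eq_range_eigenvalues]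
    exact (Set.finite_range _).continuousOn f
  have hs := permGram_isSelfAdjoint (t := t) D
  have h1 : permGram t D = cfc (fun x : ℝ => x) (permGram t D) := (cfc_id' ℝ _).symm
  have h2 : cfc (fun x : ℝ => x) (permGram t D) * cfc (fun x : ℝ => x⁻¹) (permGram t D) *
      cfc (fun x : ℝ => x) (permGram t D) = cfc (fun x : ℝ => x) (permGram t D) := by
    rw [← cfc_mul _ _ _ (hc _) (hc _), ← cfc_mul _ _ _ (hc _) (hc _)]
    simp
  rwa [← h1] at h2

/-- Right translation on the symmetric group commutes with the Gram matrix, hence with every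
function of it; the pseudo-inverse is therefore translation invariant and determined by its column
at 1. -/
theorem Wg_mul_inv (σ τ : Equiv.Perm (Fin t)) :
    Wg (σ * τ⁻¹) D = cfc (fun x : ℝ => x⁻¹) (permGram t D) σ τ := by
  let R : Matrix (Equiv.Perm (Fin t)) (Equiv.Perm (Fin t)) ℂ :=
    Matrix.of fun α β => if α * τ = β then 1 else 0
  have h1 : ∀ (M : Matrix (Equiv.Perm (Fin t)) (Equiv.Perm (Fin t)) ℂ) (α β), (M * R) α β =
      M α (β * τ⁻¹) := by
    intro M α β
    simp [R, Matrix.mul_apply, ← eq_mul_inv_iff_mul_eq]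
  have h2 : ∀ (M : Matrix (Equiv.Perm (Fin t)) (Equiv.Perm (Fin t)) ℂ) (α β), (R * M) α β =
      M (α * τ) β := by
    intro M α β
    simp [R, Matrix.mul_apply]
  have hR : Commute (permGram t D) R := by
    ext α β
    rw [h1, h2]
    simp [permGram, mul_assoc]
  have h := congrFun (congrFun (hR.cfc_real (fun x : ℝ => x⁻¹)).eq (σ * τ⁻¹)) τ
  rw [h1, h2] at h
  simpa [Wg] using h

/-- The Gram matrix commutes with the permutation matrix of `σ ↦ σ⁻¹`, because the cycle number is
invariant under inversion and conjugation; so does its pseudo-inverse. -/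
theorem Wg_inv (σ : Equiv.Perm (Fin t)) : Wg σ⁻¹ D = Wg σ D := by
  let R : Matrix (Equiv.Perm (Fin t)) (Equiv.Perm (Fin t)) ℂ :=
    Matrix.of fun α β => if α⁻¹ = β then 1 else 0
  have h1 : ∀ (M : Matrix (Equiv.Perm (Fin t)) (Equiv.Perm (Fin t)) ℂ) (α β), (M * R) α β =
      M α β⁻¹ := by
    intro M α β
    simp [R, Matrix.mul_apply, inv_eq_iff_eq_inv]
  have h2 : ∀ (M : Matrix (Equiv.Perm (Fin t)) (Equiv.Perm (Fin t)) ℂ) (α β), (R * M) α β =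
      M α⁻¹ β := by
    intro M α β
    simp [R, Matrix.mul_apply]
  have hR : Commute (permGram t D) R := by
    ext α β
    rw [h1, h2]
    simp only [permGram, Matrix.of_apply]
    rw [inv_inv, ← numCycles_inv (α⁻¹ * β⁻¹), show (α⁻¹ * β⁻¹)⁻¹ = β * α by group,
      numCycles_mul_comm]
  have h := congrFun (congrFun (hR.cfc_real (fun x : ℝ => x⁻¹)).eq σ) 1
  rw [h1, h2] at h
  simpa [Wg] using h.symm

end Weingarten

/-! ### Haar twirls and polynomial moments of unitary entries. -/

section HaarMoments

variable {n : Type} [Fintype n] [DecidableEq n] {t : ℕ}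

instance isMulLeftInvariant_unitaryHaar : (unitaryHaar n).IsMulLeftInvariant := by
  unfold unitaryHaar
  infer_instance

theorem integrable_unitaryHaar {f : Matrix.unitaryGroup n ℂ → ℂ} (hf : Continuous f) :
    Integrable f (unitaryHaar n) :=
  hf.integrable_of_hasCompactSupport (HasCompactSupport.of_compactSpace f)

theorem continuous_unitary_entry (i j : n) :
    Continuous fun U : Matrix.unitaryGroup n ℂ => (U : Matrix n n ℂ) i j :=
  (continuous_subtype_val (p := fun M : Matrix n n ℂ => M ∈ Matrix.unitaryGroup n ℂ)).matrix_elem i j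

theorem continuous_tpow_entry (p q : Fin t → n) :
    Continuous fun U : Matrix.unitaryGroup n ℂ => tpow t (U : Matrix n n ℂ) p q := by
  simp only [tpow, Matrix.of_apply]
  exact continuous_finsetProd _ fun _ _ => continuous_unitary_entry _ _

/-- The twirl `∫ U^{⊗ t} X (U^{⊗ t})† dU`. -/
def haarTwirl (X : Matrix (Fin t → n) (Fin t → n) ℂ) : Matrix (Fin t → n) (Fin t → n) ℂ :=
  Matrix.of fun p q => ∫ U : Matrix.unitaryGroup n ℂ,
    (tpow t (U : Matrix n n ℂ) * X * (tpow t (U : Matrix n n ℂ))ᴴ) p q ∂(unitaryHaar n)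

theorem continuous_twirl_entry (X : Matrix (Fin t → n) (Fin t → n) ℂ) (p q : Fin t → n) :
    Continuous fun U : Matrix.unitaryGroup n ℂ =>
      (tpow t (U : Matrix n n ℂ) * X * (tpow t (U : Matrix n n ℂ))ᴴ) p q := by
  simp only [Matrix.mul_apply, Matrix.conjTranspose_apply]
  exact continuous_finsetSum _ fun _ _ => (continuous_finsetSum _ fun _ _ =>
    (continuous_tpow_entry _ _).mul continuous_const).mul (continuous_tpow_entry _ _).star

theorem mul_haarTwirl_mul (A B X : Matrix (Fin t → n) (Fin t → n) ℂ) (p q : Fin t → n) :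
    (A * haarTwirl X * B) p q = ∫ U : Matrix.unitaryGroup n ℂ,
      (A * (tpow t (U : Matrix n n ℂ) * X * (tpow t (U : Matrix n n ℂ))ᴴ) * B) p q
        ∂(unitaryHaar n) := by
  have hi := fun a b => integrable_unitaryHaar (continuous_twirl_entry X a b)
  simp only [Matrix.mul_apply (M := A * _), Matrix.mul_apply (M := A)]
  rw [integral_finsetSum _ fun b _ => (integrable_finsetSum _ fun a _ =>
    (hi a b).const_mul _).mul_const _]
  refine Finset.sum_congr rfl fun b _ => ?_
  rw [integral_mul_const, integral_finsetSum _ fun a _ => (hi a b).const_mul _]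
  congr 1
  refine Finset.sum_congr rfl fun a _ => ?_
  rw [integral_const_mul]
  rfl

theorem conjTranspose_tpow_mul {V : Matrix n n ℂ} (hV : V ∈ Matrix.unitaryGroup n ℂ) :
    (tpow t V)ᴴ * tpow t V = 1 := by
  rw [← tpow_conjTranspose, ← tpow_mul, ← Matrix.star_eq_conjTranspose,
    Matrix.mem_unitaryGroup_iff'.1 hV, tpow_one]

/-- Left invariance of Haar measure: conjugating the twirl by `V^{⊗ t}` translates the integration
variable. -/
theorem haarTwirl_commute (X : Matrix (Fin t → n) (Fin t → n) ℂ) {V : Matrix n n ℂ}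
    (hV : V ∈ Matrix.unitaryGroup n ℂ) : Commute (haarTwirl X) (tpow t V) := by
  have h : tpow t V * haarTwirl X * (tpow t V)ᴴ = haarTwirl X := by
    ext p q
    rw [mul_haarTwirl_mul]
    have := integral_mul_left_eq_self (μ := unitaryHaar n)
      (fun U : Matrix.unitaryGroup n ℂ =>
        (tpow t (U : Matrix n n ℂ) * X * (tpow t (U : Matrix n n ℂ))ᴴ) p q) ⟨V, hV⟩
    simp only [haarTwirl, Matrix.of_apply]
    rw [← this]
    congr 1
    ext U
    simp only [Submonoid.coe_mul, tpow_mul, Matrix.conjTranspose_mul, Matrix.mul_assoc]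
  rw [Commute, SemiconjBy]
  conv_lhs => rw [← h]
  rw [Matrix.mul_assoc, conjTranspose_tpow_mul hV, mul_one]

/-- The sum is the trace against the permutation operator of `σ⁻¹`. That operator commutes with
`U^{⊗ t}`, so the conjugation cancels by cyclicity of the trace. -/
theorem sum_permMat_haarTwirl (σ : Equiv.Perm (Fin t)) (X : Matrix (Fin t → n) (Fin t → n) ℂ) :
    ∑ p, haarTwirl X (p ∘ σ) p = ∑ p, X (p ∘ σ) p := by
  have h1 : ∀ Y : Matrix (Fin t → n) (Fin t → n) ℂ,
      ∑ p, Y (p ∘ σ) p = (permMat n σ⁻¹ * Y).trace := by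
    intro Y
    simp only [Matrix.trace, Matrix.diag, permMat_mul_apply]
    rfl
  have h2 : (permMat n σ⁻¹ * haarTwirl X).trace =
      ∫ U : Matrix.unitaryGroup n ℂ, (permMat n σ⁻¹ * (tpow t (U : Matrix n n ℂ) * X *
        (tpow t (U : Matrix n n ℂ))ᴴ)).trace ∂(unitaryHaar n) := by
    simp only [Matrix.trace, Matrix.diag, permMat_mul_apply]
    rw [integral_finsetSum _ fun p _ => integrable_unitaryHaar (continuous_twirl_entry X _ _)]
    rfl
  rw [h1, h1, h2]
  have h3 : ∀ U : Matrix.unitaryGroup n ℂ, (permMat n σ⁻¹ * (tpow t (U : Matrix n n ℂ) * X *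
        (tpow t (U : Matrix n n ℂ))ᴴ)).trace = (permMat n σ⁻¹ * X).trace := by
    intro U
    rw [← Matrix.mul_assoc, ← Matrix.mul_assoc, (permMat_commute_tpow σ⁻¹ _).eq,
      Matrix.trace_mul_comm, ← Matrix.mul_assoc, ← Matrix.mul_assoc,
      conjTranspose_tpow_mul U.2, one_mul]
  simp only [h3, integral_const, probReal_univ, one_smul]

theorem sum_permMat_permMat (σ τ : Equiv.Perm (Fin t)) :
    ∑ p, permMat n τ (p ∘ σ) p = permGram t (Fintype.card n) σ τ := by
  have h : ∀ p : Fin t → n, p ∘ σ = p ∘ τ ↔ p ∘ ⇑(σ * τ⁻¹) = p := by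
    intro p
    constructor
    · intro h
      rw [Equiv.Perm.coe_mul, ← Function.comp_assoc, h]
      ext
      simp
    · intro h
      conv_rhs => rw [← h]
      ext
      simp
  simp only [permMat, Matrix.of_apply, permGram, h]
  rw [Finset.sum_boole, ← Nat.cast_pow, ← card_invariant_functions n, Fintype.card_subtype]

open ComplexOrder in
-- If `c` is any coefficient vector of the twirl, the traces of `X` against permutations are `G c`.
-- The Weingarten coefficients are `W G c`, which differ from `c` by an element of the kernel of `G`
-- and so define the same operator.
theorem haarTwirl_eq (X : Matrix (Fin t → n) (Fin t → n) ℂ) :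
    haarTwirl X = ∑ τ : Equiv.Perm (Fin t), (∑ σ : Equiv.Perm (Fin t),
      Wg (σ * τ⁻¹) (Fintype.card n) * ∑ p, X (p ∘ σ) p) • permMat n τ := by
  set G := permGram t (Fintype.card n) with hG
  set W := cfc (fun x : ℝ => x⁻¹) G with hW
  obtain ⟨c, hc⟩ := (Submodule.mem_span_range_iff_exists_fun ℂ).1
    (mem_span_permMat (A := haarTwirl X) fun U hU => haarTwirl_commute X hU)
  have hv : ∀ (c : Equiv.Perm (Fin t) → ℂ) (σ : Equiv.Perm (Fin t)),
      ∑ p, (∑ τ, c τ • permMat n τ) (p ∘ σ) p = (G *ᵥ c) σ := by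
    intro c σ
    simp only [Matrix.sum_apply, Matrix.smul_apply, smul_eq_mul]
    rw [Finset.sum_comm]
    simp only [← Finset.mul_sum, sum_permMat_permMat, Matrix.mulVec, dotProduct]
    exact Finset.sum_congr rfl fun τ _ => mul_comm _ _
  have hX : (fun σ : Equiv.Perm (Fin t) => ∑ p, X (p ∘ σ) p) = G *ᵥ c := by
    ext σ
    rw [← sum_permMat_haarTwirl, ← hc, hv]
  have hcoef : (fun τ => ∑ σ : Equiv.Perm (Fin t),
      Wg (σ * τ⁻¹) (Fintype.card n) * ∑ p, X (p ∘ σ) p) = W *ᵥ (G *ᵥ c) := by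
    ext τ
    rw [← hX]
    simp only [Matrix.mulVec, dotProduct]
    refine Finset.sum_congr rfl fun σ _ => ?_
    rw [← Wg_inv, hW, hG, ← Wg_mul_inv, show (σ * τ⁻¹)⁻¹ = τ * σ⁻¹ by group]
  have hker : G *ᵥ (W *ᵥ (G *ᵥ c) - c) = 0 := by
    rw [Matrix.mulVec_sub, Matrix.mulVec_mulVec, Matrix.mulVec_mulVec, hW, hG,
      permGram_cfc_permGram, sub_self]
  -- A vector in the kernel gives an operator `M` orthogonal to all permutation operators; lying in
  -- their span, `M` has zero Hilbert-Schmidt norm.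
  have hzero : ∀ e : Equiv.Perm (Fin t) → ℂ, G *ᵥ e = 0 → ∑ τ, e τ • permMat n τ = 0 := by
    intro e he
    set M := ∑ τ, e τ • permMat n τ with hM
    have h1 : ∀ σ : Equiv.Perm (Fin t), ∑ p, M (p ∘ σ) p = 0 := fun σ => by rw [hv, he]; rfl
    have h2 : (Mᴴ * M).trace = 0 := by
      have h3 : ∀ σ : Equiv.Perm (Fin t), ((permMat n σ)ᴴ * M).trace = ∑ p, M (p ∘ σ) p := by
        intro σ
        simp [Matrix.trace, Matrix.mul_apply, permMat]
      conv_lhs => rw [hM, Matrix.conjTranspose_sum, Finset.sum_mul, Matrix.trace_sum]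
      refine Finset.sum_eq_zero fun σ _ => ?_
      rw [Matrix.conjTranspose_smul, Matrix.smul_mul, Matrix.trace_smul, ← hM, h3, h1, smul_zero]
    exact Matrix.trace_conjTranspose_mul_self_eq_zero_iff.1 h2
  have hfin := hzero _ hker
  simp only [Pi.sub_apply, sub_smul, Finset.sum_sub_distrib, sub_eq_zero] at hfin
  rw [← hc, ← hfin]
  exact Finset.sum_congr rfl fun τ _ => by rw [← hcoef]

/-- These are the entries of the twirl of a single matrix unit. -/
theorem integral_prod_unitary (p p' q q' : Fin t → n) :
    ∫ U : Matrix.unitaryGroup n ℂ, ∏ k, ((U : Matrix n n ℂ) (p k) (q k) *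
        star ((U : Matrix n n ℂ) (p' k) (q' k))) ∂(unitaryHaar n) =
      ∑ σ : Equiv.Perm (Fin t), ∑ τ : Equiv.Perm (Fin t), Wg (σ * τ⁻¹) (Fintype.card n) *
        ((if q = q' ∘ σ then 1 else 0) * (if p = p' ∘ τ then 1 else 0)) := by
  have h := congrFun (congrFun (haarTwirl_eq (Matrix.single q q' (1 : ℂ))) p) p'
  have h1 : ∀ σ : Equiv.Perm (Fin t), ∑ r, Matrix.single q q' (1 : ℂ) (r ∘ σ) r =
      if q = q' ∘ σ then 1 else 0 := by
    intro σ
    rw [Finset.sum_eq_single q' (fun r _ hr => by simp [hr.symm])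
      (by simp)]
    simp [Matrix.single_apply]
  simp only [h1, haarTwirl, Matrix.of_apply, Matrix.sum_apply, Matrix.smul_apply, smul_eq_mul,
    permMat, Finset.sum_mul] at h
  rw [Finset.sum_comm]
  simp only [← mul_assoc]
  rw [← h]
  congr 1
  ext U
  simp [Matrix.mul_apply, Matrix.single_apply, tpow, Finset.prod_mul_distrib, ite_and, star_prod]

end HaarMoments

/-! ### Moments of unistochastic channels and the Choi matrix formula. -/

section Moments

variable {n e : Type} [Fintype n] [DecidableEq n] [Fintype e] [DecidableEq e] {t : ℕ}

theorem superOp_ext {Φ Ψ : SuperOp n}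
    (h : ∀ a b, Φ (Matrix.single a b 1) = Ψ (Matrix.single a b 1)) : Φ = Ψ := by
  refine Matrix.ext_linearMap _ fun a b => LinearMap.ext_ring ?_
  exact h a b

theorem unistochastic_single (U : Matrix (n × e) (n × e) ℂ) (a b i j : n) :
    unistochastic U (Matrix.single a b 1) i j =
      (Fintype.card e : ℂ)⁻¹ * ∑ l, ∑ m, U (i, l) (a, m) * star (U (j, l) (b, m)) := by
  simp only [unistochastic, LinearMap.coe_mk, AddHom.coe_mk, traceEnv, Matrix.of_apply,
    Matrix.mul_apply, Matrix.conjTranspose_apply, Fintype.sum_prod_type, Matrix.kroneckerMap_apply,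
    Matrix.single_apply, Matrix.smul_apply, Matrix.one_apply, smul_eq_mul, Finset.mul_sum]
  refine Finset.sum_congr rfl fun l _ => ?_
  rw [Finset.sum_eq_single b (fun x _ hx => by simp [hx.symm]) (by simp)]
  refine Finset.sum_congr rfl fun m _ => ?_
  rw [Finset.sum_eq_single a (fun x _ hx => by simp [hx.symm]) (by simp)]
  simp
  ring

theorem tensorPow_apply (Φ : SuperOp n) (X : Matrix (Fin t → n) (Fin t → n) ℂ) (i j : Fin t → n) :
    tensorPow t Φ X i j =
      ∑ a, ∑ b, X a b * ∏ k, Φ (Matrix.single (a k) (b k) 1) (i k) (j k) := rfl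

theorem tensorPow_single (Φ : SuperOp n) (a b i j : Fin t → n) :
    tensorPow t Φ (Matrix.single a b 1) i j =
      ∏ k, Φ (Matrix.single (a k) (b k) 1) (i k) (j k) := by
  simp [tensorPow_apply, Matrix.single_apply, ite_and]

theorem prod_unistochastic_single (U : Matrix (n × e) (n × e) ℂ) (a b i j : Fin t → n) :
    ∏ k, unistochastic U (Matrix.single (a k) (b k) 1) (i k) (j k) =
      ((Fintype.card e : ℂ) ^ t)⁻¹ * ∑ l : Fin t → e, ∑ m : Fin t → e,
        ∏ k, (U (i k, l k) (a k, m k) * star (U (j k, l k) (b k, m k))) := by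
  simp only [unistochastic_single]
  rw [Finset.prod_mul_distrib, Finset.prod_const, Finset.card_univ, Fintype.card_fin, inv_pow]
  congr 1
  simp only [Finset.prod_univ_sum, Fintype.piFinset_univ]

theorem unistochastic_unitaryTensorPow (U : Matrix (n × e) (n × e) ℂ) :
    unistochastic (unitaryTensorPow t U) = tensorPow t (unistochastic U) := by
  refine superOp_ext fun a b => ?_
  ext i j
  rw [tensorPow_single, prod_unistochastic_single, unistochastic_single, Fintype.card_fun,
    Fintype.card_fin, Nat.cast_pow]
  simp [unitaryTensorPow, Finset.prod_mul_distrib]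

/-- The environment strings `l` and `m` occur both in the `U` and in the conjugate factors, so the
delta functions constrain them to be invariant under `τ` and `σ`. Summing over them yields the two
powers of `d`. -/
theorem integral_prod_unistochastic {d : ℕ} (a b i j : Fin t → Fin d) :
    ∫ U : Matrix.unitaryGroup (Fin d × Fin d) ℂ,
      ∏ k, unistochastic (U : Matrix (Fin d × Fin d) (Fin d × Fin d) ℂ)
        (Matrix.single (a k) (b k) 1) (i k) (j k) ∂(unitaryHaar (Fin d × Fin d)) =
      ((d : ℂ) ^ t)⁻¹ * ∑ σ : Equiv.Perm (Fin t), ∑ τ : Equiv.Perm (Fin t),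
        Wg (σ * τ⁻¹) (d ^ 2) * (d : ℂ) ^ (numCycles σ + numCycles τ) *
          ((if a = b ∘ σ then 1 else 0) * (if i = j ∘ τ then 1 else 0)) := by
  simp only [prod_unistochastic_single, Fintype.card_fin]
  have hcont : ∀ l m : Fin t → Fin d, Integrable
      (fun U : Matrix.unitaryGroup (Fin d × Fin d) ℂ => ∏ k,
        ((U : Matrix (Fin d × Fin d) (Fin d × Fin d) ℂ) (i k, l k) (a k, m k) *
          star ((U : Matrix (Fin d × Fin d) (Fin d × Fin d) ℂ) (j k, l k) (b k, m k))))
      (unitaryHaar (Fin d × Fin d)) := fun l m =>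
    integrable_unitaryHaar (continuous_finsetProd _ fun _ _ =>
      (continuous_unitary_entry _ _).mul (continuous_unitary_entry _ _).star)
  rw [integral_const_mul,
    integral_finsetSum _ fun l _ => integrable_finsetSum _ fun m _ => hcont l m]
  simp only [integral_finsetSum _ fun m _ => hcont _ m]
  congr 1
  have hmom := fun l m : Fin t → Fin d => integral_prod_unitary (fun k => (i k, l k))
    (fun k => (j k, l k)) (fun k => (a k, m k)) (fun k => (b k, m k))
  simp only [hmom]
  have hpair : ∀ (x y z : Fin t → Fin d) (σ : Equiv.Perm (Fin t)),
      (if (fun k => (x k, z k)) = (fun k => (y k, z k)) ∘ σ then (1 : ℂ) else 0) =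
        (if x = y ∘ σ then 1 else 0) * (if z ∘ σ = z then 1 else 0) := by
    intro x y z σ
    rw [ite_zero_mul_ite_zero, mul_one]
    refine if_congr ?_ rfl rfl
    simp only [funext_iff, Function.comp_apply, Prod.mk.injEq, forall_and]
    exact and_congr Iff.rfl ⟨fun h k => (h k).symm, fun h k => (h k).symm⟩
  have hcount : ∀ σ : Equiv.Perm (Fin t),
      ∑ z : Fin t → Fin d, (if z ∘ σ = z then (1 : ℂ) else 0) = (d : ℂ) ^ numCycles σ := by
    intro σ
    have := card_invariant_functions (Fin d) σ
    rw [Finset.sum_boole, ← Fintype.card_subtype, this, Fintype.card_fin, Nat.cast_pow]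
  simp only [hpair, Fintype.card_prod, Fintype.card_fin, ← pow_two]
  have hswap : ∀ F : (Fin t → Fin d) → (Fin t → Fin d) → Equiv.Perm (Fin t) →
      Equiv.Perm (Fin t) → ℂ, ∑ l, ∑ m, ∑ σ, ∑ τ, F l m σ τ = ∑ σ, ∑ τ, ∑ l, ∑ m, F l m σ τ := by
    intro F
    simp only [← Fintype.sum_prod_type']
    exact Fintype.sum_equiv
      ⟨fun x => (x.2.2.1, x.2.2.2, x.1, x.2.1), fun x => (x.2.2.1, x.2.2.2, x.1, x.2.1),
        fun _ => rfl, fun _ => rfl⟩ _ _ fun _ => rfl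
  rw [hswap]
  refine Finset.sum_congr rfl fun σ _ => Finset.sum_congr rfl fun τ _ => ?_
  rw [pow_add, ← hcount σ, ← hcount τ, mul_assoc, Finset.sum_mul_sum, Finset.sum_comm,
    Finset.sum_mul, Finset.mul_sum]
  refine Finset.sum_congr rfl fun m _ => ?_
  rw [Finset.sum_mul, Finset.mul_sum]
  refine Finset.sum_congr rfl fun l _ => ?_
  ring

theorem integral_choi_tensorPow {d : ℕ} (a b i j : Fin t → Fin d) :
    ∫ U : Matrix.unitaryGroup (Fin d × Fin d) ℂ,
      choi (tensorPow t (unistochastic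
        (U : Matrix (Fin d × Fin d) (Fin d × Fin d) ℂ))) (i, a) (j, b)
          ∂(unitaryHaar (Fin d × Fin d)) =
      ((d : ℂ) ^ (2 * t))⁻¹ *
        ∑ σ : Equiv.Perm (Fin t), ∑ τ : Equiv.Perm (Fin t),
          Wg (σ * τ⁻¹) (d ^ 2) * (d : ℂ) ^ (numCycles σ + numCycles τ) *
            ∏ n : Fin t,
              ((if a n = b (σ n) then (1 : ℂ) else 0) * (if i n = j (τ n) then (1 : ℂ) else 0)) := by
  simp only [choi, Matrix.of_apply, tensorPow_single]
  rw [integral_const_mul, integral_prod_unistochastic, Fintype.card_fun, Fintype.card_fin,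
    Fintype.card_fin, Nat.cast_pow, ← mul_assoc, ← mul_inv, ← pow_add, ← two_mul]
  congr 1
  refine Finset.sum_congr rfl fun σ _ => Finset.sum_congr rfl fun τ _ => ?_
  congr 1
  rw [Finset.prod_mul_distrib, Finset.prod_ite_zero, Finset.prod_ite_zero]
  simp [funext_iff]

theorem integral_unistochastic_unitaryTensorPow {d : ℕ}
    (ρ : Matrix (Fin t → Fin d) (Fin t → Fin d) ℂ) (i j : Fin t → Fin d) :
    ∫ U : Matrix.unitaryGroup (Fin d × Fin d) ℂ,
        unistochastic (unitaryTensorPow t (U : Matrix (Fin d × Fin d) (Fin d × Fin d) ℂ)) ρ i j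
          ∂(unitaryHaar (Fin d × Fin d)) =
      ∑ a, ∑ b, ρ a b * ∫ U : Matrix.unitaryGroup (Fin d × Fin d) ℂ,
        ∏ k, unistochastic (U : Matrix (Fin d × Fin d) (Fin d × Fin d) ℂ)
          (Matrix.single (a k) (b k) 1) (i k) (j k) ∂(unitaryHaar (Fin d × Fin d)) := by
  have hint : ∀ a b : Fin t → Fin d, Integrable
      (fun U : Matrix.unitaryGroup (Fin d × Fin d) ℂ => ρ a b *
        ∏ k, unistochastic (U : Matrix (Fin d × Fin d) (Fin d × Fin d) ℂ)
          (Matrix.single (a k) (b k) 1) (i k) (j k)) (unitaryHaar (Fin d × Fin d)) := by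
    intro a b
    refine integrable_unitaryHaar (continuous_const.mul (continuous_finsetProd _ fun k _ => ?_))
    simp only [unistochastic_single]
    exact continuous_const.mul (continuous_finsetSum _ fun l _ => continuous_finsetSum _ fun m _ =>
      (continuous_unitary_entry _ _).mul (continuous_unitary_entry _ _).star)
  simp only [unistochastic_unitaryTensorPow, tensorPow_apply]
  rw [integral_finsetSum _ fun a _ => integrable_finsetSum _ fun b _ => hint a b]
  refine Finset.sum_congr rfl fun a _ => ?_
  rw [integral_finsetSum _ fun b _ => hint a b]
  exact Finset.sum_congr rfl fun b _ => integral_const_mul _ _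

end Moments

/-! ### Unitaries realising prescribed images of Pauli generators. -/

section Intertwiners

variable {m : Type} [Fintype m] [DecidableEq m]

theorem exists_mul_mul_ne_zero {A B : Matrix m m ℂ} (hA : A ≠ 0) (hB : B ≠ 0) :
    ∃ Q : Matrix m m ℂ, A * Q * B ≠ 0 := by
  obtain ⟨i, j, hij⟩ : ∃ i j, A i j ≠ 0 := by
    by_contra! h
    exact hA (by ext i j; exact h i j)
  obtain ⟨k, l, hkl⟩ : ∃ k l, B k l ≠ 0 := by
    by_contra! h
    exact hB (by ext i j; exact h i j)
  refine ⟨Matrix.single j k 1, fun h => mul_ne_zero hij hkl ?_⟩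
  have := congrFun (congrFun h i) l
  simpa [Matrix.mul_apply, Matrix.single_apply, ite_and] using this

/-- Extending an intertwiner of the `+1` eigenspaces of `Z` and `Z'` to an intertwiner of the
anticommuting pairs `(X, Z)` and `(X', Z')`. -/
theorem intertwiner_extend {Q X Z X' Z' : Matrix m m ℂ} (hQ : Q ≠ 0) (hX : X * X = 1)
    (hX' : X' * X' = 1) (hXZ : X * Z = -(Z * X)) (hXZ' : X' * Z' = -(Z' * X')) (hQZ : Q * Z = Q)
    (hZQ : Z' * Q = Q) :
    Q + X' * Q * X ≠ 0 ∧ (Q + X' * Q * X) * X = X' * (Q + X' * Q * X) ∧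
      (Q + X' * Q * X) * Z = Z' * (Q + X' * Q * X) := by
  have h1 : X' * Q * X * Z = -(X' * Q * X) := by
    rw [mul_assoc, hXZ, mul_neg, ← mul_assoc, mul_assoc X', hQZ]
  have h2 : Z' * (X' * Q * X) = -(X' * Q * X) := by
    have : Z' * X' = -(X' * Z') := by rw [hXZ', neg_neg]
    rw [← mul_assoc, ← mul_assoc, this, neg_mul, neg_mul, mul_assoc X', hZQ]
  refine ⟨fun h => hQ ?_, ?_, ?_⟩
  · have h3 : (Q + X' * Q * X) * (1 + Z) = (2 : ℂ) • Q := by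
      rw [mul_add, mul_one, add_mul, hQZ, h1, two_smul]
      abel
    rw [h, zero_mul] at h3
    exact (smul_eq_zero.1 h3.symm).resolve_left two_ne_zero
  · rw [add_mul, mul_add, mul_assoc (X' * Q), hX, mul_one, ← mul_assoc, ← mul_assoc, hX', one_mul,
      add_comm]
  · rw [add_mul, mul_add, hQZ, hZQ, h1, h2]

theorem intertwiner_extend_commute {Q X X' B B' : Matrix m m ℂ} (hB : X * B = B * X)
    (hB' : X' * B' = B' * X') (hQ : Q * B = B' * Q) :
    (Q + X' * Q * X) * B = B' * (Q + X' * Q * X) := by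
  rw [add_mul, mul_add, hQ, mul_assoc, hB, ← mul_assoc, mul_assoc X', hQ, ← mul_assoc, hB']
  simp only [mul_assoc]

theorem one_add_mul_of_sq_eq_one {Z : Matrix m m ℂ} (h : Z * Z = 1) : (1 + Z) * Z = 1 + Z := by
  rw [add_mul, h, one_mul, add_comm]

theorem mul_one_add_of_sq_eq_one {Z : Matrix m m ℂ} (h : Z * Z = 1) : Z * (1 + Z) = 1 + Z := by
  rw [mul_add, h, mul_one, add_comm]

theorem exists_intertwiner_pair [Nonempty m] {X Z X' Z' : Matrix m m ℂ} (hX : X * X = 1)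
    (hX' : X' * X' = 1) (hZ : Z * Z = 1) (hZ' : Z' * Z' = 1) (hXZ : X * Z = -(Z * X))
    (hXZ' : X' * Z' = -(Z' * X')) :
    ∃ C : Matrix m m ℂ, C ≠ 0 ∧ C * X = X' * C ∧ C * Z = Z' * C := by
  -- If the `+1` projector vanished, `Z` would be `-1` and could not anticommute with the invertible
  -- `X`.
  have hne : ∀ X Z : Matrix m m ℂ, X * X = 1 → X * Z = -(Z * X) → 1 + Z ≠ 0 := by
    intro X Z hX hXZ h
    have hZ1 : Z = -1 := (neg_eq_of_add_eq_zero_right h).symm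
    rw [hZ1, mul_neg, mul_one, neg_mul, one_mul, neg_neg] at hXZ
    have h2 : (2 : ℂ) • X = 0 := by rw [two_smul]; nth_rw 1 [← hXZ]; exact neg_add_cancel X
    rw [(smul_eq_zero.1 h2).resolve_left two_ne_zero, zero_mul] at hX
    exact zero_ne_one hX
  obtain ⟨Q₀, hQ₀⟩ := exists_mul_mul_ne_zero (hne X' Z' hX' hXZ') (hne X Z hX hXZ)
  obtain ⟨h1, h2, h3⟩ := intertwiner_extend hQ₀ hX hX' hXZ hXZ'
    (by rw [mul_assoc, one_add_mul_of_sq_eq_one hZ])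
    (by rw [← mul_assoc, ← mul_assoc, mul_one_add_of_sq_eq_one hZ'])
  exact ⟨_, h1, h2, h3⟩

/-- Start from a nonzero map between the joint `+1` eigenspaces of `(Z₁, Z₂)` and `(Z₁', Z₂')`, then
extend it first along the `X₁` pair and then along the `X₂` pair; the mutual commutation keeps the
first set of relations intact. -/
theorem exists_intertwiner_two_pairs [Nonempty m] {X₁ Z₁ X₂ Z₂ X₁' Z₁' X₂' Z₂' : Matrix m m ℂ}
    (hX₁ : X₁ * X₁ = 1) (hX₂ : X₂ * X₂ = 1) (hZ₁ : Z₁ * Z₁ = 1) (hZ₂ : Z₂ * Z₂ = 1)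
    (hX₁' : X₁' * X₁' = 1) (hX₂' : X₂' * X₂' = 1) (hZ₁' : Z₁' * Z₁' = 1) (hZ₂' : Z₂' * Z₂' = 1)
    (h₁ : X₁ * Z₁ = -(Z₁ * X₁)) (h₂ : X₂ * Z₂ = -(Z₂ * X₂))
    (h₁' : X₁' * Z₁' = -(Z₁' * X₁')) (h₂' : X₂' * Z₂' = -(Z₂' * X₂'))
    (hXX : X₂ * X₁ = X₁ * X₂) (hXZ : X₂ * Z₁ = Z₁ * X₂) (hZX : Z₂ * X₁ = X₁ * Z₂)
    (hZZ : Z₂ * Z₁ = Z₁ * Z₂)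
    (hXX' : X₂' * X₁' = X₁' * X₂') (hXZ' : X₂' * Z₁' = Z₁' * X₂') (hZX' : Z₂' * X₁' = X₁' * Z₂')
    (hZZ' : Z₂' * Z₁' = Z₁' * Z₂') :
    ∃ C : Matrix m m ℂ, C ≠ 0 ∧ C * X₁ = X₁' * C ∧ C * Z₁ = Z₁' * C ∧ C * X₂ = X₂' * C ∧
      C * Z₂ = Z₂' * C := by
  -- A matrix anticommuting with an involution is traceless. Hence `(1 + Z₁)(1 + Z₂)` has the trace
  -- of the identity and is nonzero.
  have htr : ∀ {A B : Matrix m m ℂ}, A * A = 1 → A * B = -(B * A) → B.trace = 0 := by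
    intro A B hA hAB
    have h : B = -(A * B * A) := by rw [hAB, neg_mul, neg_neg, mul_assoc, hA, mul_one]
    have h2 := congrArg Matrix.trace h
    rw [Matrix.trace_neg, Matrix.trace_mul_comm, ← mul_assoc, hA, one_mul] at h2
    exact self_eq_neg.1 h2
  have hne : ∀ {X₁ Z₁ X₂ Z₂ : Matrix m m ℂ}, X₁ * X₁ = 1 → X₂ * X₂ = 1 → X₁ * Z₁ = -(Z₁ * X₁) →
      X₂ * Z₂ = -(Z₂ * X₂) → Z₂ * X₁ = X₁ * Z₂ → (1 + Z₁) * (1 + Z₂) ≠ 0 := by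
    intro X₁ Z₁ X₂ Z₂ hX₁ hX₂ h₁ h₂ hZX h
    have h3 : X₁ * (Z₁ * Z₂) = -(Z₁ * Z₂ * X₁) := by
      rw [← mul_assoc, h₁, neg_mul, mul_assoc, mul_assoc, hZX]
    have h4 := congrArg Matrix.trace h
    rw [add_mul, mul_add, mul_add, one_mul, one_mul, mul_one, Matrix.trace_add, Matrix.trace_add,
      Matrix.trace_add, htr hX₁ h₁, htr hX₂ h₂, htr hX₁ h3, Matrix.trace_one] at h4
    simp at h4
  obtain ⟨Q₀, hQ₀⟩ := exists_mul_mul_ne_zero (hne hX₁' hX₂' h₁' h₂' hZX') (hne hX₁ hX₂ h₁ h₂ hZX)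
  set Q := (1 + Z₁') * (1 + Z₂') * Q₀ * ((1 + Z₁) * (1 + Z₂)) with hQ
  have hcomm : ∀ {Z₁ Z₂ : Matrix m m ℂ}, Z₂ * Z₁ = Z₁ * Z₂ →
      (1 + Z₁) * (1 + Z₂) = (1 + Z₂) * (1 + Z₁) := by
    intro Z₁ Z₂ h
    rw [add_mul, mul_add, mul_add, add_mul, mul_add, mul_add, h]
    simp only [one_mul, mul_one]
    abel
  have q2 : Q * Z₂ = Q := by rw [hQ, mul_assoc, mul_assoc (1 + Z₁), one_add_mul_of_sq_eq_one hZ₂]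
  have q1 : Q * Z₁ = Q := by rw [hQ, hcomm hZZ, mul_assoc, mul_assoc (1 + Z₂), one_add_mul_of_sq_eq_one hZ₁]
  have q1' : Z₁' * Q = Q := by
    simp only [hQ, ← mul_assoc, mul_one_add_of_sq_eq_one hZ₁']
  have q2' : Z₂' * Q = Q := by
    simp only [hQ, hcomm hZZ', ← mul_assoc, mul_one_add_of_sq_eq_one hZ₂']
  obtain ⟨t1, t2, t3⟩ := intertwiner_extend hQ₀ hX₁ hX₁' h₁ h₁' q1 q1'
  have t4 := intertwiner_extend_commute (Q := Q) (X := X₁) (X' := X₁') hZX.symm hZX'.symm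
    (q2.trans q2'.symm)
  set T := Q + X₁' * Q * X₁ with hT
  have t5 : T * Z₂ = T := by
    rw [hT, add_mul, q2, mul_assoc, ← hZX, ← mul_assoc, mul_assoc X₁', q2]
  obtain ⟨c1, c2, c3⟩ := intertwiner_extend t1 hX₂ hX₂' h₂ h₂' t5 (t4.symm.trans t5)
  exact ⟨_, c1, intertwiner_extend_commute hXX hXX' t2,
    intertwiner_extend_commute hXZ hXZ' t3, c2, c3⟩

/-- A nonzero intertwiner of irreducible families of Hermitian matrices can be rescaled to be
special unitary. -/
theorem exists_specialUnitary_smul [Nonempty m] {ι : Type*} {A A' : ι → Matrix m m ℂ}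
    (hA : ∀ i, (A i).IsHermitian) (hA' : ∀ i, (A' i).IsHermitian)
    (hirr : ∀ M : Matrix m m ℂ, (∀ i, M * A i = A i * M) → ∃ c : ℂ, M = c • 1)
    {C : Matrix m m ℂ} (hC : C ≠ 0) (hCA : ∀ i, C * A i = A' i * C) :
    ∃ c : ℂ, c • C ∈ Matrix.specialUnitaryGroup m ℂ := by
  have hCA' : ∀ i, A i * Cᴴ = Cᴴ * A' i := by
    intro i
    have := congrArg Matrix.conjTranspose (hCA i)
    rwa [Matrix.conjTranspose_mul, Matrix.conjTranspose_mul, (hA i).eq, (hA' i).eq] at this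
  -- Schur's lemma: `Cᴴ C` commutes with the source family because `Cᴴ` intertwines backwards. The
  -- scalar is the squared norm of any column, positive because `C ≠ 0`.
  obtain ⟨r, hr⟩ := hirr (Cᴴ * C) fun i => by
    rw [mul_assoc, hCA, ← mul_assoc, ← hCA', mul_assoc]
  have hdiag : ∀ j, r = ((∑ i, ‖C i j‖ ^ 2 : ℝ) : ℂ) := by
    intro j
    have := congrFun (congrFun hr j) j
    simp only [Matrix.mul_apply, Matrix.conjTranspose_apply, Matrix.smul_apply, Matrix.one_apply_eq,
      smul_eq_mul, mul_one] at this
    rw [← this]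
    push_cast
    exact Finset.sum_congr rfl fun i _ => Complex.conj_mul' _
  obtain ⟨i, j, hij⟩ : ∃ i j, C i j ≠ 0 := by
    by_contra! h
    exact hC (by ext i j; exact h i j)
  set s : ℝ := ∑ i, ‖C i j‖ ^ 2 with hs
  have hs0 : 0 < s := Finset.sum_pos' (fun i _ => by positivity) ⟨i, Finset.mem_univ _, by positivity⟩
  have hU : ((Real.sqrt s : ℂ)⁻¹ • C) ∈ Matrix.unitaryGroup m ℂ := by
    rw [Matrix.mem_unitaryGroup_iff', Matrix.star_eq_conjTranspose, Matrix.conjTranspose_smul,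
      Matrix.smul_mul, Matrix.mul_smul, hr, hdiag j, smul_smul, smul_smul]
    have h1 : star (Real.sqrt s : ℂ)⁻¹ = (Real.sqrt s : ℂ)⁻¹ := by
      rw [Complex.star_def, map_inv₀, Complex.conj_ofReal]
    have h2 : (Real.sqrt s : ℂ) * Real.sqrt s = s := by
      rw [← Complex.ofReal_mul, Real.mul_self_sqrt hs0.le]
    have h3 : (Real.sqrt s : ℂ) ≠ 0 := by
      exact_mod_cast (Real.sqrt_pos.2 hs0).ne'
    rw [h1, ← h2]
    field_simp
    simp
  set U := (Real.sqrt s : ℂ)⁻¹ • C with hUdef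
  have hdet : ‖U.det‖ = 1 := CStarRing.norm_of_mem_unitary (Matrix.det_of_mem_unitary hU)
  -- A root of the inverse determinant, of order the dimension, normalises the determinant to 1; it
  -- has modulus 1 and so preserves unitarity.
  obtain ⟨z, hz⟩ := IsAlgClosed.exists_pow_nat_eq (U.det)⁻¹ (Fintype.card_pos (α := m))
  have hz1 : ‖z‖ = 1 := by
    have : ‖z‖ ^ Fintype.card m = 1 := by rw [← norm_pow, hz, norm_inv, hdet, inv_one]
    exact (pow_eq_one_iff_of_nonneg (norm_nonneg z) Fintype.card_ne_zero).1 this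
  refine ⟨z * (Real.sqrt s : ℂ)⁻¹, ?_⟩
  rw [mul_smul, ← hUdef, Matrix.mem_specialUnitaryGroup_iff]
  constructor
  · rw [Matrix.mem_unitaryGroup_iff', Matrix.star_eq_conjTranspose, Matrix.conjTranspose_smul,
      Matrix.smul_mul, Matrix.mul_smul, smul_smul, ← Matrix.star_eq_conjTranspose,
      Matrix.mem_unitaryGroup_iff'.1 hU, Complex.star_def, Complex.conj_mul', hz1]
    simp
  · rw [Matrix.det_smul, hz, inv_mul_cancel₀]
    intro h
    rw [h, norm_zero] at hdet
    exact zero_ne_one hdet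

theorem specialUnitary_mul_conjTranspose {C : Matrix m m ℂ}
    (hC : C ∈ Matrix.specialUnitaryGroup m ℂ) : C * Cᴴ = 1 :=
  Matrix.mem_unitaryGroup_iff.1 (Matrix.mem_specialUnitaryGroup_iff.1 hC).1

theorem specialUnitary_conjTranspose_mul {C : Matrix m m ℂ}
    (hC : C ∈ Matrix.specialUnitaryGroup m ℂ) : Cᴴ * C = 1 :=
  Matrix.mem_unitaryGroup_iff'.1 (Matrix.mem_specialUnitaryGroup_iff.1 hC).1

theorem conj_eq_iff {C A B : Matrix m m ℂ} (hC : C ∈ Matrix.specialUnitaryGroup m ℂ) :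
    C * A * Cᴴ = B ↔ C * A = B * C := by
  constructor
  · rintro rfl
    rw [mul_assoc _ Cᴴ, specialUnitary_conjTranspose_mul hC, mul_one]
  · intro h
    rw [h, mul_assoc, specialUnitary_mul_conjTranspose hC, mul_one]

/-- Special unitary matrices with the same adjoint action on an irreducible family define the same
unitary channel. -/
theorem unitaryChannel_eq_of_conj_eq {ι : Type*} {A : ι → Matrix m m ℂ}
    (hirr : ∀ M : Matrix m m ℂ, (∀ i, M * A i = A i * M) → ∃ c : ℂ, M = c • 1)
    {C C' : Matrix m m ℂ} (hC : C ∈ Matrix.specialUnitaryGroup m ℂ)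
    (hC' : C' ∈ Matrix.specialUnitaryGroup m ℂ)
    (h : ∀ i, C * A i * Cᴴ = C' * A i * C'ᴴ) : unitaryChannel C = unitaryChannel C' := by
  -- Schur's lemma again: the two matrices differ by a scalar, which unitarity forces to be a phase,
  -- invisible to conjugation.
  obtain ⟨c, hc⟩ := hirr (C'ᴴ * C) fun i => by
    have h1 := (conj_eq_iff hC).1 (h i)
    rw [mul_assoc, h1]
    simp only [← mul_assoc]
    rw [specialUnitary_conjTranspose_mul hC', one_mul]
  have hCC : C = c • C' := by
    have := congrArg (C' * ·) hc
    simp only [← mul_assoc, specialUnitary_mul_conjTranspose hC', one_mul] at this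
    rw [this, Matrix.mul_smul, mul_one]
  have hn : Nonempty m ∨ IsEmpty m := (isEmpty_or_nonempty m).symm
  refine LinearMap.ext fun ρ => ?_
  rcases hn with hn | hn
  · have hcc : c * star c = 1 := by
      have h1 := specialUnitary_mul_conjTranspose hC
      rw [hCC, Matrix.conjTranspose_smul, Matrix.smul_mul, Matrix.mul_smul, smul_smul,
        specialUnitary_mul_conjTranspose hC'] at h1
      have := congrFun (congrFun h1 (Classical.arbitrary m)) (Classical.arbitrary m)
      simpa using this
    simp only [unitaryChannel, LinearMap.coe_mk, AddHom.coe_mk]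
    rw [hCC, Matrix.conjTranspose_smul, Matrix.smul_mul, Matrix.smul_mul, Matrix.mul_smul, smul_smul,
      hcc, one_smul]
  · ext i
    exact hn.elim i

end Intertwiners

/-! ### Pauli matrices and signed two-qubit Pauli labels. -/

section Pauli

/-- The Pauli matrices, in the order `1`, `σ_x`, `σ_z`, `σ_y`. -/
def pauli : Fin 4 → Matrix (Fin 2) (Fin 2) ℂ :=
  ![1, pauliX, pauliZ, !![0, -Complex.I; Complex.I, 0]]

/-- The index of the product of two Pauli matrices, up to phase. -/
def pauliIdx : Fin 4 → Fin 4 → Fin 4 :=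
  ![![0, 1, 2, 3], ![1, 0, 3, 2], ![2, 3, 0, 1], ![3, 2, 1, 0]]

/-- The power of `i` in the product of two Pauli matrices. -/
def pauliPhase : Fin 4 → Fin 4 → ℕ :=
  ![![0, 0, 0, 0], ![0, 0, 3, 1], ![0, 1, 0, 3], ![0, 3, 1, 0]]

theorem pauli_mul (a b : Fin 4) :
    pauli a * pauli b = Complex.I ^ pauliPhase a b • pauli (pauliIdx a b) := by
  fin_cases a <;> fin_cases b <;> ext i j <;> fin_cases i <;> fin_cases j <;>
    simp [pauli, pauliIdx, pauliPhase, pauliX, pauliZ, Complex.I_pow_three]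

theorem pauli_isHermitian (a : Fin 4) : (pauli a)ᴴ = pauli a := by
  fin_cases a <;> ext i j <;> fin_cases i <;> fin_cases j <;> simp [pauli, pauliX, pauliZ]

theorem pauli_mul_self (a : Fin 4) : pauli a * pauli a = 1 := by
  rw [pauli_mul]
  fin_cases a <;> simp [pauliIdx, pauliPhase, pauli]

theorem trace_pauli (a : Fin 4) : (pauli a).trace = if a = 0 then 2 else 0 := by
  fin_cases a <;> simp [pauli, pauliX, pauliZ, Matrix.trace, Fin.sum_univ_two]

theorem trace_pauli_mul (a b : Fin 4) :
    (pauli a * pauli b).trace = if a = b then 2 else 0 := by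
  rw [pauli_mul, Matrix.trace_smul, trace_pauli]
  fin_cases a <;> fin_cases b <;> simp [pauliIdx, pauliPhase]

theorem pauli_mul_comm (a b : Fin 4) :
    pauli a * pauli b = (-1 : ℂ) ^ pauliPhase a b • (pauli b * pauli a) := by
  rw [pauli_mul, pauli_mul, smul_smul]
  fin_cases a <;> fin_cases b <;> simp [pauliIdx, pauliPhase, Complex.I_pow_three] <;> norm_num

/-- The sign `±1` given by a Boolean. -/
def sgn (s : Bool) : ℂ := if s then -1 else 1

theorem sgn_mul_self (s : Bool) : sgn s * sgn s = 1 := by cases s <;> simp [sgn]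

theorem star_sgn (s : Bool) : star (sgn s) = sgn s := by cases s <;> simp [sgn]

theorem sgn_ne_zero (s : Bool) : sgn s ≠ 0 := by cases s <;> simp [sgn]

theorem sgn_injective : Function.Injective sgn := by
  intro s s' h
  cases s <;> cases s' <;> simp [sgn] at h ⊢
  · norm_num at h
  · norm_num at h

/-- Labels of the Hermitian elements of the two-qubit Pauli group: a sign and two Pauli indices. -/
abbrev SignedPauli : Type := Bool × Fin 4 × Fin 4

/-- The Hermitian two-qubit Pauli operator with a given label. -/
def SignedPauli.mat (x : SignedPauli) : Matrix (Fin 2 × Fin 2) (Fin 2 × Fin 2) ℂ :=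
  sgn x.1 • (pauli x.2.1 ⊗ₖ pauli x.2.2)

/-- The power of `i` in the product of two signed Pauli operators, signs not counted. -/
def SignedPauli.phase (x y : SignedPauli) : ℕ :=
  pauliPhase x.2.1 y.2.1 + pauliPhase x.2.2 y.2.2

/-- Whether two signed Pauli operators anticommute. -/
def SignedPauli.anti (x y : SignedPauli) : Bool := x.phase y % 2 == 1

/-- The label of `i x y`, for anticommuting `x` and `y`. -/
def SignedPauli.third (x y : SignedPauli) : SignedPauli :=
  (xor (xor x.1 y.1) ((1 + x.phase y) % 4 == 2), pauliIdx x.2.1 y.2.1, pauliIdx x.2.2 y.2.2)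

theorem SignedPauli.mat_isHermitian (x : SignedPauli) : x.mat.IsHermitian := by
  rw [Matrix.IsHermitian, SignedPauli.mat, Matrix.conjTranspose_smul,
    Matrix.conjTranspose_kronecker, pauli_isHermitian, pauli_isHermitian, star_sgn]

theorem SignedPauli.mat_mul (x y : SignedPauli) : x.mat * y.mat =
    (sgn x.1 * sgn y.1 * Complex.I ^ x.phase y) •
      (pauli (pauliIdx x.2.1 y.2.1) ⊗ₖ pauli (pauliIdx x.2.2 y.2.2)) := by
  rw [SignedPauli.mat, SignedPauli.mat, Matrix.smul_mul, Matrix.mul_smul,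
    ← Matrix.mul_kronecker_mul, pauli_mul, pauli_mul, Matrix.smul_kronecker,
    Matrix.kronecker_smul, smul_smul, smul_smul, smul_smul, SignedPauli.phase, pow_add]
  congr 1
  ring

theorem SignedPauli.mat_mul_self (x : SignedPauli) : x.mat * x.mat = 1 := by
  rw [SignedPauli.mat, Matrix.smul_mul, Matrix.mul_smul, ← Matrix.mul_kronecker_mul,
    pauli_mul_self, pauli_mul_self, smul_smul, sgn_mul_self, one_smul, Matrix.one_kronecker_one]

theorem SignedPauli.mat_mul_comm (x y : SignedPauli) :
    x.mat * y.mat = (-1 : ℂ) ^ x.phase y • (y.mat * x.mat) := by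
  simp only [SignedPauli.mat, Matrix.smul_mul, Matrix.mul_smul, ← Matrix.mul_kronecker_mul]
  rw [pauli_mul_comm x.2.1, pauli_mul_comm x.2.2, Matrix.smul_kronecker, Matrix.kronecker_smul,
    SignedPauli.phase, pow_add]
  simp only [smul_smul]
  congr 1
  ring

theorem SignedPauli.mat_anticommute {x y : SignedPauli} (h : x.anti y = true) :
    x.mat * y.mat = -(y.mat * x.mat) := by
  have : Odd (x.phase y) := Nat.odd_iff.2 (by simpa [SignedPauli.anti] using h)
  rw [SignedPauli.mat_mul_comm, this.neg_one_pow, neg_one_smul]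

theorem SignedPauli.mat_commute {x y : SignedPauli} (h : x.anti y = false) :
    x.mat * y.mat = y.mat * x.mat := by
  have : Even (x.phase y) := Nat.even_iff.2 (by simpa [SignedPauli.anti] using h)
  rw [SignedPauli.mat_mul_comm, this.neg_one_pow, one_smul]

theorem SignedPauli.mat_mul_ne_zero (x y : SignedPauli) : x.mat * y.mat ≠ 0 := by
  intro h
  have h2 := congrArg (x.mat * · * y.mat) h
  simp only [← mul_assoc, x.mat_mul_self, one_mul, y.mat_mul_self, mul_zero, zero_mul] at h2
  exact one_ne_zero h2

theorem SignedPauli.anti_iff (x y : SignedPauli) :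
    x.anti y = true ↔ x.mat * y.mat = -(y.mat * x.mat) := by
  refine ⟨SignedPauli.mat_anticommute, fun h => ?_⟩
  by_contra hc
  have h1 := SignedPauli.mat_commute (Bool.eq_false_iff.2 hc)
  have h2 : (2 : ℂ) • (x.mat * y.mat) = 0 := by
    rw [two_smul]
    nth_rw 1 [h]
    rw [h1, neg_add_cancel]
  exact SignedPauli.mat_mul_ne_zero x y ((smul_eq_zero.1 h2).resolve_left two_ne_zero)

theorem SignedPauli.mat_third {x y : SignedPauli} (h : x.anti y = true) :
    (x.third y).mat = Complex.I • (x.mat * y.mat) := by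
  rw [SignedPauli.mat_mul, SignedPauli.mat, SignedPauli.third, smul_smul]
  congr 1
  have h1 : x.phase y % 2 = 1 := by simpa [SignedPauli.anti] using h
  have h2 : Complex.I * (sgn x.1 * sgn y.1 * Complex.I ^ x.phase y) =
      sgn x.1 * sgn y.1 * Complex.I ^ (1 + x.phase y) := by ring
  have h3 : Complex.I ^ (1 + x.phase y) = sgn ((1 + x.phase y) % 4 == 2) := by
    -- Anticommutation means that the phase exponent is odd, so the additional factor `i` leaves a
    -- genuine sign; this is what makes `third` well labelled.
    have h4 : (1 + x.phase y) % 4 = 0 ∨ (1 + x.phase y) % 4 = 2 := by omega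
    rw [Complex.I_pow_eq_pow_mod]
    rcases h4 with h4 | h4 <;> simp [h4, sgn]
  rw [h2, h3]
  generalize ((1 + x.phase y) % 4 == 2) = s
  cases x.1 <;> cases y.1 <;> cases s <;> simp [sgn]

theorem trace_kronecker_pauli_mul (a b a' b' : Fin 4) :
    ((pauli a ⊗ₖ pauli b) * (pauli a' ⊗ₖ pauli b')).trace =
      if a = a' ∧ b = b' then 4 else 0 := by
  rw [← Matrix.mul_kronecker_mul, Matrix.trace_kronecker, trace_pauli_mul, trace_pauli_mul]
  split_ifs <;> simp_all
  norm_num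

/-- Trace orthogonality of the Pauli basis recovers the indices, and then the sign. -/
theorem SignedPauli.mat_injective : Function.Injective SignedPauli.mat := by
  rintro ⟨s, a, b⟩ ⟨s', a', b'⟩ h
  have h1 := congrArg (fun M => (M * (pauli a ⊗ₖ pauli b)).trace) h
  simp only [SignedPauli.mat, Matrix.smul_mul, Matrix.trace_smul, trace_kronecker_pauli_mul,
    and_self, if_true, smul_eq_mul] at h1
  split_ifs at h1 with hab
  · obtain ⟨rfl, rfl⟩ := hab
    rw [sgn_injective (mul_right_cancel₀ (by norm_num : (4 : ℂ) ≠ 0) h1)]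
  · rw [mul_zero] at h1
    exact absurd h1 (mul_ne_zero (sgn_ne_zero s) (by norm_num))

/-- An odd power of `i` would make the multiple anti-Hermitian. Since conjugation by a unitary
preserves Hermiticity, only signs need tracking for images of Hermitian Paulis. -/
theorem isHermitian_I_pow_smul {m : Type} {A : Matrix m m ℂ} (hA : A.IsHermitian) (hA0 : A ≠ 0)
    {l : ℕ} (h : (Complex.I ^ l • A).IsHermitian) : ∃ s, Complex.I ^ l = sgn s := by
  rw [Matrix.IsHermitian, Matrix.conjTranspose_smul, hA.eq, ← sub_eq_zero, ← sub_smul] at h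
  have h1 := sub_eq_zero.1 ((smul_eq_zero.1 h).resolve_right hA0)
  rw [star_pow, Complex.star_def, Complex.conj_I] at h1
  have h3 : l % 4 < 4 := Nat.mod_lt _ (by norm_num)
  have h5 : (-Complex.I) ^ l = (-1) ^ l * Complex.I ^ l := by rw [← mul_pow, neg_one_mul]
  rcases Nat.even_or_odd l with he | ho
  · rw [Complex.I_pow_eq_pow_mod]
    have h4 : l % 4 = 0 ∨ l % 4 = 2 := by
      have := Nat.even_iff.1 he
      omega
    rcases h4 with h4 | h4
    · exact ⟨false, by simp [h4, sgn]⟩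
    · exact ⟨true, by simp [h4, sgn]⟩
  · rw [h5, ho.neg_one_pow, neg_one_mul] at h1
    exact absurd (neg_eq_self.1 h1) (pow_ne_zero _ Complex.I_ne_zero)

end Pauli

/-! ### The Clifford groups in terms of Pauli indices. -/

section Reindex

theorem reindex_cliffordSet {m m' : Type} [Fintype m] [DecidableEq m] [Fintype m'] [DecidableEq m']
    (e : m ≃ m') (G : Set (Matrix m m ℂ)) :
    Matrix.reindex e e '' {C | C ∈ Matrix.specialUnitaryGroup m ℂ ∧ ∀ P ∈ G, C * P * Cᴴ ∈ G} =
      {C | C ∈ Matrix.specialUnitaryGroup m' ℂ ∧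
        ∀ P ∈ Matrix.reindex e e '' G, C * P * Cᴴ ∈ Matrix.reindex e e '' G} := by
  have hmul : ∀ A B : Matrix m m ℂ, Matrix.reindex e e (A * B) =
      Matrix.reindex e e A * Matrix.reindex e e B := fun A B => by
    simp [Matrix.submatrix_mul_equiv]
  have hstar : ∀ A : Matrix m m ℂ, Matrix.reindex e e Aᴴ = (Matrix.reindex e e A)ᴴ := fun A => rfl
  have hone : Matrix.reindex e e (1 : Matrix m m ℂ) = 1 := by simp
  have hinj := (Matrix.reindex e e : Matrix m m ℂ ≃ Matrix m' m' ℂ).injective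
  have hSU : ∀ C : Matrix m m ℂ, Matrix.reindex e e C ∈ Matrix.specialUnitaryGroup m' ℂ ↔
      C ∈ Matrix.specialUnitaryGroup m ℂ := by
    intro C
    rw [Matrix.mem_specialUnitaryGroup_iff, Matrix.mem_specialUnitaryGroup_iff,
      Matrix.det_reindex_self, Matrix.mem_unitaryGroup_iff, Matrix.mem_unitaryGroup_iff,
      Matrix.star_eq_conjTranspose, Matrix.star_eq_conjTranspose, ← hstar, ← hmul, ← hone,
      hinj.eq_iff]
  ext C'
  obtain ⟨C, rfl⟩ := (Matrix.reindex e e : Matrix m m ℂ ≃ Matrix m' m' ℂ).surjective C'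
  rw [hinj.mem_set_image, Set.mem_ofPred_eq, Set.mem_ofPred_eq, hSU, Set.forall_mem_image]
  simp only [← hstar, ← hmul, hinj.mem_set_image]

theorem pauliX_pow_mul_pauliZ_pow (j k : Fin 2) : ∃ (l : ℕ) (a : Fin 4),
    pauliX ^ (j : ℕ) * pauliZ ^ (k : ℕ) = Complex.I ^ l • pauli a := by
  fin_cases j <;> fin_cases k
  · exact ⟨0, 0, by simp [pauli]⟩
  · exact ⟨0, 2, by simp [pauli]⟩
  · exact ⟨0, 1, by simp [pauli]⟩
  · refine ⟨3, 3, ?_⟩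
    have := pauli_mul 1 2
    simpa [pauliPhase, pauliIdx, pauli] using this

theorem pauli_eq_pauliX_pow_mul_pauliZ_pow (a : Fin 4) : ∃ (l : ℕ) (j k : Fin 2),
    pauli a = Complex.I ^ l • (pauliX ^ (j : ℕ) * pauliZ ^ (k : ℕ)) := by
  fin_cases a
  · exact ⟨0, 0, 0, by simp [pauli]⟩
  · exact ⟨0, 1, 0, by simp [pauli]⟩
  · exact ⟨0, 0, 1, by simp [pauli]⟩
  · refine ⟨1, 1, 1, ?_⟩
    have := pauli_mul 1 2
    simp only [pauliPhase, pauliIdx] at this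
    simp only [pauli] at this ⊢
    simp at this ⊢
    rw [this]
    ext i j
    fin_cases i <;> fin_cases j <;> simp

theorem I_pow_eq_fin (l : ℕ) : ∃ l' : Fin 4, Complex.I ^ l = Complex.I ^ (l' : ℕ) :=
  ⟨⟨l % 4, Nat.mod_lt _ (by norm_num)⟩, Complex.I_pow_eq_pow_mod l⟩

theorem reindex_pauliGroup_one :
    Matrix.reindex (Equiv.funUnique (Fin 1) (Fin 2)) (Equiv.funUnique (Fin 1) (Fin 2)) ''
      pauliGroup 1 = {P | ∃ (l : ℕ) (a : Fin 4), P = Complex.I ^ l • pauli a} := by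
  have hre : ∀ (l : Fin 4) (j k : Fin 1 → Fin 2),
      Matrix.reindex (Equiv.funUnique (Fin 1) (Fin 2)) (Equiv.funUnique (Fin 1) (Fin 2))
        (Complex.I ^ (l : ℕ) • Matrix.of fun x y => ∏ a,
          (pauliX ^ (j a : ℕ) * pauliZ ^ (k a : ℕ)) (x a) (y a)) =
        Complex.I ^ (l : ℕ) • (pauliX ^ (j 0 : ℕ) * pauliZ ^ (k 0 : ℕ)) := by
    intro l j k
    ext x y
    simp [Equiv.funUnique]
  ext P
  constructor
  · rintro ⟨_, ⟨l, j, k, rfl⟩, rfl⟩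
    obtain ⟨l', a, h⟩ := pauliX_pow_mul_pauliZ_pow (j 0) (k 0)
    exact ⟨l + l', a, by rw [hre, h, smul_smul, pow_add]⟩
  · rintro ⟨l, a, rfl⟩
    obtain ⟨l', j, k, h⟩ := pauli_eq_pauliX_pow_mul_pauliZ_pow a
    obtain ⟨l'', hl⟩ := I_pow_eq_fin (l + l')
    refine ⟨_, ⟨l'', fun _ => j, fun _ => k, rfl⟩, ?_⟩
    rw [hre, h, smul_smul, ← pow_add, hl]

theorem reindex_pauliGroup_two :
    Matrix.reindex (finTwoArrowEquiv (Fin 2)) (finTwoArrowEquiv (Fin 2)) '' pauliGroup 2 =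
      {P | ∃ (l : ℕ) (a b : Fin 4), P = Complex.I ^ l • (pauli a ⊗ₖ pauli b)} := by
  have hre : ∀ (l : Fin 4) (j k : Fin 2 → Fin 2),
      Matrix.reindex (finTwoArrowEquiv (Fin 2)) (finTwoArrowEquiv (Fin 2))
        (Complex.I ^ (l : ℕ) • Matrix.of fun x y => ∏ a,
          (pauliX ^ (j a : ℕ) * pauliZ ^ (k a : ℕ)) (x a) (y a)) =
        Complex.I ^ (l : ℕ) • ((pauliX ^ (j 0 : ℕ) * pauliZ ^ (k 0 : ℕ)) ⊗ₖ
          (pauliX ^ (j 1 : ℕ) * pauliZ ^ (k 1 : ℕ))) := by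
    intro l j k
    ext x y
    simp [finTwoArrowEquiv, Fin.prod_univ_two]
  ext P
  constructor
  · rintro ⟨_, ⟨l, j, k, rfl⟩, rfl⟩
    obtain ⟨l', a, h⟩ := pauliX_pow_mul_pauliZ_pow (j 0) (k 0)
    obtain ⟨l'', b, h'⟩ := pauliX_pow_mul_pauliZ_pow (j 1) (k 1)
    exact ⟨l + l' + l'', a, b, by
      rw [hre, h, h', Matrix.smul_kronecker, Matrix.kronecker_smul, smul_smul, smul_smul, pow_add,
        pow_add, mul_assoc]⟩
  · rintro ⟨l, a, b, rfl⟩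
    obtain ⟨l', j, k, h⟩ := pauli_eq_pauliX_pow_mul_pauliZ_pow a
    obtain ⟨l'', j', k', h'⟩ := pauli_eq_pauliX_pow_mul_pauliZ_pow b
    obtain ⟨l₀, hl⟩ := I_pow_eq_fin (l + l' + l'')
    refine ⟨_, ⟨l₀, ![j, j'], ![k, k'], rfl⟩, ?_⟩
    rw [hre, h, h', Matrix.smul_kronecker, Matrix.kronecker_smul, smul_smul, smul_smul, ← hl,
      pow_add, pow_add, mul_assoc]
    rfl

theorem mem_cliffordOne_iff {C : Matrix (Fin 2) (Fin 2) ℂ} :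
    C ∈ cliffordOne ↔ C ∈ Matrix.specialUnitaryGroup (Fin 2) ℂ ∧
      ∀ (l : ℕ) (a : Fin 4), ∃ (l' : ℕ) (a' : Fin 4),
        C * (Complex.I ^ l • pauli a) * Cᴴ = Complex.I ^ l' • pauli a' := by
  rw [cliffordOne, cliffordGroup, reindex_cliffordSet, reindex_pauliGroup_one]
  refine and_congr Iff.rfl ⟨fun h l a => h _ ⟨l, a, rfl⟩, ?_⟩
  rintro h _ ⟨l, a, rfl⟩
  exact h l a

theorem mem_cliffordTwo_iff {C : Matrix (Fin 2 × Fin 2) (Fin 2 × Fin 2) ℂ} :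
    C ∈ cliffordTwo ↔ C ∈ Matrix.specialUnitaryGroup (Fin 2 × Fin 2) ℂ ∧
      ∀ (l : ℕ) (a b : Fin 4), ∃ (l' : ℕ) (a' b' : Fin 4),
        C * (Complex.I ^ l • (pauli a ⊗ₖ pauli b)) * Cᴴ =
          Complex.I ^ l' • (pauli a' ⊗ₖ pauli b') := by
  rw [cliffordTwo, cliffordGroup, reindex_cliffordSet, reindex_pauliGroup_two]
  refine and_congr Iff.rfl ⟨fun h l a b => h _ ⟨l, a, b, rfl⟩, ?_⟩
  rintro h _ ⟨l, a, b, rfl⟩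
  exact h l a b

end Reindex

/-! ### Unital qubit maps encoded by Bloch columns. -/

section Bloch

/-- Signed Pauli matrices on one qubit and the zero matrix. -/
abbrev BlochColumn : Type := Option (Bool × Fin 3)

/-- The matrix with a given label. -/
def BlochColumn.mat : BlochColumn → Matrix (Fin 2) (Fin 2) ℂ
  | none => 0
  | some x => sgn x.1 • pauli x.2.succ

theorem BlochColumn.mat_injective : Function.Injective BlochColumn.mat := by
  have hne : ∀ x : Bool × Fin 3, BlochColumn.mat (some x) ≠ 0 := by
    intro x h
    have h1 := congrArg (fun M => (M * pauli x.2.succ).trace) h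
    simp only [BlochColumn.mat, Matrix.smul_mul, Matrix.trace_smul, trace_pauli_mul, if_true,
      zero_mul, Matrix.trace_zero, smul_eq_mul] at h1
    exact mul_ne_zero (sgn_ne_zero _) two_ne_zero h1
  rintro (_ | ⟨s, q⟩) (_ | ⟨s', q'⟩) h
  · rfl
  · exact absurd h.symm (hne _)
  · exact absurd h (hne _)
  · have h1 := congrArg (fun M => (M * pauli q.succ).trace) h
    simp only [BlochColumn.mat, Matrix.smul_mul, Matrix.trace_smul, trace_pauli_mul, if_true,
      smul_eq_mul] at h1
    split_ifs at h1 with hq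
    · rw [Fin.succ_inj] at hq
      rw [hq, sgn_injective (mul_right_cancel₀ two_ne_zero h1)]
    · rw [mul_zero] at h1
      exact absurd h1 (mul_ne_zero (sgn_ne_zero s) two_ne_zero)

/-- The unital trace-preserving map sending the Pauli matrix `p + 1` to column `p` of `c`. -/
def blochMap (c : Fin 3 → BlochColumn) : SuperOp (Fin 2) where
  toFun ρ := (1 / 2 : ℂ) • (ρ.trace • 1 + ∑ p, (pauli p.succ * ρ).trace • (c p).mat)
  map_add' ρ ρ' := by
    simp only [mul_add, Matrix.trace_add, add_smul, Finset.sum_add_distrib, smul_add]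
    abel
  map_smul' r ρ := by
    simp only [Matrix.mul_smul, Matrix.trace_smul, smul_eq_mul, mul_smul, ← Finset.smul_sum,
      ← smul_add, RingHom.id_apply]
    rw [smul_comm]

theorem blochMap_apply (c : Fin 3 → BlochColumn) (ρ : Matrix (Fin 2) (Fin 2) ℂ) :
    blochMap c ρ = (1 / 2 : ℂ) • (ρ.trace • 1 + ∑ p, (pauli p.succ * ρ).trace • (c p).mat) := rfl

theorem blochMap_pauli_succ (c : Fin 3 → BlochColumn) (p : Fin 3) :
    blochMap c (pauli p.succ) = (c p).mat := by
  rw [blochMap_apply, trace_pauli, if_neg (Fin.succ_ne_zero p), zero_smul, zero_add,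
    Finset.sum_eq_single p, trace_pauli_mul, if_pos rfl, smul_smul]
  · norm_num
  · intro q _ hq
    rw [trace_pauli_mul, if_neg (by rwa [Fin.succ_inj]), zero_smul]
  · simp

theorem blochMap_injective : Function.Injective blochMap := by
  intro c c' h
  ext1 p
  refine BlochColumn.mat_injective ?_
  rw [← blochMap_pauli_succ, h, blochMap_pauli_succ]

/-- Completeness of the Pauli basis; it makes a unital linear map determined by its values on the
three nontrivial Paulis. -/
theorem matrix_eq_sum_pauli (ρ : Matrix (Fin 2) (Fin 2) ℂ) :
    ρ = (1 / 2 : ℂ) • (ρ.trace • 1 + ∑ p : Fin 3, (pauli p.succ * ρ).trace • pauli p.succ) := by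
  have h1 : (pauli 1 * ρ).trace = ρ 1 0 + ρ 0 1 := by
    simp only [Matrix.trace, Matrix.diag_apply, Matrix.mul_apply, Fin.sum_univ_two]
    simp [pauli, pauliX]
  have h2 : (pauli 2 * ρ).trace = ρ 0 0 - ρ 1 1 := by
    simp only [Matrix.trace, Matrix.diag_apply, Matrix.mul_apply, Fin.sum_univ_two]
    simp [pauli, pauliZ, sub_eq_add_neg]
  have h3 : (pauli 3 * ρ).trace = Complex.I * (ρ 0 1 - ρ 1 0) := by
    simp only [Matrix.trace, Matrix.diag_apply, Matrix.mul_apply, Fin.sum_univ_two]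
    simp [pauli]
    ring
  rw [Fin.sum_univ_three, show (Fin.succ 0 : Fin 4) = 1 from rfl,
    show (Fin.succ 1 : Fin 4) = 2 from rfl, show (Fin.succ 2 : Fin 4) = 3 from rfl, h1, h2, h3,
    Matrix.trace_fin_two]
  ext i j
  fin_cases i <;> fin_cases j <;> simp [pauli, pauliX, pauliZ]
  · ring
  · linear_combination (1 / 2 : ℂ) * (ρ 0 1 - ρ 1 0) * Complex.I_sq
  · linear_combination (-1 / 2 : ℂ) * (ρ 0 1 - ρ 1 0) * Complex.I_sq
  · ring

theorem eq_blochMap {Φ : SuperOp (Fin 2)} {c : Fin 3 → BlochColumn} (h1 : Φ 1 = 1)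
    (h : ∀ p : Fin 3, Φ (pauli p.succ) = (c p).mat) : Φ = blochMap c := by
  refine LinearMap.ext fun ρ => ?_
  conv_lhs => rw [matrix_eq_sum_pauli ρ]
  simp only [map_smul, map_add, map_sum, h1, h, blochMap_apply]

end Bloch

/-! ### Tableaux of two-qubit Clifford unitaries and their channels. -/

section TwoQubits

/-- The label of the partial trace over the environment of a signed Pauli operator. -/
def SignedPauli.column (x : SignedPauli) : BlochColumn :=
  if x.2.2 = 0 then
    (![none, some 0, some 1, some 2] x.2.1 : Option (Fin 3)).map fun q => (x.1, q)
  else none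

/-- The Bloch columns of the channel defined by a Clifford unitary with
`σ_x ⊗ 1 ↦ x`, `σ_z ⊗ 1 ↦ z`. -/
def blochCode (x z : SignedPauli) : Fin 3 → BlochColumn :=
  ![x.column, z.column, (x.third z).column]

theorem traceEnv_kronecker (A B : Matrix (Fin 2) (Fin 2) ℂ) :
    traceEnv (A ⊗ₖ B) = B.trace • A := by
  ext i j
  simp [traceEnv, Matrix.trace, Fin.sum_univ_two]
  ring

theorem traceEnv_smul (c : ℂ) (M : Matrix (Fin 2 × Fin 2) (Fin 2 × Fin 2) ℂ) :
    traceEnv (c • M) = c • traceEnv M := by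
  ext i j
  simp [traceEnv, mul_add]

/-- Only operators trivial on the environment survive the partial trace. The identity is excluded
because its label yields the zero column although its partial trace is nonzero. -/
theorem SignedPauli.traceEnv_mat (x : SignedPauli) (hx : x.2 ≠ (0, 0)) :
    traceEnv x.mat = (2 : ℂ) • x.column.mat := by
  obtain ⟨s, a, b⟩ := x
  rw [SignedPauli.mat, traceEnv_smul, traceEnv_kronecker, trace_pauli, SignedPauli.column]
  by_cases hb : b = 0
  · subst hb
    simp only [if_true]
    rw [smul_comm]
    congr 1
    fin_cases a
    · exact absurd rfl hx
    · rfl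
    · rfl
    · rfl
  · simp [hb, BlochColumn.mat]

theorem SignedPauli.ne_one_of_anti {x z : SignedPauli} (h : x.anti z = true) :
    x.2 ≠ (0, 0) ∧ z.2 ≠ (0, 0) ∧ (x.third z).2 ≠ (0, 0) := by
  obtain ⟨s, a, b⟩ := x
  obtain ⟨s', a', b'⟩ := z
  revert h
  simp only [SignedPauli.anti, SignedPauli.third, SignedPauli.phase]
  revert a b a' b'
  decide +kernel

/-- The image of σ_y needs no separate datum: σ_y = i σ_x σ_z, so it is the `third` of the other two
images. -/
theorem blochMap_of_images {C : Matrix (Fin 2 × Fin 2) (Fin 2 × Fin 2) ℂ}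
    (hC : C ∈ Matrix.specialUnitaryGroup (Fin 2 × Fin 2) ℂ) {x z : SignedPauli}
    (hxz : x.anti z = true) (hX : C * (pauli 1 ⊗ₖ 1) * Cᴴ = x.mat)
    (hZ : C * (pauli 2 ⊗ₖ 1) * Cᴴ = z.mat) : unistochastic C = blochMap (blochCode x z) := by
  obtain ⟨h1, h2, h3⟩ := SignedPauli.ne_one_of_anti hxz
  have happ : ∀ ρ, unistochastic C ρ = (1 / 2 : ℂ) • traceEnv (C * (ρ ⊗ₖ 1) * Cᴴ) := by
    intro ρ
    simp only [unistochastic, LinearMap.coe_mk, AddHom.coe_mk, Fintype.card_fin,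
      Matrix.kronecker_smul, Matrix.mul_smul, Matrix.smul_mul, traceEnv_smul]
    norm_num
  have hhalf : ∀ x : SignedPauli, x.2 ≠ (0, 0) →
      (1 / 2 : ℂ) • traceEnv x.mat = x.column.mat := by
    intro x hx
    rw [x.traceEnv_mat hx, smul_smul]
    norm_num
  have hY : C * (pauli 3 ⊗ₖ 1) * Cᴴ = (x.third z).mat := by
    have h4 : pauli 3 ⊗ₖ (1 : Matrix (Fin 2) (Fin 2) ℂ) =
        Complex.I • ((pauli 1 ⊗ₖ 1) * (pauli 2 ⊗ₖ 1)) := by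
      rw [← Matrix.mul_kronecker_mul, pauli_mul, ← Matrix.smul_kronecker, smul_smul, one_mul,
        ← pow_succ']
      simp [pauliPhase, pauliIdx]
    rw [SignedPauli.mat_third hxz, h4, ← hX, ← hZ, Matrix.mul_smul, Matrix.smul_mul]
    congr 1
    simp only [mul_assoc]
    rw [← mul_assoc Cᴴ C, specialUnitary_conjTranspose_mul hC, one_mul]
  refine eq_blochMap ?_ fun p => ?_
  · rw [happ, Matrix.one_kronecker_one, mul_one, specialUnitary_mul_conjTranspose hC,
      ← Matrix.one_kronecker_one, traceEnv_kronecker, Matrix.trace_one, smul_smul]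
    norm_num
  · rw [happ]
    fin_cases p
    · exact (congrArg _ (congrArg _ hX)).trans (hhalf x h1)
    · exact (congrArg _ (congrArg _ hZ)).trans (hhalf z h2)
    · exact (congrArg _ (congrArg _ hY)).trans (hhalf _ h3)

/-- Labels of the generators `σ_x ⊗ 1`, `σ_z ⊗ 1`, `1 ⊗ σ_x`, `1 ⊗ σ_z`. -/
def generator : Fin 4 → SignedPauli :=
  ![(false, 1, 0), (false, 2, 0), (false, 0, 1), (false, 0, 2)]

theorem generator_mat_zero : (generator 0).mat = pauli 1 ⊗ₖ 1 := by
  simp [generator, SignedPauli.mat, sgn, pauli]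

theorem generator_mat_one : (generator 1).mat = pauli 2 ⊗ₖ 1 := by
  simp [generator, SignedPauli.mat, sgn, pauli]

theorem generator_mat_two : (generator 2).mat = 1 ⊗ₖ pauli 1 := by
  simp [generator, SignedPauli.mat, sgn, pauli]

theorem generator_mat_three : (generator 3).mat = 1 ⊗ₖ pauli 2 := by
  simp [generator, SignedPauli.mat, sgn, pauli]

/-- Commuting with both Z operators forces a diagonal matrix, and commuting with both X operators
makes its diagonal constant. -/
theorem generator_irreducible (M : Matrix (Fin 2 × Fin 2) (Fin 2 × Fin 2) ℂ)
    (h : ∀ i, M * (generator i).mat = (generator i).mat * M) : ∃ c : ℂ, M = c • 1 := by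
  have h0 := fun p q => congrFun (congrFun (h 0) p) q
  have h1 := fun p q => congrFun (congrFun (h 1) p) q
  have h2 := fun p q => congrFun (congrFun (h 2) p) q
  have h3 := fun p q => congrFun (congrFun (h 3) p) q
  rw [generator_mat_zero] at h0
  rw [generator_mat_one] at h1
  rw [generator_mat_two] at h2
  rw [generator_mat_three] at h3
  simp only [Matrix.mul_apply, Fintype.sum_prod_type, Fin.sum_univ_two, Matrix.kroneckerMap_apply,
    Matrix.one_apply, pauli, pauliX, pauliZ] at h0 h1 h2 h3
  have z1 : ∀ i j k l, i ≠ j → M (i, k) (j, l) = 0 := by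
    intro i j k l hij
    have := h1 (i, k) (j, l)
    fin_cases i <;> fin_cases j <;> fin_cases k <;> fin_cases l <;> simp at this hij ⊢ <;>
      first | exact self_eq_neg.1 this | exact neg_eq_self.1 this
  have z2 : ∀ i j k l, k ≠ l → M (i, k) (j, l) = 0 := by
    intro i j k l hij
    have := h3 (i, k) (j, l)
    fin_cases i <;> fin_cases j <;> fin_cases k <;> fin_cases l <;> simp at this hij ⊢ <;>
      first | exact self_eq_neg.1 this | exact neg_eq_self.1 this
  have x1 : ∀ k, M (0, k) (0, k) = M (1, k) (1, k) := by
    intro k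
    have := h0 (0, k) (1, k)
    fin_cases k <;> simpa using this
  have x2 : ∀ i, M (i, 0) (i, 0) = M (i, 1) (i, 1) := by
    intro i
    have := h2 (i, 0) (i, 1)
    fin_cases i <;> simpa using this
  refine ⟨M (0, 0) (0, 0), ?_⟩
  ext ⟨i, k⟩ ⟨j, l⟩
  by_cases hij : i = j
  · by_cases hkl : k = l
    · subst hij hkl
      fin_cases i <;> fin_cases k <;> simp [← x1, ← x2]
    · simp [z2 i j k l hkl, hkl]
  · simp [z1 i j k l hij, hij]

/-- Labels of possible images of the four generators. -/
abbrev Tableau : Type := (SignedPauli × SignedPauli) × (SignedPauli × SignedPauli)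

/-- The images listed by a tableau. -/
def Tableau.image (T : Tableau) : Fin 4 → SignedPauli := ![T.1.1, T.1.2, T.2.1, T.2.2]

/-- The second pair of a tableau anticommutes, and commutes with `x` and `z`. -/
def secondPair (x z : SignedPauli) (uv : SignedPauli × SignedPauli) : Bool :=
  !uv.1.anti x && !uv.1.anti z && !uv.2.anti x && !uv.2.anti z && uv.1.anti uv.2

/-- The images satisfy the commutation relations of the generators. -/
def Tableau.Valid (T : Tableau) : Prop := T.1.1.anti T.1.2 = true ∧ secondPair T.1.1 T.1.2 T.2 = true

theorem Tableau.image_injective : Function.Injective Tableau.image := by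
  rintro ⟨⟨x, z⟩, u, v⟩ ⟨⟨x', z'⟩, u', v'⟩ h
  have h0 := congrFun h 0
  have h1 := congrFun h 1
  have h2 := congrFun h 2
  have h3 := congrFun h 3
  simp only [Tableau.image] at h0 h1 h2 h3
  simp at h0 h1 h2 h3
  simp [h0, h1, h2, h3]

/-- Two mutually commuting anticommuting pairs of involutions give equivalent irreducible
representations; the intertwiner from the standard pairs is rescaled to be special unitary. -/
theorem Tableau.exists_specialUnitary {T : Tableau} (hT : T.Valid) :
    ∃ C ∈ Matrix.specialUnitaryGroup (Fin 2 × Fin 2) ℂ,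
      ∀ i, C * (generator i).mat * Cᴴ = (T.image i).mat := by
  obtain ⟨⟨x, z⟩, u, v⟩ := T
  obtain ⟨hxz, h2⟩ := hT
  simp only [secondPair, Bool.and_eq_true, Bool.not_eq_true'] at h2 hxz
  obtain ⟨⟨⟨⟨hux, huz⟩, hvx⟩, hvz⟩, huv⟩ := h2
  obtain ⟨C, hC, c0, c1, c2, c3⟩ := exists_intertwiner_two_pairs
    (X₁ := (generator 0).mat) (Z₁ := (generator 1).mat) (X₂ := (generator 2).mat)
    (Z₂ := (generator 3).mat) (X₁' := x.mat) (Z₁' := z.mat) (X₂' := u.mat) (Z₂' := v.mat)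
    (SignedPauli.mat_mul_self _) (SignedPauli.mat_mul_self _) (SignedPauli.mat_mul_self _)
    (SignedPauli.mat_mul_self _) (SignedPauli.mat_mul_self _) (SignedPauli.mat_mul_self _)
    (SignedPauli.mat_mul_self _) (SignedPauli.mat_mul_self _)
    (SignedPauli.mat_anticommute rfl) (SignedPauli.mat_anticommute rfl)
    (SignedPauli.mat_anticommute hxz) (SignedPauli.mat_anticommute huv)
    (SignedPauli.mat_commute rfl) (SignedPauli.mat_commute rfl) (SignedPauli.mat_commute rfl)
    (SignedPauli.mat_commute rfl) (SignedPauli.mat_commute hux) (SignedPauli.mat_commute huz)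
    (SignedPauli.mat_commute hvx) (SignedPauli.mat_commute hvz)
  have hint : ∀ i, C * (generator i).mat =
      (Tableau.image ((x, z), u, v) i).mat * C := by
    intro i
    fin_cases i
    · exact c0
    · exact c1
    · exact c2
    · exact c3
  obtain ⟨c, hc⟩ := exists_specialUnitary_smul (fun i => (generator i).mat_isHermitian)
    (fun i => (Tableau.image ((x, z), u, v) i).mat_isHermitian) generator_irreducible hC hint
  refine ⟨_, hc, fun i => (conj_eq_iff hc).2 ?_⟩
  rw [Matrix.smul_mul, Matrix.mul_smul, hint]

theorem conj_mul_conj {m : Type} [Fintype m] [DecidableEq m] {C : Matrix m m ℂ}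
    (hC : C ∈ Matrix.specialUnitaryGroup m ℂ) (A B : Matrix m m ℂ) :
    C * A * Cᴴ * (C * B * Cᴴ) = C * (A * B) * Cᴴ := by
  simp only [mul_assoc]
  rw [← mul_assoc Cᴴ C, specialUnitary_conjTranspose_mul hC, one_mul]

theorem conj_injective {m : Type} [Fintype m] [DecidableEq m] {C : Matrix m m ℂ}
    (hC : C ∈ Matrix.specialUnitaryGroup m ℂ) {A B : Matrix m m ℂ}
    (h : C * A * Cᴴ = C * B * Cᴴ) : A = B := by
  have h1 := congrArg (Cᴴ * · * C) h
  simp only [mul_assoc, specialUnitary_conjTranspose_mul hC, mul_one] at h1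
  simpa only [← mul_assoc, specialUnitary_conjTranspose_mul hC, one_mul] using h1

/-- Forward, conjugation preserves Hermiticity, hence takes signed Paulis to signed Paulis, and it
preserves anticommutation. Backward, the generators produce the whole Pauli group up to powers of
`i`, so their images control everything. -/
theorem mem_cliffordTwo_iff_exists_tableau {C : Matrix (Fin 2 × Fin 2) (Fin 2 × Fin 2) ℂ} :
    C ∈ cliffordTwo ↔ C ∈ Matrix.specialUnitaryGroup (Fin 2 × Fin 2) ℂ ∧
      ∃ T : Tableau, T.Valid ∧ ∀ i, C * (generator i).mat * Cᴴ = (T.image i).mat := by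
  rw [mem_cliffordTwo_iff]
  refine and_congr_right fun hC => ⟨fun h => ?_, ?_⟩
  · have himg : ∀ x : SignedPauli, ∃ y : SignedPauli, C * x.mat * Cᴴ = y.mat := by
      rintro ⟨s, a, b⟩
      obtain ⟨l, a', b', h1⟩ := h (if s then 2 else 0) a b
      have hs : Complex.I ^ (if s then 2 else 0) = sgn s := by cases s <;> simp [sgn]
      rw [hs] at h1
      have hy := SignedPauli.mat_isHermitian (false, a', b')
      have hm : SignedPauli.mat (false, a', b') = pauli a' ⊗ₖ pauli b' := by
        simp [SignedPauli.mat, sgn]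
      have hherm : (Complex.I ^ l • SignedPauli.mat (false, a', b')).IsHermitian := by
        rw [hm, ← h1]
        have := SignedPauli.mat_isHermitian (s, a, b)
        rw [Matrix.IsHermitian, Matrix.conjTranspose_mul, Matrix.conjTranspose_mul,
          Matrix.conjTranspose_conjTranspose, ← mul_assoc]
        rw [SignedPauli.mat, Matrix.IsHermitian] at this
        rw [this]
      have hne : SignedPauli.mat (false, a', b') ≠ 0 := fun h0 => by
        have := SignedPauli.mat_mul_self (false, a', b')
        rw [h0, zero_mul] at this
        exact zero_ne_one this
      obtain ⟨s', hs'⟩ := isHermitian_I_pow_smul hy hne hherm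
      exact ⟨(s', a', b'), by rw [SignedPauli.mat, SignedPauli.mat, h1, hs']⟩
    choose f hf using himg
    have hanti : ∀ x y : SignedPauli, (f x).anti (f y) = x.anti y := by
      intro x y
      rw [Bool.eq_iff_iff, SignedPauli.anti_iff, SignedPauli.anti_iff, ← hf, ← hf,
        conj_mul_conj hC, conj_mul_conj hC, ← Matrix.neg_mul, ← Matrix.mul_neg]
      exact ⟨fun h => conj_injective hC h, fun h => by rw [h]⟩
    refine ⟨((f (generator 0), f (generator 1)), f (generator 2), f (generator 3)), ?_, ?_⟩
    · simp only [Tableau.Valid, secondPair, hanti]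
      decide
    · intro i
      fin_cases i <;> exact hf _
  · rintro ⟨T, -, hT⟩
    let G : Set (Matrix (Fin 2 × Fin 2) (Fin 2 × Fin 2) ℂ) :=
      {P | ∃ (l : ℕ) (a b : Fin 4), P = Complex.I ^ l • (pauli a ⊗ₖ pauli b)}
    have hGmul : ∀ P ∈ G, ∀ Q ∈ G, P * Q ∈ G := by
      rintro _ ⟨l, a, b, rfl⟩ _ ⟨l', a', b', rfl⟩
      refine ⟨l + l' + pauliPhase a a' + pauliPhase b b', pauliIdx a a', pauliIdx b b', ?_⟩
      rw [Matrix.smul_mul, Matrix.mul_smul, ← Matrix.mul_kronecker_mul, pauli_mul, pauli_mul,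
        Matrix.smul_kronecker, Matrix.kronecker_smul]
      simp only [smul_smul, pow_add, mul_assoc]
    have hGone : (1 : Matrix (Fin 2 × Fin 2) (Fin 2 × Fin 2) ℂ) ∈ G :=
      ⟨0, 0, 0, by simp [pauli]⟩
    have hGsmul : ∀ (l : ℕ), ∀ P ∈ G, Complex.I ^ l • P ∈ G := by
      rintro l _ ⟨l', a, b, rfl⟩
      exact ⟨l + l', a, b, by rw [smul_smul, pow_add]⟩
    have hmat : ∀ x : SignedPauli, x.mat ∈ G := by
      rintro ⟨s, a, b⟩
      exact ⟨if s then 2 else 0, a, b, by cases s <;> simp [SignedPauli.mat, sgn]⟩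
    have hcmul : ∀ P Q, C * P * Cᴴ ∈ G → C * Q * Cᴴ ∈ G → C * (P * Q) * Cᴴ ∈ G := by
      intro P Q hP hQ
      rw [← conj_mul_conj hC]
      exact hGmul _ hP _ hQ
    have hcone : C * 1 * Cᴴ ∈ G := by
      rw [mul_one, specialUnitary_mul_conjTranspose hC]
      exact hGone
    have hgen : ∀ (i : Fin 4) (j : Fin 2), C * (generator i).mat ^ (j : ℕ) * Cᴴ ∈ G := by
      intro i j
      fin_cases j
      · simpa using hcone
      · simpa [hT] using hmat (T.image i)
    intro l a b
    obtain ⟨l₁, j, k, h₁⟩ := pauli_eq_pauliX_pow_mul_pauliZ_pow a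
    obtain ⟨l₂, j', k', h₂⟩ := pauli_eq_pauliX_pow_mul_pauliZ_pow b
    have hprod : Complex.I ^ l • (pauli a ⊗ₖ pauli b) = Complex.I ^ (l + l₁ + l₂) •
        (((generator 0).mat ^ (j : ℕ) * (generator 1).mat ^ (k : ℕ)) *
          ((generator 2).mat ^ (j' : ℕ) * (generator 3).mat ^ (k' : ℕ))) := by
      have hk1 : ∀ (A : Matrix (Fin 2) (Fin 2) ℂ) (j : Fin 2),
          (A ⊗ₖ (1 : Matrix (Fin 2) (Fin 2) ℂ)) ^ (j : ℕ) = (A ^ (j : ℕ)) ⊗ₖ 1 := by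
        intro A j
        fin_cases j <;> simp
      have hk2 : ∀ (A : Matrix (Fin 2) (Fin 2) ℂ) (j : Fin 2),
          ((1 : Matrix (Fin 2) (Fin 2) ℂ) ⊗ₖ A) ^ (j : ℕ) = 1 ⊗ₖ (A ^ (j : ℕ)) := by
        intro A j
        fin_cases j <;> simp
      rw [generator_mat_zero, generator_mat_one, generator_mat_two, generator_mat_three, hk1, hk1,
        hk2, hk2, ← Matrix.mul_kronecker_mul, ← Matrix.mul_kronecker_mul,
        ← Matrix.mul_kronecker_mul, one_mul, one_mul, mul_one, h₁, h₂,
        Matrix.smul_kronecker, Matrix.kronecker_smul]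
      simp only [smul_smul, pow_add, mul_assoc]
      rfl
    rw [hprod, Matrix.mul_smul, Matrix.smul_mul]
    exact hGsmul _ _ (hcmul _ _ (hcmul _ _ (hgen _ _) (hgen _ _)) (hcmul _ _ (hgen _ _) (hgen _ _)))

end TwoQubits

/-! ### Enumeration of Bloch codes and counting of tableaux. -/

section Codes

/-- A nontrivial signed one-qubit Pauli operator on the system. -/
def systemPauli (y : Bool × Fin 3) : SignedPauli := (y.1, y.2.succ, 0)

/-- Bloch codes of the one-qubit Clifford channels. -/
def localCodes : Finset (Fin 3 → BlochColumn) :=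
  (Finset.univ.filter fun xz : (Bool × Fin 3) × (Bool × Fin 3) => xz.1.2 ≠ xz.2.2).image
    fun xz => blochCode (systemPauli xz.1) (systemPauli xz.2)

/-- The Bloch code with a single nonzero column. -/
def rankCode (y : Bool × Fin 3) (p : Fin 3) : Fin 3 → BlochColumn :=
  ![![some y, none, none], ![none, some y, none], ![none, none, some y]] p

/-- Bloch codes with exactly one nonzero column. -/
def rankCodes : Finset (Fin 3 → BlochColumn) :=
  Finset.univ.image fun yp : (Bool × Fin 3) × Fin 3 => rankCode yp.1 yp.2

/-- The Bloch code of the depolarising channel. -/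
def zeroCode : Fin 3 → BlochColumn := ![none, none, none]

/-- The number of anticommuting pairs of labels with a given Bloch code. -/
def pairCount (c : Fin 3 → BlochColumn) : ℕ :=
  (Finset.univ.filter fun xz : SignedPauli × SignedPauli =>
    xz.1.anti xz.2 = true ∧ blochCode xz.1 xz.2 = c).card

/-- The entries of `pairCount`, arranged for evaluation. -/
def columnCount (c₀ c₁ c₂ : BlochColumn) : ℕ :=
  ∑ x : SignedPauli, if x.column = c₀ then ∑ z : SignedPauli, if z.column = c₁ then
    if x.anti z = true then if (x.third z).column = c₂ then 1 else 0 else 0 else 0 else 0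

theorem pairCount_eq (c₀ c₁ c₂ : BlochColumn) :
    pairCount ![c₀, c₁, c₂] = columnCount c₀ c₁ c₂ := by
  have h : ∀ x z : SignedPauli, blochCode x z = ![c₀, c₁, c₂] ↔
      x.column = c₀ ∧ z.column = c₁ ∧ (x.third z).column = c₂ := by
    intro x z
    simp [blochCode]
  simp only [pairCount, h]
  rw [Finset.card_filter, Fintype.sum_prod_type, columnCount]
  refine Finset.sum_congr rfl fun x _ => ?_
  by_cases hx : x.column = c₀
  · rw [if_pos hx]
    refine Finset.sum_congr rfl fun z _ => ?_
    by_cases h1 : z.column = c₁ <;> by_cases h2 : x.anti z = true <;>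
      by_cases h3 : (x.third z).column = c₂ <;> simp only [hx, h1, h2, h3, and_true, and_false,
        if_true, if_false, Bool.false_eq_true]
  · rw [if_neg hx]
    exact Finset.sum_eq_zero fun z _ => if_neg fun h => hx h.2.1

/-- When all three columns are nonzero, both labels can be read off from the first two, so there is
exactly one pair. -/
theorem columnCount_local : ∀ x z : Bool × Fin 3, x.2 ≠ z.2 →
    columnCount (some x) (some z) ((systemPauli x).third (systemPauli z)).column = 1 := by
  decide +kernel

/-- One of `x`, `z`, `third` is a fixed system Pauli; another is any signed Pauli anticommuting with
it and nontrivial on the environment, with 2 system factors, 3 environment factors and 2 signs. The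
remaining one is then determined. -/
theorem columnCount_rank : ∀ y : Bool × Fin 3, columnCount (some y) none none = 12 ∧
    columnCount none (some y) none = 12 ∧ columnCount none none (some y) = 12 := by
  decide +kernel

/-- The remainder of the 30 · 16 = 480 anticommuting ordered pairs, after 24 · 1 and 18 · 12 are
removed. -/
theorem columnCount_zero : columnCount none none none = 240 := by
  decide +kernel

theorem systemPauli_column (y : Bool × Fin 3) : (systemPauli y).column = some y := by
  obtain ⟨s, q⟩ := y
  fin_cases q <;> rfl

theorem systemPauli_anti : ∀ x z : Bool × Fin 3,
    (systemPauli x).anti (systemPauli z) = true ↔ x.2 ≠ z.2 := by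
  decide +kernel

theorem blochCode_systemPauli (x z : Bool × Fin 3) :
    blochCode (systemPauli x) (systemPauli z) =
      ![some x, some z, ((systemPauli x).third (systemPauli z)).column] := by
  rw [blochCode, systemPauli_column, systemPauli_column]

theorem pairCount_local {c : Fin 3 → BlochColumn} (hc : c ∈ localCodes) : pairCount c = 1 := by
  obtain ⟨⟨x, z⟩, h, rfl⟩ := Finset.mem_image.1 hc
  rw [blochCode_systemPauli, pairCount_eq]
  exact columnCount_local x z (Finset.mem_filter.1 h).2

theorem pairCount_rank {c : Fin 3 → BlochColumn} (hc : c ∈ rankCodes) : pairCount c = 12 := by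
  obtain ⟨⟨y, p⟩, -, rfl⟩ := Finset.mem_image.1 hc
  obtain ⟨h0, h1, h2⟩ := columnCount_rank y
  fin_cases p
  · exact (pairCount_eq _ _ _).trans h0
  · exact (pairCount_eq _ _ _).trans h1
  · exact (pairCount_eq _ _ _).trans h2

theorem pairCount_zero : pairCount zeroCode = 240 := by
  rw [zeroCode, pairCount_eq, columnCount_zero]

theorem card_localCodes : localCodes.card = 24 := by decide +kernel

theorem card_rankCodes : rankCodes.card = 18 := by decide +kernel

theorem disjoint_localCodes_rankCodes : Disjoint localCodes rankCodes := by decide +kernel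

theorem zeroCode_notMem : zeroCode ∉ localCodes ∪ rankCodes := by decide +kernel

/-- All Bloch codes of two-qubit Clifford unitaries. -/
def allCodes : Finset (Fin 3 → BlochColumn) := localCodes ∪ rankCodes ∪ {zeroCode}

theorem card_allCodes : allCodes.card = 43 := by
  rw [allCodes, Finset.card_union_of_disjoint (Finset.disjoint_singleton_right.2 zeroCode_notMem),
    Finset.card_union_of_disjoint disjoint_localCodes_rankCodes, card_localCodes, card_rankCodes,
    Finset.card_singleton]

theorem SignedPauli.column_eq_none {x : SignedPauli} (h : x.2.2 ≠ 0) : x.column = none :=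
  if_neg h

theorem SignedPauli.eq_systemPauli {x : SignedPauli} (h : x.2.2 = 0) (hx : x.2 ≠ (0, 0)) :
    ∃ y, x = systemPauli y := by
  obtain ⟨s, a, b⟩ := x
  simp only at h
  subst h
  obtain ⟨q, rfl⟩ := Fin.exists_succ_eq.2 fun h : a = 0 => hx (by rw [h])
  exact ⟨(s, q), rfl⟩

/-- The environment factor of `third` is the product of the other two, so two trivial environment
factors force the third to be trivial: exactly two nonzero columns never occur. -/
theorem blochCode_mem {x z : SignedPauli} (h : x.anti z = true) : blochCode x z ∈ allCodes := by
  obtain ⟨hx, hz, -⟩ := SignedPauli.ne_one_of_anti h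
  have hidx : ∀ b : Fin 4, pauliIdx 0 b = b ∧ pauliIdx b 0 = b := by decide
  simp only [allCodes, Finset.mem_union, Finset.mem_singleton]
  by_cases hxb : x.2.2 = 0
  · obtain ⟨y, rfl⟩ := SignedPauli.eq_systemPauli hxb hx
    by_cases hzb : z.2.2 = 0
    · obtain ⟨y', rfl⟩ := SignedPauli.eq_systemPauli hzb hz
      refine Or.inl (Or.inl (Finset.mem_image.2 ⟨(y, y'), ?_, rfl⟩))
      exact Finset.mem_filter.2 ⟨Finset.mem_univ _, (systemPauli_anti y y').1 h⟩
    · refine Or.inl (Or.inr (Finset.mem_image.2 ⟨(y, 0), Finset.mem_univ _, ?_⟩))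
      have ht : ((systemPauli y).third z).2.2 ≠ 0 := by
        change pauliIdx 0 z.2.2 ≠ 0
        rwa [(hidx _).1]
      rw [blochCode, systemPauli_column, z.column_eq_none hzb, SignedPauli.column_eq_none ht]
      rfl
  · by_cases hzb : z.2.2 = 0
    · obtain ⟨y', rfl⟩ := SignedPauli.eq_systemPauli hzb hz
      refine Or.inl (Or.inr (Finset.mem_image.2 ⟨(y', 1), Finset.mem_univ _, ?_⟩))
      have ht : (x.third (systemPauli y')).2.2 ≠ 0 := by
        change pauliIdx x.2.2 0 ≠ 0
        rwa [(hidx _).2]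
      rw [blochCode, systemPauli_column, x.column_eq_none hxb, SignedPauli.column_eq_none ht]
      rfl
    · rw [blochCode, z.column_eq_none hzb, x.column_eq_none hxb]
      rcases (x.third z).column with _ | y
      · exact Or.inr rfl
      · exact Or.inl (Or.inr (Finset.mem_image.2 ⟨(y, 2), Finset.mem_univ _, rfl⟩))

theorem pairCount_pos {c : Fin 3 → BlochColumn} (hc : c ∈ allCodes) : 0 < pairCount c := by
  simp only [allCodes, Finset.mem_union, Finset.mem_singleton] at hc
  rcases hc with (hc | hc) | rfl
  · rw [pairCount_local hc]; norm_num
  · rw [pairCount_rank hc]; norm_num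
  · rw [pairCount_zero]; norm_num

theorem exists_pair_of_mem {c : Fin 3 → BlochColumn} (hc : c ∈ allCodes) :
    ∃ x z : SignedPauli, x.anti z = true ∧ blochCode x z = c := by
  obtain ⟨⟨x, z⟩, hxz⟩ := Finset.card_pos.1 (pairCount_pos hc)
  exact ⟨x, z, (Finset.mem_filter.1 hxz).2⟩

/-- Whether two Pauli operators without signs anticommute. -/
def antiIdx (x y : Fin 4 × Fin 4) : Bool :=
  (pauliPhase x.1 y.1 + pauliPhase x.2 y.2) % 2 == 1

/-- Modulo signs, the Paulis commuting with an anticommuting pair form the Pauli group of a second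
qubit, which has 3 · 2 ordered anticommuting pairs. -/
theorem sum_second_pairs : ∀ x z : Fin 4 × Fin 4, antiIdx x z = true →
    (∑ u : Fin 4 × Fin 4, if (!antiIdx u x && !antiIdx u z) = true then
      ∑ v : Fin 4 × Fin 4, if (!antiIdx v x && !antiIdx v z && antiIdx u v) = true then 1 else 0
        else 0) = 6 := by
  decide +kernel

/-- The 6 unsigned pairs, times 4 choices of signs, since commutation ignores signs. -/
theorem card_secondPair {x z : SignedPauli} (h : x.anti z = true) :
    (Finset.univ.filter fun uv : SignedPauli × SignedPauli =>
      secondPair x z uv = true).card = 24 := by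
  have h1 := sum_second_pairs x.2 z.2 h
  have h2 : ∀ (s t : Bool) (u v : Fin 4 × Fin 4), secondPair x z ((s, u), (t, v)) =
      ((!antiIdx u x.2 && !antiIdx u z.2) && (!antiIdx v x.2 && !antiIdx v z.2 && antiIdx u v)) := by
    intro s t u v
    simp only [secondPair, Bool.and_assoc]
    rfl
  rw [Finset.card_filter, Fintype.sum_prod_type, Fintype.sum_prod_type]
  simp only [Fintype.sum_prod_type (α₁ := Bool), h2, Fintype.sum_bool]
  have h3 : ∀ u : Fin 4 × Fin 4, (∑ v : Fin 4 × Fin 4, if ((!antiIdx u x.2 && !antiIdx u z.2) &&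
      (!antiIdx v x.2 && !antiIdx v z.2 && antiIdx u v)) = true then 1 else 0) =
      if (!antiIdx u x.2 && !antiIdx u z.2) = true then ∑ v : Fin 4 × Fin 4,
        if (!antiIdx v x.2 && !antiIdx v z.2 && antiIdx u v) = true then 1 else 0 else 0 := by
    intro u
    by_cases hu : (!antiIdx u x.2 && !antiIdx u z.2) = true
    · simp only [hu, Bool.true_and, if_true]
    · simp only [Bool.eq_false_iff.2 hu, Bool.false_and]
      simp
  simp only [h3, Finset.sum_add_distrib, h1]
  rfl

end Codes

/-! ### Fibres of the map from Clifford unitaries to channels. -/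

section Fibers

theorem exists_valid_tableau {x z : SignedPauli} (h : x.anti z = true) :
    ∃ uv, Tableau.Valid ((x, z), uv) := by
  have h1 := card_secondPair h
  obtain ⟨uv, huv⟩ := Finset.card_pos.1 (h1.symm ▸ (by norm_num : 0 < 24))
  exact ⟨uv, h, (Finset.mem_filter.1 huv).2⟩

theorem unistochastic_of_tableau {T : Tableau} (hT : T.Valid)
    {C : Matrix (Fin 2 × Fin 2) (Fin 2 × Fin 2) ℂ}
    (hC : C ∈ Matrix.specialUnitaryGroup (Fin 2 × Fin 2) ℂ)
    (h : ∀ i, C * (generator i).mat * Cᴴ = (T.image i).mat) :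
    unistochastic C = blochMap (blochCode T.1.1 T.1.2) := by
  refine blochMap_of_images hC hT.1 ?_ ?_
  · rw [← generator_mat_zero, h]
    rfl
  · rw [← generator_mat_one, h]
    rfl

theorem unistochastic_image_cliffordTwo :
    unistochastic '' cliffordTwo = blochMap '' (allCodes : Set (Fin 3 → BlochColumn)) := by
  ext Φ
  constructor
  · rintro ⟨C, hC, rfl⟩
    obtain ⟨hSU, T, hT, h⟩ := mem_cliffordTwo_iff_exists_tableau.1 hC
    exact ⟨_, blochCode_mem hT.1, (unistochastic_of_tableau hT hSU h).symm⟩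
  · rintro ⟨c, hc, rfl⟩
    obtain ⟨x, z, hxz, rfl⟩ := exists_pair_of_mem hc
    obtain ⟨uv, hT⟩ := exists_valid_tableau hxz
    obtain ⟨C, hC, h⟩ := Tableau.exists_specialUnitary hT
    exact ⟨C, mem_cliffordTwo_iff_exists_tableau.2 ⟨hC, _, hT, h⟩, unistochastic_of_tableau hT hC h⟩

theorem ncard_tableaux (c : Fin 3 → BlochColumn) :
    {T : Tableau | T.Valid ∧ blochCode T.1.1 T.1.2 = c}.ncard = 24 * pairCount c := by
  classical
  have h1 : {T : Tableau | T.Valid ∧ blochCode T.1.1 T.1.2 = c} =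
      ((Finset.univ.filter fun T : Tableau => T.Valid ∧ blochCode T.1.1 T.1.2 = c :
        Finset Tableau) : Set Tableau) := by
    rw [Finset.coe_filter_univ]
  rw [h1, Set.ncard_coe_finset, Finset.card_filter, Fintype.sum_prod_type, pairCount,
    Finset.card_filter, Finset.mul_sum]
  refine Finset.sum_congr rfl fun xz _ => ?_
  by_cases h : xz.1.anti xz.2 = true ∧ blochCode xz.1 xz.2 = c
  · rw [if_pos h, mul_one, ← card_secondPair h.1, Finset.card_filter]
    refine Finset.sum_congr rfl fun uv _ => ?_
    exact if_congr ⟨fun h1 => h1.1.2, fun h1 => ⟨⟨h.1, h1⟩, h.2⟩⟩ rfl rfl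
  · rw [if_neg h, mul_zero]
    exact Finset.sum_eq_zero fun uv _ => if_neg fun h1 => h ⟨h1.1.1, h1.2⟩

/-- Clifford unitaries up to phase are identified with their unitary channels, and these biject with
valid tableaux: equal images give equal channels by irreducibility, and a channel reveals its
tableau by acting on the generators. -/
theorem ncard_fiber (c : Fin 3 → BlochColumn) :
    (unitaryChannel '' {C | C ∈ cliffordTwo ∧ unistochastic C = blochMap c}).ncard =
      24 * pairCount c := by
  classical
  choose rep hrep hrepi using fun T : {T : Tableau // T.Valid} => Tableau.exists_specialUnitary T.2
  have himage : unitaryChannel '' {C | C ∈ cliffordTwo ∧ unistochastic C = blochMap c} =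
      (fun T => unitaryChannel (rep T)) ''
        {T : {T : Tableau // T.Valid} | blochCode T.1.1.1 T.1.1.2 = c} := by
    ext Φ
    constructor
    · rintro ⟨C, ⟨hC, hΦ⟩, rfl⟩
      obtain ⟨hSU, T, hT, h⟩ := mem_cliffordTwo_iff_exists_tableau.1 hC
      refine ⟨⟨T, hT⟩, ?_, ?_⟩
      · rw [unistochastic_of_tableau hT hSU h] at hΦ
        exact blochMap_injective hΦ
      · refine unitaryChannel_eq_of_conj_eq generator_irreducible (hrep _) hSU fun i => ?_
        rw [hrepi, h]
    · rintro ⟨T, hT, rfl⟩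
      refine ⟨rep T, ⟨mem_cliffordTwo_iff_exists_tableau.2 ⟨hrep T, T.1, T.2, hrepi T⟩, ?_⟩, rfl⟩
      rw [unistochastic_of_tableau T.2 (hrep T) (hrepi T)]
      exact congrArg _ hT
  have hinj : Function.Injective fun T => unitaryChannel (rep T) := by
    intro T T' h
    refine Subtype.ext (Tableau.image_injective (funext fun i => SignedPauli.mat_injective ?_))
    rw [← hrepi, ← hrepi]
    exact LinearMap.congr_fun h (generator i).mat
  rw [himage, Set.ncard_image_of_injective _ hinj, ← ncard_tableaux,
    ← Set.ncard_image_of_injective _ Subtype.val_injective]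
  congr 1
  ext T
  constructor
  · rintro ⟨T, hT, rfl⟩
    exact ⟨T.2, hT⟩
  · exact fun hT => ⟨⟨T, hT.1⟩, hT.2, rfl⟩

end Fibers

/-! ### One-qubit Clifford channels. -/

section OneQubit

theorem depolarising_eq : depolarising (Fin 2) = blochMap zeroCode := by
  refine LinearMap.ext fun ρ => ?_
  simp [depolarising, blochMap_apply, zeroCode, Fin.sum_univ_three, BlochColumn.mat, smul_smul,
    mul_comm]

theorem systemPauli_mat (y : Bool × Fin 3) :
    (systemPauli y).mat = BlochColumn.mat (some y) ⊗ₖ 1 := by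
  simp [SignedPauli.mat, systemPauli, BlochColumn.mat, pauli, Matrix.smul_kronecker]

theorem kronecker_one_injective {A B : Matrix (Fin 2) (Fin 2) ℂ}
    (h : A ⊗ₖ (1 : Matrix (Fin 2) (Fin 2) ℂ) = B ⊗ₖ 1) : A = B := by
  ext i j
  simpa using congrFun (congrFun h (i, 0)) (j, 0)

theorem column_mat_mul_self (y : Bool × Fin 3) :
    BlochColumn.mat (some y) * BlochColumn.mat (some y) = 1 := by
  rw [BlochColumn.mat, Matrix.smul_mul, Matrix.mul_smul, pauli_mul_self, smul_smul, sgn_mul_self,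
    one_smul]

theorem column_mat_isHermitian (y : Bool × Fin 3) : (BlochColumn.mat (some y)).IsHermitian := by
  rw [Matrix.IsHermitian, BlochColumn.mat, Matrix.conjTranspose_smul, pauli_isHermitian, star_sgn]

theorem column_mat_anticommute_iff (x z : Bool × Fin 3) :
    x.2 ≠ z.2 ↔ BlochColumn.mat (some x) * BlochColumn.mat (some z) =
      -(BlochColumn.mat (some z) * BlochColumn.mat (some x)) := by
  rw [← systemPauli_anti, SignedPauli.anti_iff, systemPauli_mat, systemPauli_mat,
    ← Matrix.mul_kronecker_mul, ← Matrix.mul_kronecker_mul, mul_one]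
  have hneg : ∀ A : Matrix (Fin 2) (Fin 2) ℂ, -(A ⊗ₖ (1 : Matrix (Fin 2) (Fin 2) ℂ)) = (-A) ⊗ₖ 1 :=
    fun A => by
      rw [← neg_one_smul ℂ, ← Matrix.smul_kronecker, neg_one_smul]
  rw [hneg]
  exact ⟨kronecker_one_injective, fun h => by rw [h]⟩

theorem column_mat_third {x z : Bool × Fin 3} (h : x.2 ≠ z.2) :
    ((systemPauli x).third (systemPauli z)).column.mat =
      Complex.I • (BlochColumn.mat (some x) * BlochColumn.mat (some z)) := by
  have ha := (systemPauli_anti x z).2 h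
  have h1 := SignedPauli.traceEnv_mat _ (SignedPauli.ne_one_of_anti ha).2.2
  rw [SignedPauli.mat_third ha, systemPauli_mat, systemPauli_mat, ← Matrix.mul_kronecker_mul,
    mul_one, traceEnv_smul, traceEnv_kronecker, Matrix.trace_one, smul_comm] at h1
  exact (smul_right_injective _ (two_ne_zero (α := ℂ)) (by simpa using h1)).symm

theorem pauli_three_eq : pauli 3 = Complex.I • (pauli 1 * pauli 2) := by
  rw [pauli_mul, smul_smul, ← pow_succ']
  simp [pauliPhase, pauliIdx]

theorem pauli_one_mul_two : pauli 1 * pauli 2 = -(pauli 2 * pauli 1) := by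
  have h : (-1 : ℂ) ^ pauliPhase 1 2 = -1 := by
    change (-1 : ℂ) ^ 3 = -1
    norm_num
  rw [pauli_mul_comm, h, neg_one_smul]

theorem unitaryChannel_eq_blochMap {C : Matrix (Fin 2) (Fin 2) ℂ}
    (hC : C ∈ Matrix.specialUnitaryGroup (Fin 2) ℂ) {x z : Bool × Fin 3} (h : x.2 ≠ z.2)
    (hX : C * pauli 1 * Cᴴ = BlochColumn.mat (some x))
    (hZ : C * pauli 2 * Cᴴ = BlochColumn.mat (some z)) :
    unitaryChannel C = blochMap (blochCode (systemPauli x) (systemPauli z)) := by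
  rw [blochCode_systemPauli]
  refine eq_blochMap ?_ fun p => ?_
  · simp only [unitaryChannel, LinearMap.coe_mk, AddHom.coe_mk, mul_one]
    exact specialUnitary_mul_conjTranspose hC
  · fin_cases p
    · exact hX
    · exact hZ
    · refine Eq.trans ?_ (column_mat_third h).symm
      change C * pauli 3 * Cᴴ = _
      rw [← hX, ← hZ, conj_mul_conj hC, pauli_three_eq, Matrix.mul_smul, Matrix.smul_mul]

theorem pauli_pair_irreducible (M : Matrix (Fin 2) (Fin 2) ℂ)
    (h : ∀ i : Bool, M * pauli (if i then 1 else 2) = pauli (if i then 1 else 2) * M) :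
    ∃ c : ℂ, M = c • 1 := by
  have hX := fun p q => congrFun (congrFun (h true) p) q
  have hZ := fun p q => congrFun (congrFun (h false) p) q
  simp only [Matrix.mul_apply, Fin.sum_univ_two, pauli, pauliX, pauliZ] at hX hZ
  have z01 := hZ 0 1
  have z10 := hZ 1 0
  have x01 := hX 0 1
  simp at z01 z10 x01
  refine ⟨M 0 0, ?_⟩
  ext i j
  fin_cases i <;> fin_cases j <;> simp
  · exact neg_eq_self.1 z01
  · exact self_eq_neg.1 z10
  · exact x01.symm

/-- The one-qubit analogue of the tableau description: the images of σ_x and σ_z are signed Paulis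
of different types, and each such choice is realised by an intertwiner. -/
theorem cliffordChannels_eq :
    cliffordChannels = blochMap '' (localCodes : Set (Fin 3 → BlochColumn)) := by
  ext Φ
  constructor
  · rintro ⟨C, hC, rfl⟩
    obtain ⟨hSU, h⟩ := mem_cliffordOne_iff.1 hC
    have himg : ∀ q : Fin 3, ∃ y, C * pauli q.succ * Cᴴ = BlochColumn.mat (some y) := by
      intro q
      obtain ⟨l, a, h1⟩ := h 0 q.succ
      rw [pow_zero, one_smul] at h1
      have hne : pauli a ≠ 0 := fun h0 => by
        have := pauli_mul_self a
        rw [h0, zero_mul] at this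
        exact zero_ne_one this
      have hherm : (Complex.I ^ l • pauli a).IsHermitian := by
        rw [← h1, Matrix.IsHermitian, Matrix.conjTranspose_mul, Matrix.conjTranspose_mul,
          Matrix.conjTranspose_conjTranspose, ← mul_assoc, pauli_isHermitian]
      obtain ⟨s, hs⟩ := isHermitian_I_pow_smul (pauli_isHermitian a) hne hherm
      -- Conjugation preserves the trace, so a traceless Pauli cannot be sent to a multiple of the
      -- identity.
      have ha : a ≠ 0 := by
        rintro rfl
        have htr := congrArg Matrix.trace h1
        rw [Matrix.trace_mul_comm, ← mul_assoc, specialUnitary_conjTranspose_mul hSU, one_mul,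
          trace_pauli, if_neg (Fin.succ_ne_zero q), hs, Matrix.trace_smul, trace_pauli,
          if_pos rfl] at htr
        exact mul_ne_zero (sgn_ne_zero s) two_ne_zero htr.symm
      obtain ⟨q', rfl⟩ := Fin.exists_succ_eq.2 ha
      exact ⟨(s, q'), by rw [h1, hs]; rfl⟩
    obtain ⟨x, hx⟩ := himg 0
    obtain ⟨z, hz⟩ := himg 1
    have hxz : x.2 ≠ z.2 := by
      rw [column_mat_anticommute_iff, ← hx, ← hz, conj_mul_conj hSU, conj_mul_conj hSU,
        ← Matrix.neg_mul, ← Matrix.mul_neg]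
      exact congrArg (C * · * Cᴴ) pauli_one_mul_two
    exact ⟨_, Finset.mem_image.2 ⟨(x, z), Finset.mem_filter.2 ⟨Finset.mem_univ _, hxz⟩, rfl⟩,
      (unitaryChannel_eq_blochMap hSU hxz hx hz).symm⟩
  · rintro ⟨c, hc, rfl⟩
    obtain ⟨⟨x, z⟩, hxz, rfl⟩ := Finset.mem_image.1 hc
    replace hxz : x.2 ≠ z.2 := (Finset.mem_filter.1 hxz).2
    obtain ⟨C, hC, hCX, hCZ⟩ := exists_intertwiner_pair (pauli_mul_self 1) (column_mat_mul_self x)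
      (pauli_mul_self 2) (column_mat_mul_self z)
      pauli_one_mul_two ((column_mat_anticommute_iff x z).1 hxz)
    obtain ⟨r, hr⟩ := exists_specialUnitary_smul (ι := Bool)
      (A := fun i => pauli (if i then 1 else 2))
      (A' := fun i => BlochColumn.mat (some (if i then x else z)))
      (fun i => pauli_isHermitian _) (fun i => column_mat_isHermitian _) pauli_pair_irreducible hC
      (fun i => by cases i <;> [exact hCZ; exact hCX])
    set C' := r • C with hC'
    have hX : C' * pauli 1 * C'ᴴ = BlochColumn.mat (some x) := by
      rw [conj_eq_iff hr, hC', Matrix.smul_mul, Matrix.mul_smul, hCX]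
    have hZ : C' * pauli 2 * C'ᴴ = BlochColumn.mat (some z) := by
      rw [conj_eq_iff hr, hC', Matrix.smul_mul, Matrix.mul_smul, hCZ]
    refine ⟨C', mem_cliffordOne_iff.2 ⟨hr, ?_⟩, unitaryChannel_eq_blochMap hr hxz hX hZ⟩
    have hcol : ∀ c : BlochColumn, c.mat = 0 ∨ ∃ (l : ℕ) (a : Fin 4), c.mat = Complex.I ^ l • pauli a := by
      rintro (_ | ⟨s, q⟩)
      · exact Or.inl rfl
      · exact Or.inr ⟨if s then 2 else 0, q.succ, by cases s <;> simp [BlochColumn.mat, sgn]⟩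
    have hY : C' * pauli 3 * C'ᴴ = ((systemPauli x).third (systemPauli z)).column.mat := by
      rw [column_mat_third hxz, ← hX, ← hZ, conj_mul_conj hr, pauli_three_eq, Matrix.mul_smul,
        Matrix.smul_mul]
    have hfin : ∀ (a : Fin 4) (c : BlochColumn), C' * pauli a * C'ᴴ = c.mat →
        ∃ (l' : ℕ) (a' : Fin 4), C' * pauli a * C'ᴴ = Complex.I ^ l' • pauli a' := by
      intro a c hc
      rcases hcol c with h0 | h1
      · rw [h0] at hc
        have h2 := conj_mul_conj hr (pauli a) (pauli a)
        rw [hc, zero_mul, pauli_mul_self, mul_one, specialUnitary_mul_conjTranspose hr] at h2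
        exact absurd h2 zero_ne_one
      · rwa [hc]
    have hone : ∃ (l' : ℕ) (a' : Fin 4), C' * pauli 0 * C'ᴴ = Complex.I ^ l' • pauli a' :=
      ⟨0, 0, by
        change C' * 1 * C'ᴴ = _ • 1
        rw [mul_one, specialUnitary_mul_conjTranspose hr, pow_zero, one_smul]⟩
    have hall : ∀ a : Fin 4, ∃ (l' : ℕ) (a' : Fin 4),
        C' * pauli a * C'ᴴ = Complex.I ^ l' • pauli a' := by
      intro a
      fin_cases a
      · exact hone
      · exact hfin _ _ hX
      · exact hfin _ _ hZ
      · exact hfin _ _ hY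
    intro l a
    obtain ⟨l', a', h⟩ := hall a
    exact ⟨l + l', a', by rw [Matrix.mul_smul, Matrix.smul_mul, h, smul_smul, pow_add]⟩

end OneQubit

/-! ### Rank-two mixed unitary channels. -/

section RankTwo

/-- The gates `H`, `1`, `S H`, whose columns are the eigenvectors of `σ_x`, `σ_z`, `σ_y`. -/
def gate : Fin 3 → Matrix (Fin 2) (Fin 2) ℂ := ![gateH, 1, gateS * gateH]

theorem mem_gates_iff {A : Matrix (Fin 2) (Fin 2) ℂ} :
    A ∈ ({1, gateH, gateS * gateH} : Set (Matrix (Fin 2) (Fin 2) ℂ)) ↔ ∃ q, A = gate q := by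
  simp only [Set.mem_insert_iff, Set.mem_singleton_iff, Fin.exists_fin_succ, gate]
  simp
  tauto

/-- The sign `(-1) ^ j`. -/
def bitSign (j : Fin 2) : ℂ := ![1, -1] j

/-- Column `i` of each gate is the eigenvector of the matching Pauli with eigenvalue `(-1)^i`, so
its projector is half of identity plus signed Pauli. -/
theorem gate_mul_star (q : Fin 3) (i r s : Fin 2) :
    gate q r i * star (gate q s i) =
      (1 / 2 : ℂ) * ((1 : Matrix (Fin 2) (Fin 2) ℂ) r s + bitSign i * pauli q.succ r s) := by
  have h2 : ((Real.sqrt 2 : ℝ) : ℂ)⁻¹ * ((Real.sqrt 2 : ℝ) : ℂ)⁻¹ = 1 / 2 := by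
    rw [← mul_inv, ← Complex.ofReal_mul, Real.mul_self_sqrt zero_le_two]
    norm_num
  have hH : ∀ r i, gateH r i = ((Real.sqrt 2 : ℝ) : ℂ)⁻¹ * !![1, 1; 1, -1] r i := fun r i => rfl
  have hS : ∀ r i, (gateS * gateH) r i =
      ((Real.sqrt 2 : ℝ) : ℂ)⁻¹ * !![1, 1; Complex.I, -Complex.I] r i := by
    intro r i
    fin_cases r <;> fin_cases i <;> simp [gateS, hH, Matrix.mul_apply, Fin.sum_univ_two] <;> ring
  have hconj : star ((Real.sqrt 2 : ℝ) : ℂ)⁻¹ = ((Real.sqrt 2 : ℝ) : ℂ)⁻¹ := by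
    rw [Complex.star_def, map_inv₀, Complex.conj_ofReal]
  have hmul : ∀ x y : ℂ, ((Real.sqrt 2 : ℝ) : ℂ)⁻¹ * x * star (((Real.sqrt 2 : ℝ) : ℂ)⁻¹ * y) =
      1 / 2 * (x * star y) := by
    intro x y
    rw [star_mul', hconj, ← h2]
    ring
  fin_cases q
  · change gateH r i * star (gateH s i) = _
    rw [hH, hH, hmul]
    congr 1
    fin_cases i <;> fin_cases r <;> fin_cases s <;> simp [bitSign, pauli, pauliX]
  · change (1 : Matrix (Fin 2) (Fin 2) ℂ) r i * star ((1 : Matrix (Fin 2) (Fin 2) ℂ) s i) = _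
    fin_cases i <;> fin_cases r <;> fin_cases s <;> simp [bitSign, pauli, pauliZ] <;> norm_num
  · change (gateS * gateH) r i * star ((gateS * gateH) s i) = _
    rw [hS, hS, hmul]
    congr 1
    fin_cases i <;> fin_cases r <;> fin_cases s <;> simp [bitSign, pauli]

/-- The vector is a product of column `j + k i` of `A` with column `i` of `B`: the controlled NOT
merely adds the environment bit to the system bit. -/
theorem rankTwoVec_apply (A B : Matrix (Fin 2) (Fin 2) ℂ) (j k i : Fin 2) (p : Fin 2 × Fin 2) :
    rankTwoVec A B j k i p = A p.1 (j + k * i) * B p.2 i := by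
  have hX : ∀ r : Fin 2, (pauliX ^ (j : ℕ)) r 0 = if r = j then 1 else 0 := by
    intro r
    fin_cases j <;> fin_cases r <;> simp [pauliX]
  have hC : ∀ r : Fin 2 × Fin 2, (cnotTwoOne ^ (k : ℕ)) r (j, i) =
      if r = (j + k * i, i) then 1 else 0 := by
    intro r
    fin_cases k
    · simp [Matrix.one_apply]
    · simp [cnotTwoOne]
  rw [rankTwoVec, Matrix.mulVec_single_one, Matrix.col_apply, Matrix.mul_apply,
    Finset.sum_eq_single (j, i), Matrix.mul_apply, Finset.sum_eq_single (j + k * i, i), hC]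
  · simp [hX]
  · intro r _ hr
    rw [hC, if_neg hr, mul_zero]
  · simp
  · rintro ⟨r, s⟩ - hr
    rw [Matrix.kroneckerMap_apply, hX, Matrix.one_apply]
    by_cases h1 : r = j
    · by_cases h2 : s = i
      · exact absurd (by rw [h1, h2]) hr
      · simp [h2]
    · simp [h1]
  · simp

theorem choi_eq_rankTwo_iff (Φ : SuperOp (Fin 2)) (q p : Fin 3) (j k : Fin 2) :
    choi Φ = (1 / 2 : ℂ) • ∑ i : Fin 2, Matrix.vecMulVec (rankTwoVec (gate q) (gate p) j k i)
        (star (rankTwoVec (gate q) (gate p) j k i)) ↔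
      ∀ a b r s, Φ (Matrix.single a b 1) r s = ∑ i : Fin 2,
        ((1 / 2 : ℂ) * ((1 : Matrix (Fin 2) (Fin 2) ℂ) r s +
          bitSign (j + k * i) * pauli q.succ r s)) *
        ((1 / 2 : ℂ) * ((1 : Matrix (Fin 2) (Fin 2) ℂ) a b + bitSign i * pauli p.succ a b)) := by
  have h : ∀ a b r s, ((1 / 2 : ℂ) • ∑ i : Fin 2,
      Matrix.vecMulVec (rankTwoVec (gate q) (gate p) j k i)
        (star (rankTwoVec (gate q) (gate p) j k i))) (r, a) (s, b) =
      (1 / 2 : ℂ) * ∑ i : Fin 2, ((1 / 2 : ℂ) * ((1 : Matrix (Fin 2) (Fin 2) ℂ) r s +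
          bitSign (j + k * i) * pauli q.succ r s)) *
        ((1 / 2 : ℂ) * ((1 : Matrix (Fin 2) (Fin 2) ℂ) a b + bitSign i * pauli p.succ a b)) := by
    intro a b r s
    simp only [Matrix.smul_apply, Matrix.sum_apply, Matrix.vecMulVec_apply, Pi.star_apply,
      rankTwoVec_apply, smul_eq_mul, star_mul', ← gate_mul_star]
    congr 1
    exact Finset.sum_congr rfl fun i _ => by ring
  have hchoi : ∀ a b r s, choi Φ (r, a) (s, b) = (1 / 2 : ℂ) * Φ (Matrix.single a b 1) r s := by
    intro a b r s
    simp [choi]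
  constructor
  · intro hΦ a b r s
    have := congrFun (congrFun hΦ (r, a)) (s, b)
    rw [h, hchoi] at this
    exact mul_left_cancel₀ (by norm_num) this
  · intro hΦ
    ext ⟨r, a⟩ ⟨s, b⟩
    rw [h, hchoi, hΦ]

/-- Only σ_y is antisymmetric. The resulting sign enters because the Choi matrix transposes the
input factor. -/
theorem pauli_transpose (p : Fin 3) (a b : Fin 2) :
    pauli p.succ b a = sgn (p == 2) * pauli p.succ a b := by
  fin_cases p <;> fin_cases a <;> fin_cases b <;> simp [pauli, pauliX, pauliZ, sgn]

theorem blochMap_rankCode (y : Bool × Fin 3) (p : Fin 3) (ρ : Matrix (Fin 2) (Fin 2) ℂ) :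
    blochMap (rankCode y p) ρ = (1 / 2 : ℂ) • (ρ.trace • 1 +
      (pauli p.succ * ρ).trace • BlochColumn.mat (some y)) := by
  rw [blochMap_apply, Fin.sum_univ_three]
  have h0 : BlochColumn.mat none = 0 := rfl
  fin_cases p <;> simp [rankCode, h0]

theorem blochMap_rankCode_single (y : Bool × Fin 3) (p : Fin 3) (a b r s : Fin 2) :
    blochMap (rankCode y p) (Matrix.single a b 1) r s =
      (1 / 2 : ℂ) * ((1 : Matrix (Fin 2) (Fin 2) ℂ) a b * (1 : Matrix (Fin 2) (Fin 2) ℂ) r s +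
        sgn (p == 2) * pauli p.succ a b * (sgn y.1 * pauli y.2.succ r s)) := by
  rw [blochMap_rankCode]
  have h1 : (Matrix.single a b (1 : ℂ)).trace = (1 : Matrix (Fin 2) (Fin 2) ℂ) a b := by
    rw [Matrix.one_apply]
    split_ifs with h
    · subst h; simp
    · simp [Matrix.trace_single_eq_of_ne _ _ _ h]
  have h2 : (pauli p.succ * Matrix.single a b (1 : ℂ)).trace = pauli p.succ b a := by
    simp [Matrix.trace_mul_single]
  rw [h1, h2, pauli_transpose]
  rfl

/-- Unitality is the obstruction that removes the product states, that is the case `k = 0`. -/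
theorem IsMixedUnitary.map_one {Φ : SuperOp (Fin 2)} (h : IsMixedUnitary Φ) : Φ 1 = 1 := by
  obtain ⟨m, p, U, -, hsum, rfl⟩ := h
  have hU : ∀ r, unitaryChannel (U r : Matrix (Fin 2) (Fin 2) ℂ) 1 = 1 := by
    intro r
    simp only [unitaryChannel, LinearMap.coe_mk, AddHom.coe_mk, mul_one]
    exact Matrix.mem_unitaryGroup_iff.1 (U r).2
  simp only [LinearMap.sum_apply, LinearMap.smul_apply, hU, ← Finset.sum_smul]
  rw [← Complex.ofReal_sum, hsum, Complex.ofReal_one, one_smul]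

/-- Two Bloch columns whose average is a third one. -/
def isAverage : BlochColumn → BlochColumn → BlochColumn → Bool
  | some x, some z, none => x.1 != z.1 && x.2 == z.2
  | some x, some z, some y => x == y && z == y
  | _, _, _ => false

theorem isAverage_mat {x z y : BlochColumn} (h : isAverage x z y = true) :
    x.mat + z.mat = (2 : ℂ) • y.mat := by
  rcases x with _ | ⟨s, q⟩ <;> rcases z with _ | ⟨s', q'⟩ <;> rcases y with _ | y <;>
    simp [isAverage] at h
  · obtain ⟨h1, rfl⟩ := h
    cases s <;> cases s' <;> simp [BlochColumn.mat, sgn] at h1 ⊢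
  · obtain ⟨rfl, h2⟩ := h
    rw [h2, two_smul]

/-- A map with the single column `p` is the mean of two Clifford channels agreeing in column `p` and
opposite in the other two. Flipping the signs of `x` and `z` according to `p` also sets the sign of
the third column, which changes by the product of the two flips. -/
theorem exists_average : ∀ (y : Bool × Fin 3) (p : Fin 3), ∃ x z : Bool × Fin 3, x.2 ≠ z.2 ∧
    ∀ p', isAverage (blochCode (systemPauli x) (systemPauli z) p')
      (blochCode (systemPauli (xor x.1 (p != 0), x.2)) (systemPauli (xor z.1 (p != 1), z.2)) p')
      (rankCode y p p') = true := by
  decide +kernel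

theorem isMixedUnitary_blochMap_rankCode (y : Bool × Fin 3) (p : Fin 3) :
    IsMixedUnitary (blochMap (rankCode y p)) := by
  obtain ⟨x, z, hxz, h⟩ := exists_average y p
  have hmem : ∀ x z : Bool × Fin 3, x.2 ≠ z.2 → ∃ U : Matrix.unitaryGroup (Fin 2) ℂ,
      unitaryChannel (U : Matrix (Fin 2) (Fin 2) ℂ) =
        blochMap (blochCode (systemPauli x) (systemPauli z)) := by
    intro x z hxz
    have h1 : blochMap (blochCode (systemPauli x) (systemPauli z)) ∈ cliffordChannels := by
      rw [cliffordChannels_eq]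
      exact ⟨_, Finset.mem_image.2 ⟨(x, z), Finset.mem_filter.2 ⟨Finset.mem_univ _, hxz⟩, rfl⟩, rfl⟩
    obtain ⟨C, hC, hCe⟩ := h1
    exact ⟨⟨C, (Matrix.mem_specialUnitaryGroup_iff.1 (mem_cliffordOne_iff.1 hC).1).1⟩, hCe⟩
  obtain ⟨U, hU⟩ := hmem x z hxz
  obtain ⟨V, hV⟩ := hmem (xor x.1 (p != 0), x.2) (xor z.1 (p != 1), z.2) hxz
  refine ⟨2, fun _ => 1 / 2, ![U, V], fun _ => by norm_num, by simp, ?_⟩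
  rw [Fin.sum_univ_two]
  simp only [Matrix.cons_val_zero, Matrix.cons_val_one, hU, hV, ← smul_add]
  refine LinearMap.ext fun ρ => ?_
  simp only [LinearMap.smul_apply, LinearMap.add_apply, blochMap_apply]
  rw [← smul_add, add_add_add_comm, ← Finset.sum_add_distrib]
  simp only [← smul_add, isAverage_mat (h _)]
  simp only [smul_comm _ (2 : ℂ), ← Finset.smul_sum]
  rw [← two_smul ℂ (1 : Matrix (Fin 2) (Fin 2) ℂ), smul_comm _ (2 : ℂ), ← smul_add, smul_smul,
    smul_smul]
  norm_num

theorem rankTwoMixedUnitary_eq :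
    rankTwoMixedUnitary = blochMap '' (rankCodes : Set (Fin 3 → BlochColumn)) := by
  ext Φ
  constructor
  · rintro ⟨⟨A, hA, B, hB, j, k, hΦ⟩, hmix⟩
    obtain ⟨q, rfl⟩ := mem_gates_iff.1 hA
    obtain ⟨p, rfl⟩ := mem_gates_iff.1 hB
    rw [choi_eq_rankTwo_iff] at hΦ
    fin_cases k
    -- For `k = 0` the system factor is the same pure state for both `i`, so the identity is sent to
    -- `1 ± σ` instead of 1.
    · exfalso
      have h1 : (1 : Matrix (Fin 2) (Fin 2) ℂ) = Matrix.single 0 0 1 + Matrix.single 1 1 1 := by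
        ext r s
        fin_cases r <;> fin_cases s <;> simp
      have h2 := hmix.map_one
      have h3 : bitSign j • pauli q.succ = 0 := by
        ext r s
        have h4 := congrFun (congrFun h2 r) s
        conv_lhs at h4 => rw [h1]
        rw [map_add, Matrix.add_apply, hΦ, hΦ, Fin.sum_univ_two, Fin.sum_univ_two] at h4
        simp only [bitSign, Fin.zero_eta, zero_mul, add_zero, Matrix.one_apply_eq,
          Matrix.cons_val_zero, Matrix.cons_val_one] at h4
        simp only [Matrix.smul_apply, smul_eq_mul, bitSign, Matrix.zero_apply]
        linear_combination h4
      have h5 := congrArg (· * pauli q.succ) h3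
      simp only [Matrix.smul_mul, pauli_mul_self, zero_mul] at h5
      have h6 := congrFun (congrFun h5 0) 0
      fin_cases j <;> simp [bitSign] at h6
    -- For `k = 1` the terms linear in a single Pauli cancel over `i`, leaving the identity and a
    -- product of Paulis with sign `(-1)^j`, corrected by the transpose sign when `p` labels σ_y.
    · refine ⟨rankCode (xor (j == 1) (p == 2), q) p, Finset.mem_coe.2
        (Finset.mem_image.2 ⟨((xor (j == 1) (p == 2), q), p), Finset.mem_univ _, rfl⟩), ?_⟩
      refine superOp_ext fun a b => ?_
      ext r s
      rw [hΦ, blochMap_rankCode_single, Fin.sum_univ_two]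
      generalize (p == 2) = u
      fin_cases j <;> cases u <;> simp [bitSign, sgn] <;> ring
  · rintro ⟨c, hc, rfl⟩
    obtain ⟨⟨⟨t, q⟩, p⟩, -, rfl⟩ := Finset.mem_image.1 (Finset.mem_coe.1 hc)
    refine ⟨⟨gate q, mem_gates_iff.2 ⟨q, rfl⟩, gate p, mem_gates_iff.2 ⟨p, rfl⟩,
      if xor t (p == 2) = true then 1 else 0, 1, ?_⟩, isMixedUnitary_blochMap_rankCode _ _⟩
    rw [choi_eq_rankTwo_iff]
    intro a b r s
    rw [blochMap_rankCode_single, Fin.sum_univ_two]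
    generalize (p == 2) = u
    cases t <;> cases u <;> simp [bitSign, sgn] <;> ring

end RankTwo

/-! ### The Weingarten function for three copies in dimension four. -/

section WeingartenThree

/-- The number of binary strings invariant under a permutation of three letters. -/
def invariantCount (σ : Equiv.Perm (Fin 3)) : ℕ :=
  Fintype.card {f : Fin 3 → Fin 2 // f ∘ σ = f}

/-- The Weingarten function on three letters in dimension four, multiplied by `360`. -/
def weingartenThree (σ : Equiv.Perm (Fin 3)) : ℤ :=
  if invariantCount σ = 8 then 7 else if invariantCount σ = 4 then -2 else 1

theorem two_pow_numCycles (σ : Equiv.Perm (Fin 3)) :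
    (2 : ℂ) ^ numCycles σ = invariantCount σ := by
  have h := card_invariant_functions (Fin 2) σ
  rw [Fintype.card_fin] at h
  rw [invariantCount, h, Nat.cast_pow, Nat.cast_ofNat]

theorem sum_weingartenThree_mul : ∀ σ τ : Equiv.Perm (Fin 3),
    ∑ ρ, weingartenThree (σ * ρ⁻¹) * (invariantCount (ρ * τ⁻¹) : ℤ) ^ 2 =
      if σ = τ then 360 else 0 := by
  decide +kernel

theorem sum_mul_weingartenThree : ∀ σ τ : Equiv.Perm (Fin 3),
    ∑ ρ, (invariantCount (σ * ρ⁻¹) : ℤ) ^ 2 * weingartenThree (ρ * τ⁻¹) =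
      if σ = τ then 360 else 0 := by
  decide +kernel

/-- The candidate with values 7, -2, 1 is a two-sided inverse of the Gram matrix up to the factor
360. Multiplying `G W G = G` by it on both sides isolates the pseudo-inverse. -/
theorem Wg_three_four (σ τ : Equiv.Perm (Fin 3)) :
    Wg (σ * τ⁻¹) 4 = (360 : ℂ)⁻¹ * weingartenThree (σ * τ⁻¹) := by
  set V : Matrix (Equiv.Perm (Fin 3)) (Equiv.Perm (Fin 3)) ℂ :=
    Matrix.of fun σ τ => (weingartenThree (σ * τ⁻¹) : ℂ) with hV
  have hG : ∀ σ τ, permGram 3 4 σ τ = (invariantCount (σ * τ⁻¹) : ℂ) ^ 2 := fun σ τ => by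
    rw [permGram, Matrix.of_apply, ← two_pow_numCycles, ← pow_mul, mul_comm, pow_mul]
    norm_num
  have hVG : V * permGram 3 4 = (360 : ℂ) • 1 := by
    ext σ τ
    have h := congrArg (Int.cast : ℤ → ℂ) (sum_weingartenThree_mul σ τ)
    push_cast at h
    simp only [Matrix.mul_apply, hG, hV, Matrix.of_apply, h, Matrix.smul_apply, Matrix.one_apply,
      smul_eq_mul, mul_ite, mul_one, mul_zero]
  have hGV : permGram 3 4 * V = (360 : ℂ) • 1 := by
    ext σ τ
    have h := congrArg (Int.cast : ℤ → ℂ) (sum_mul_weingartenThree σ τ)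
    push_cast at h
    simp only [Matrix.mul_apply, hG, hV, Matrix.of_apply, h, Matrix.smul_apply, Matrix.one_apply,
      smul_eq_mul, mul_ite, mul_one, mul_zero]
  have h := congrArg (fun M => V * M * V) (permGram_cfc_permGram (t := 3) 4)
  rw [show ∀ W : Matrix (Equiv.Perm (Fin 3)) (Equiv.Perm (Fin 3)) ℂ,
    V * (permGram 3 4 * W * permGram 3 4) * V = (V * permGram 3 4) * W * (permGram 3 4 * V) from
    fun W => by simp only [Matrix.mul_assoc], hVG, hGV] at h
  simp only [Matrix.smul_mul, Matrix.mul_smul, Matrix.one_mul, Matrix.mul_one] at h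
  have h1 := congrFun (congrFun h σ) τ
  simp only [Matrix.smul_apply, smul_eq_mul] at h1
  rw [Wg_mul_inv]
  have h2 : V σ τ = (weingartenThree (σ * τ⁻¹) : ℂ) := rfl
  rw [← h2]
  linear_combination (360 : ℂ)⁻¹ * (360 : ℂ)⁻¹ * h1

theorem sum_perm_three (f : Equiv.Perm (Fin 3) → ℂ) :
    ∑ σ, f σ = f 1 + f (Equiv.swap 0 1) + f (Equiv.swap 0 2) + f (Equiv.swap 1 2) +
      f (finRotate 3) + f (finRotate 3)⁻¹ := by
  have h : (Finset.univ : Finset (Equiv.Perm (Fin 3))) = {1, Equiv.swap 0 1, Equiv.swap 0 2,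
      Equiv.swap 1 2, finRotate 3, (finRotate 3)⁻¹} := by decide
  rw [h, Finset.sum_insert (by decide), Finset.sum_insert (by decide),
    Finset.sum_insert (by decide), Finset.sum_insert (by decide), Finset.sum_insert (by decide),
    Finset.sum_singleton]
  ring

theorem invariantCount_values : invariantCount 1 = 8 ∧ invariantCount (Equiv.swap 0 1) = 4 ∧
    invariantCount (Equiv.swap 0 2) = 4 ∧ invariantCount (Equiv.swap 1 2) = 4 ∧
    invariantCount (finRotate 3) = 2 ∧ invariantCount (finRotate 3)⁻¹ = 2 := by
  decide +kernel

/-- The part of the Weingarten expansion not already in the moments of the Clifford channels is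
the square of the antisymmetriser. -/
theorem sum_weingartenThree (x y : Equiv.Perm (Fin 3) → ℂ) :
    ∑ σ, ∑ τ, (weingartenThree (σ * τ⁻¹) : ℂ) * (invariantCount σ * invariantCount τ) *
        (x σ * y τ) =
      360 * (x 1 * y 1) +
      24 * ((2 * x (Equiv.swap 0 1) - x 1) * (2 * y (Equiv.swap 0 1) - y 1) +
        (2 * x (Equiv.swap 0 2) - x 1) * (2 * y (Equiv.swap 0 2) - y 1) +
        (2 * x (Equiv.swap 1 2) - x 1) * (2 * y (Equiv.swap 1 2) - y 1)) +
      12 * ((x (finRotate 3) - x (finRotate 3)⁻¹) * (y (finRotate 3) - y (finRotate 3)⁻¹)) +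
      16 * ((∑ σ, (Equiv.Perm.sign σ : ℂ) * x σ) * ∑ τ, (Equiv.Perm.sign τ : ℂ) * y τ) := by
  -- After subtraction of the rank-one part 16 sgn ⊗ sgn, only the listed entries survive. In the
  -- completed squares, 432 = 360 + 3 · 24, -48 = -2 · 24 and 96 = 4 · 24; the three-cycles
  -- contribute ±12.
  have h : ∀ σ τ : Equiv.Perm (Fin 3),
      weingartenThree (σ * τ⁻¹) * (invariantCount σ * invariantCount τ) =
        16 * (Equiv.Perm.sign σ * Equiv.Perm.sign τ : ℤ) +
        (if σ = 1 ∧ τ = 1 then 432 else if σ = 1 ∧ invariantCount τ = 4 then -48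
          else if τ = 1 ∧ invariantCount σ = 4 then -48
          else if σ = τ ∧ invariantCount σ = 4 then 96
          else if invariantCount σ = 2 ∧ invariantCount τ = 2 then
            (if σ = τ then 12 else -12) else 0) := by
    decide +kernel
  have h' : ∀ σ τ : Equiv.Perm (Fin 3),
      (weingartenThree (σ * τ⁻¹) : ℂ) * (invariantCount σ * invariantCount τ) =
        16 * ((Equiv.Perm.sign σ : ℂ) * (Equiv.Perm.sign τ : ℂ)) +
        (if σ = 1 ∧ τ = 1 then 432 else if σ = 1 ∧ invariantCount τ = 4 then -48
          else if τ = 1 ∧ invariantCount σ = 4 then -48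
          else if σ = τ ∧ invariantCount σ = 4 then 96
          else if invariantCount σ = 2 ∧ invariantCount τ = 2 then
            (if σ = τ then 12 else -12) else 0) := fun σ τ => by
    exact_mod_cast congrArg (Int.cast : ℤ → ℂ) (h σ τ)
  obtain ⟨v0, v1, v2, v3, v4, v5⟩ := invariantCount_values
  rw [Finset.sum_mul_sum, Finset.mul_sum]
  simp only [h', add_mul, Finset.sum_add_distrib, Finset.mul_sum]
  rw [add_comm]
  congr 1
  · simp only [sum_perm_three, v0, v1, v2, v3, v4, v5]
    simp +decide
    ring
  · refine Finset.sum_congr rfl fun σ _ => Finset.sum_congr rfl fun τ _ => ?_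
    ring

end WeingartenThree

/-! ### Weighted moments of Bloch coefficients up to degree three. -/

section CodeMoments

/-- The coefficient of a Bloch column at a Pauli matrix. -/
def BlochColumn.coeff : BlochColumn → Fin 3 → ℤ
  | none, _ => 0
  | some x, q => if x.2 = q then (if x.1 then -1 else 1) else 0

/-- The Levi-Civita symbol. -/
def leviCivita : Fin 3 → Fin 3 → Fin 3 → ℤ :=
  ![![![0, 0, 0], ![0, 0, 1], ![0, -1, 0]], ![![0, 0, -1], ![0, 0, 0], ![1, 0, 0]],
    ![![0, 1, 0], ![-1, 0, 0], ![0, 0, 0]]]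

/-- The weighted sum over the nonzero Bloch codes, arranged for evaluation. -/
def weightedSum (f : (Fin 3 → BlochColumn) → ℤ) : ℤ :=
  (∑ x : Bool × Fin 3, ∑ z : Bool × Fin 3,
    if x.2 ≠ z.2 then f (blochCode (systemPauli x) (systemPauli z)) else 0) +
  12 * ∑ y : Bool × Fin 3, ∑ p, f (rankCode y p)

/-- Odd moments of this kind cancel because the sign of a column can be flipped within the family.
-/
theorem weightedSum_coeff : ∀ p q, weightedSum (fun c => (c p).coeff q) = 0 := by
  decide +kernel

/-- A given coefficient is nonzero in 8 local codes of weight 1 and 2 rank-two codes of weight 12,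
whence 8 + 24 = 32. -/
theorem weightedSum_coeff_mul : ∀ p q p' q',
    weightedSum (fun c => (c p).coeff q * (c p').coeff q') =
      if p = p' ∧ q = q' then 32 else 0 := by
  decide +kernel

/-- Only local codes contribute. They are the signed permutation matrices of determinant 1, four for
each permutation, and the product of the three entries is the sign of the permutation. -/
theorem weightedSum_coeff_mul_mul : ∀ p q p' q' p'' q'',
    weightedSum (fun c => (c p).coeff q * (c p').coeff q' * (c p'').coeff q'') =
      4 * (leviCivita p p' p'' * leviCivita q q' q'') := by
  decide +kernel

theorem sum_localCodes (f : (Fin 3 → BlochColumn) → ℤ) :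
    ∑ c ∈ localCodes, f c = ∑ x : Bool × Fin 3, ∑ z : Bool × Fin 3,
      if x.2 ≠ z.2 then f (blochCode (systemPauli x) (systemPauli z)) else 0 := by
  -- The image has as many elements as the index set, so the parametrisation is injective and the
  -- sum can be reindexed.
  have hinj := Finset.card_image_iff.1 (card_localCodes.trans (by decide +kernel :
    24 = (Finset.univ.filter fun xz : (Bool × Fin 3) × (Bool × Fin 3) => xz.1.2 ≠ xz.2.2).card))
  rw [localCodes, Finset.sum_image hinj, Finset.sum_filter, Fintype.sum_prod_type]

theorem sum_rankCodes (f : (Fin 3 → BlochColumn) → ℤ) :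
    ∑ c ∈ rankCodes, f c = ∑ y : Bool × Fin 3, ∑ p, f (rankCode y p) := by
  have hinj := Finset.card_image_iff.1 (card_rankCodes.trans (by decide +kernel :
    18 = (Finset.univ : Finset ((Bool × Fin 3) × Fin 3)).card))
  rw [rankCodes, Finset.sum_image hinj, Fintype.sum_prod_type]

theorem sum_allCodes (f : (Fin 3 → BlochColumn) → ℤ) :
    ∑ c ∈ allCodes, (pairCount c : ℤ) * f c = weightedSum f + 240 * f zeroCode := by
  rw [allCodes, Finset.sum_union (Finset.disjoint_singleton_right.2 zeroCode_notMem),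
    Finset.sum_union disjoint_localCodes_rankCodes, Finset.sum_singleton, pairCount_zero,
    weightedSum, ← sum_localCodes, ← sum_rankCodes, Finset.mul_sum]
  rw [Finset.sum_congr rfl fun c hc => by rw [pairCount_local hc, Nat.cast_one, one_mul],
    Finset.sum_congr rfl fun c (hc : c ∈ rankCodes) => by rw [pairCount_rank hc, Nat.cast_ofNat]]
  rfl

theorem zeroCode_coeff (p q : Fin 3) : (zeroCode p).coeff q = 0 := by
  fin_cases p <;> rfl

theorem sum_pairCount : ∑ c ∈ allCodes, (pairCount c : ℂ) = 480 := by
  have h := sum_allCodes fun _ => 1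
  rw [show weightedSum (fun _ => 1) = 240 by decide +kernel] at h
  simp only [mul_one] at h
  exact_mod_cast h

theorem sum_pairCount_coeff (x : Fin 3 × Fin 3) :
    ∑ c ∈ allCodes, (pairCount c : ℂ) * ((c x.1).coeff x.2 : ℂ) = 0 := by
  have h := sum_allCodes fun c => (c x.1).coeff x.2
  rw [weightedSum_coeff, zeroCode_coeff] at h
  exact_mod_cast h

theorem sum_pairCount_coeff_mul (x y : Fin 3 × Fin 3) :
    ∑ c ∈ allCodes, (pairCount c : ℂ) * (((c x.1).coeff x.2 : ℂ) * ((c y.1).coeff y.2 : ℂ)) =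
      if x = y then 32 else 0 := by
  have h := sum_allCodes fun c => (c x.1).coeff x.2 * (c y.1).coeff y.2
  rw [weightedSum_coeff_mul, zeroCode_coeff, zero_mul, mul_zero, add_zero] at h
  simp only [← Prod.ext_iff] at h
  exact_mod_cast congrArg (Int.cast : ℤ → ℂ) h

theorem sum_pairCount_coeff_mul_mul (x y z : Fin 3 × Fin 3) :
    ∑ c ∈ allCodes, (pairCount c : ℂ) * (((c x.1).coeff x.2 : ℂ) * ((c y.1).coeff y.2 : ℂ) *
      ((c z.1).coeff z.2 : ℂ)) =
      4 * ((leviCivita x.1 y.1 z.1 : ℂ) * (leviCivita x.2 y.2 z.2 : ℂ)) := by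
  have h := sum_allCodes fun c => (c x.1).coeff x.2 * (c y.1).coeff y.2 * (c z.1).coeff z.2
  rw [weightedSum_coeff_mul_mul, zeroCode_coeff, zero_mul, zero_mul, mul_zero, add_zero] at h
  exact_mod_cast congrArg (Int.cast : ℤ → ℂ) h

/-- Third moments of affine functions of the Bloch coefficients. -/
theorem sum_pairCount_prod (D : Fin 3 → ℂ) (R : Fin 3 → Fin 3 × Fin 3 → ℂ) :
    ∑ c ∈ allCodes, (pairCount c : ℂ) *
        ∏ k, (D k + ∑ x : Fin 3 × Fin 3, R k x * ((c x.1).coeff x.2 : ℂ)) =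
      480 * (D 0 * D 1 * D 2) + 32 * (D 0 * ∑ x, R 1 x * R 2 x + D 1 * ∑ x, R 0 x * R 2 x +
        D 2 * ∑ x, R 0 x * R 1 x) +
      4 * ∑ x, ∑ y, ∑ z, R 0 x * R 1 y * R 2 z *
        ((leviCivita x.1 y.1 z.1 : ℂ) * (leviCivita x.2 y.2 z.2 : ℂ)) := by
  have h1 : ∀ k, ∑ c ∈ allCodes, (pairCount c : ℂ) *
      (∑ x : Fin 3 × Fin 3, R k x * ((c x.1).coeff x.2 : ℂ)) = 0 := by
    intro k
    simp only [Finset.mul_sum]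
    rw [Finset.sum_comm]
    refine Finset.sum_eq_zero fun x _ => ?_
    rw [← mul_zero (R k x), ← sum_pairCount_coeff x, Finset.mul_sum]
    exact Finset.sum_congr rfl fun c _ => by ring
  have h2 : ∀ k l, ∑ c ∈ allCodes, (pairCount c : ℂ) *
      ((∑ x : Fin 3 × Fin 3, R k x * ((c x.1).coeff x.2 : ℂ)) *
        ∑ y : Fin 3 × Fin 3, R l y * ((c y.1).coeff y.2 : ℂ)) = 32 * ∑ x, R k x * R l x := by
    intro k l
    have : ∀ x y, ∑ c ∈ allCodes, (pairCount c : ℂ) * ((R k x * ((c x.1).coeff x.2 : ℂ)) *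
        (R l y * ((c y.1).coeff y.2 : ℂ))) = if x = y then 32 * (R k x * R l y) else 0 := by
      intro x y
      rw [show (if x = y then 32 * (R k x * R l y) else 0) =
        R k x * R l y * (if x = y then 32 else 0) by split_ifs <;> ring,
        ← sum_pairCount_coeff_mul, Finset.mul_sum]
      exact Finset.sum_congr rfl fun c _ => by ring
    simp only [Finset.sum_mul_sum]
    simp only [Finset.mul_sum]
    rw [Finset.sum_comm]
    refine Finset.sum_congr rfl fun x _ => ?_
    rw [Finset.sum_comm]
    simp only [this, Finset.sum_ite_eq, Finset.mem_univ, if_true]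
  have h3 : ∑ c ∈ allCodes, (pairCount c : ℂ) *
      ((∑ x : Fin 3 × Fin 3, R 0 x * ((c x.1).coeff x.2 : ℂ)) *
        (∑ y : Fin 3 × Fin 3, R 1 y * ((c y.1).coeff y.2 : ℂ)) *
        ∑ z : Fin 3 × Fin 3, R 2 z * ((c z.1).coeff z.2 : ℂ)) =
      4 * ∑ x, ∑ y, ∑ z, R 0 x * R 1 y * R 2 z *
        ((leviCivita x.1 y.1 z.1 : ℂ) * (leviCivita x.2 y.2 z.2 : ℂ)) := by
    have hprod : ∀ u v w : Fin 3 × Fin 3 → ℂ,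
        (∑ x, u x) * (∑ y, v y) * ∑ z, w z = ∑ x, ∑ y, ∑ z, u x * v y * w z := by
      intro u v w
      rw [Finset.sum_mul_sum, Finset.sum_mul]
      refine Finset.sum_congr rfl fun x _ => ?_
      rw [Finset.sum_mul]
      exact Finset.sum_congr rfl fun y _ => Finset.mul_sum _ _ _
    simp only [hprod]
    simp only [Finset.mul_sum]
    rw [Finset.sum_comm]
    refine Finset.sum_congr rfl fun x _ => ?_
    rw [Finset.sum_comm]
    refine Finset.sum_congr rfl fun y _ => ?_
    rw [Finset.sum_comm]
    refine Finset.sum_congr rfl fun z _ => ?_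
    rw [mul_left_comm, ← sum_pairCount_coeff_mul_mul, Finset.mul_sum]
    exact Finset.sum_congr rfl fun c _ => by ring
  have h0 := sum_pairCount
  simp only [Fin.prod_univ_three]
  set L : (Fin 3 → BlochColumn) → Fin 3 → ℂ := fun c k =>
    ∑ x : Fin 3 × Fin 3, R k x * ((c x.1).coeff x.2 : ℂ) with hL
  have hexp : ∀ c, (pairCount c : ℂ) * ((D 0 + L c 0) * (D 1 + L c 1) * (D 2 + L c 2)) =
      (D 0 * D 1 * D 2) * pairCount c + (D 0 * D 1) * (pairCount c * L c 2) +
      (D 0 * D 2) * (pairCount c * L c 1) + (D 1 * D 2) * (pairCount c * L c 0) +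
      D 0 * (pairCount c * (L c 1 * L c 2)) + D 1 * (pairCount c * (L c 0 * L c 2)) +
      D 2 * (pairCount c * (L c 0 * L c 1)) + pairCount c * (L c 0 * L c 1 * L c 2) := by
    intro c
    ring
  change ∑ c ∈ allCodes, (pairCount c : ℂ) * ((D 0 + L c 0) * (D 1 + L c 1) * (D 2 + L c 2)) = _
  simp only [hexp, Finset.sum_add_distrib, ← Finset.mul_sum]
  rw [h0, h1, h1, h1, h2, h2, h2, h3]
  ring

end CodeMoments

/-! ### Contractions of Pauli matrices into permutations. -/

section PauliSums

theorem BlochColumn.mat_eq_sum (c : BlochColumn) :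
    c.mat = ∑ q : Fin 3, (c.coeff q : ℂ) • pauli q.succ := by
  rcases c with _ | ⟨s, q⟩
  · simp [BlochColumn.mat, BlochColumn.coeff]
  · rw [Finset.sum_eq_single q]
    · cases s <;> simp [BlochColumn.mat, BlochColumn.coeff, sgn]
    · intro q' _ h
      simp [BlochColumn.coeff, h.symm]
    · simp

theorem blochMap_single (c : Fin 3 → BlochColumn) (a b i j : Fin 2) :
    blochMap c (Matrix.single a b 1) i j = (1 / 2 : ℂ) *
      ((if a = b then 1 else 0) * (if i = j then 1 else 0) +
        ∑ x : Fin 3 × Fin 3, pauli x.1.succ b a * pauli x.2.succ i j *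
          ((c x.1).coeff x.2 : ℂ)) := by
  have h1 : (Matrix.single a b (1 : ℂ)).trace = if a = b then 1 else 0 := by
    split_ifs with h
    · subst h; simp
    · simp [Matrix.trace_single_eq_of_ne, h]
  have h2 : ∀ M : Matrix (Fin 2) (Fin 2) ℂ, (M * Matrix.single a b 1).trace = M b a := by
    intro M
    simp [Matrix.trace_mul_single]
  rw [blochMap_apply, h1, Fintype.sum_prod_type]
  simp only [h2, BlochColumn.mat_eq_sum, Matrix.smul_apply, Matrix.add_apply, Matrix.sum_apply,
    smul_eq_mul, Matrix.one_apply, Finset.mul_sum]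
  congr 2
  exact Finset.sum_congr rfl fun p _ => Finset.sum_congr rfl fun q _ => by ring

/-- Pauli completeness: Σ σ ⊗ σ is twice the swap minus the identity. -/
theorem sum_pauli_mul (a b a' b' : Fin 2) :
    ∑ p : Fin 3, pauli p.succ b a * pauli p.succ b' a' =
      2 * (if a = b' ∧ a' = b then 1 else 0) - (if a = b ∧ a' = b' then 1 else 0) := by
  rw [Fin.sum_univ_three]
  fin_cases a <;> fin_cases b <;> fin_cases a' <;> fin_cases b' <;>
    simp [pauli, pauliX, pauliZ] <;> norm_num

/-- The totally antisymmetric contraction of three Paulis is a multiple of the difference of the two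
three-cycles. Its sign reflects the order σ_x, σ_z, σ_y of the indices. -/
theorem sum_leviCivita_pauli (a b a' b' a'' b'' : Fin 2) :
    ∑ p : Fin 3, ∑ q : Fin 3, ∑ r : Fin 3,
        pauli p.succ b a * pauli q.succ b' a' * pauli r.succ b'' a'' * (leviCivita p q r : ℂ) =
      2 * Complex.I * ((if a = b'' ∧ a' = b ∧ a'' = b' then 1 else 0) -
        (if a = b' ∧ a' = b'' ∧ a'' = b then 1 else 0)) := by
  simp only [Fin.sum_univ_three, leviCivita]
  simp
  fin_cases a <;> fin_cases b <;> fin_cases a' <;> fin_cases b' <;> fin_cases a'' <;>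
    fin_cases b'' <;> simp [pauli, pauliX, pauliZ] <;> ring

/-- Three bits cannot be distinct: the transposition of two equal entries of `b` fixes the indicator
and reverses the sign. -/
theorem sum_sign_indicator (a b : Fin 3 → Fin 2) :
    ∑ σ : Equiv.Perm (Fin 3), (Equiv.Perm.sign σ : ℂ) * (if a = b ∘ σ then 1 else 0) = 0 := by
  obtain ⟨k, l, hkl, hb⟩ := Fintype.exists_ne_map_eq_of_card_lt b (by simp)
  have hs : b ∘ Equiv.swap k l = b := by
    ext x : 1
    rw [Function.comp_apply, Equiv.swap_apply_def]
    split_ifs with h1 h2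
    · rw [h1, hb]
    · rw [h2, hb]
    · rfl
  have h := Fintype.sum_equiv (Equiv.mulLeft (Equiv.swap k l))
    (fun σ : Equiv.Perm (Fin 3) => -((Equiv.Perm.sign σ : ℂ) * (if a = b ∘ σ then 1 else 0)))
    (fun σ => (Equiv.Perm.sign σ : ℂ) * (if a = b ∘ σ then 1 else 0)) fun σ => by
      rw [Equiv.coe_mulLeft, Equiv.Perm.sign_mul, Equiv.Perm.sign_swap hkl, Equiv.Perm.coe_mul,
        ← Function.comp_assoc, hs]
      push_cast
      ring
  rw [Finset.sum_neg_distrib] at h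
  linear_combination (-1 / 2 : ℂ) * h

end PauliSums

/-! ### Comparison of the Clifford and Haar third moments. -/

section Design

theorem sum_pair_mul (u u' v v' : Fin 3 → ℂ) :
    ∑ x : Fin 3 × Fin 3, u x.1 * v x.2 * (u' x.1 * v' x.2) =
      (∑ p, u p * u' p) * ∑ q, v q * v' q := by
  rw [Finset.sum_mul_sum, Fintype.sum_prod_type]
  exact Finset.sum_congr rfl fun p _ => Finset.sum_congr rfl fun q _ => by ring

theorem sum_triple_mul (u u' u'' v v' v'' : Fin 3 → ℂ) (e : Fin 3 → Fin 3 → Fin 3 → ℂ) :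
    ∑ x : Fin 3 × Fin 3, ∑ y : Fin 3 × Fin 3, ∑ z : Fin 3 × Fin 3,
        u x.1 * v x.2 * (u' y.1 * v' y.2) * (u'' z.1 * v'' z.2) *
          (e x.1 y.1 z.1 * e x.2 y.2 z.2) =
      (∑ p, ∑ q, ∑ r, u p * u' q * u'' r * e p q r) *
        ∑ p, ∑ q, ∑ r, v p * v' q * v'' r * e p q r := by
  have h : ∀ {A : Type} [Fintype A] (f : A → A → A → ℂ),
      ∑ p, ∑ q, ∑ r, f p q r = ∑ s : A × A × A, f s.1 s.2.1 s.2.2 := fun f => by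
    rw [Fintype.sum_prod_type]
    refine Finset.sum_congr rfl fun p _ => ?_
    rw [Fintype.sum_prod_type]
  rw [h, h, h, Fintype.sum_mul_sum, ← Fintype.sum_prod_type']
  refine Fintype.sum_equiv ⟨fun x => ((x.1.1, x.2.1.1, x.2.2.1), (x.1.2, x.2.1.2, x.2.2.2)),
    fun x => ((x.1.1, x.2.1), (x.1.2.1, x.2.2.1), (x.1.2.2, x.2.2.2)),
    fun _ => rfl, fun _ => rfl⟩ _ _ fun x => ?_
  simp only [Equiv.coe_fn_mk]
  ring

theorem eq_comp_perm_iff (f g : Fin 3 → Fin 2) :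
    (f = g ∘ (1 : Equiv.Perm (Fin 3)) ↔ f 0 = g 0 ∧ f 1 = g 1 ∧ f 2 = g 2) ∧
    (f = g ∘ Equiv.swap 0 1 ↔ f 0 = g 1 ∧ f 1 = g 0 ∧ f 2 = g 2) ∧
    (f = g ∘ Equiv.swap 0 2 ↔ f 0 = g 2 ∧ f 1 = g 1 ∧ f 2 = g 0) ∧
    (f = g ∘ Equiv.swap 1 2 ↔ f 0 = g 0 ∧ f 1 = g 2 ∧ f 2 = g 1) ∧
    (f = g ∘ finRotate 3 ↔ f 0 = g 1 ∧ f 1 = g 2 ∧ f 2 = g 0) ∧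
    (f = g ∘ ((finRotate 3)⁻¹ : Equiv.Perm (Fin 3)) ↔ f 0 = g 2 ∧ f 1 = g 0 ∧ f 2 = g 1) := by
  have h : ∀ σ : Equiv.Perm (Fin 3),
      f = g ∘ σ ↔ f 0 = g (σ 0) ∧ f 1 = g (σ 1) ∧ f 2 = g (σ 2) := fun σ => by
    simp [funext_iff, Fin.forall_fin_succ]
  exact ⟨h _, h _, h _, h _, h _, h _⟩

/-- Both sides reduce to an identity term, three terms `2 · swap - 1` and one difference of
three-cycles, each a product of an input and an output factor, with coefficients 1/8, 1/120 and
1/240. -/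
theorem sum_pairCount_prod_blochMap (a b i j : Fin 3 → Fin 2) :
    (480 : ℂ)⁻¹ * ∑ c ∈ allCodes, (pairCount c : ℂ) *
        ∏ k, blochMap c (Matrix.single (a k) (b k) 1) (i k) (j k) =
      ((2 : ℂ) ^ 3)⁻¹ * ∑ σ : Equiv.Perm (Fin 3), ∑ τ : Equiv.Perm (Fin 3),
        Wg (σ * τ⁻¹) 4 * (2 : ℂ) ^ (numCycles σ + numCycles τ) *
          ((if a = b ∘ σ then 1 else 0) * (if i = j ∘ τ then 1 else 0)) := by
  set x : Equiv.Perm (Fin 3) → ℂ := fun σ => if a = b ∘ σ then 1 else 0 with hx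
  set y : Equiv.Perm (Fin 3) → ℂ := fun τ => if i = j ∘ τ then 1 else 0 with hy
  have hR : ∑ σ : Equiv.Perm (Fin 3), ∑ τ : Equiv.Perm (Fin 3),
      Wg (σ * τ⁻¹) 4 * (2 : ℂ) ^ (numCycles σ + numCycles τ) * (x σ * y τ) =
      (360 : ℂ)⁻¹ * ∑ σ, ∑ τ, (weingartenThree (σ * τ⁻¹) : ℂ) *
        (invariantCount σ * invariantCount τ) * (x σ * y τ) := by
    simp only [Finset.mul_sum, Wg_three_four, pow_add, two_pow_numCycles]
    exact Finset.sum_congr rfl fun σ _ => Finset.sum_congr rfl fun τ _ => by ring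
  obtain ⟨P, hP⟩ : ∃ P : Fin 3 → Fin 3 → ℂ, ∀ k p, P k p = pauli p.succ (b k) (a k) :=
    ⟨_, fun _ _ => rfl⟩
  obtain ⟨Q, hQ⟩ : ∃ Q : Fin 3 → Fin 3 → ℂ, ∀ k q, Q k q = pauli q.succ (i k) (j k) :=
    ⟨_, fun _ _ => rfl⟩
  have hL : ∑ c ∈ allCodes, (pairCount c : ℂ) *
      ∏ k, blochMap c (Matrix.single (a k) (b k) 1) (i k) (j k) =
      (1 / 2) ^ 3 * ∑ c ∈ allCodes, (pairCount c : ℂ) *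
        ∏ k, ((if a k = b k then 1 else 0) * (if i k = j k then 1 else 0) +
          ∑ x : Fin 3 × Fin 3, P k x.1 * Q k x.2 * ((c x.1).coeff x.2 : ℂ)) := by
    simp only [blochMap_single, ← hP, ← hQ, Finset.prod_mul_distrib, Finset.prod_const, Finset.card_univ,
      Fintype.card_fin]
    rw [Finset.mul_sum]
    exact Finset.sum_congr rfl fun c _ => by ring
  change _ = ((2 : ℂ) ^ 3)⁻¹ * ∑ σ : Equiv.Perm (Fin 3), ∑ τ : Equiv.Perm (Fin 3),
      Wg (σ * τ⁻¹) 4 * (2 : ℂ) ^ (numCycles σ + numCycles τ) * (x σ * y τ)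
  rw [hR, sum_weingartenThree, sum_sign_indicator a b, hL,
    sum_pairCount_prod (fun k => (if a k = b k then 1 else 0) * (if i k = j k then 1 else 0))
      fun k x => P k x.1 * Q k x.2]
  -- Dictionary between products of deltas from the Pauli contractions and indicators of
  -- permutations acting on strings.
  have hpair : ∀ f g : Fin 3 → Fin 2,
      (if f 0 = g 0 then (1 : ℂ) else 0) * (if f 1 = g 1 then 1 else 0) *
        (if f 2 = g 2 then 1 else 0) = (if f = g ∘ (1 : Equiv.Perm (Fin 3)) then 1 else 0) ∧
      (if f 0 = g 0 then (1 : ℂ) else 0) *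
        (2 * (if f 1 = g 2 ∧ f 2 = g 1 then 1 else 0) - if f 1 = g 1 ∧ f 2 = g 2 then 1 else 0) =
        2 * (if f = g ∘ Equiv.swap 1 2 then 1 else 0) -
          (if f = g ∘ (1 : Equiv.Perm (Fin 3)) then 1 else 0) ∧
      (if f 1 = g 1 then (1 : ℂ) else 0) *
        (2 * (if f 0 = g 2 ∧ f 2 = g 0 then 1 else 0) - if f 0 = g 0 ∧ f 2 = g 2 then 1 else 0) =
        2 * (if f = g ∘ Equiv.swap 0 2 then 1 else 0) -
          (if f = g ∘ (1 : Equiv.Perm (Fin 3)) then 1 else 0) ∧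
      (if f 2 = g 2 then (1 : ℂ) else 0) *
        (2 * (if f 0 = g 1 ∧ f 1 = g 0 then 1 else 0) - if f 0 = g 0 ∧ f 1 = g 1 then 1 else 0) =
        2 * (if f = g ∘ Equiv.swap 0 1 then 1 else 0) -
          (if f = g ∘ (1 : Equiv.Perm (Fin 3)) then 1 else 0) ∧
      (if f 0 = g 2 ∧ f 1 = g 0 ∧ f 2 = g 1 then (1 : ℂ) else 0) -
        (if f 0 = g 1 ∧ f 1 = g 2 ∧ f 2 = g 0 then 1 else 0) =
        (if f = g ∘ ((finRotate 3)⁻¹ : Equiv.Perm (Fin 3)) then 1 else 0) - (if f = g ∘ finRotate 3 then 1 else 0) := by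
    intro f g
    obtain ⟨e0, e1, e2, e3, e4, e5⟩ := eq_comp_perm_iff f g
    simp only [e0, e1, e2, e3, e4, e5]
    refine ⟨?_, ?_, ?_, ?_, trivial⟩
    · rw [ite_zero_mul_ite_zero, ite_zero_mul_ite_zero, mul_one, mul_one]
      simp only [and_assoc]
    · by_cases h : f 0 = g 0 <;> simp [h]
    · by_cases h : f 1 = g 1 <;> simp [h]
    · by_cases h : f 2 = g 2 <;> simp [h]
  obtain ⟨x0, x1, x2, x3, x4⟩ := hpair a b
  obtain ⟨y0, y1, y2, y3, y4⟩ := hpair i j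
  have hV : ∀ k l : Fin 3, ∑ p, P k p * P l p =
      2 * (if a k = b l ∧ a l = b k then 1 else 0) - if a k = b k ∧ a l = b l then 1 else 0 := by
    intro k l
    simp only [hP]
    exact sum_pauli_mul _ _ _ _
  have hW : ∀ k l : Fin 3, ∑ q, Q k q * Q l q =
      2 * (if i k = j l ∧ i l = j k then 1 else 0) - if i k = j k ∧ i l = j l then 1 else 0 := by
    intro k l
    simp only [hQ]
    rw [sum_pauli_mul, if_congr (⟨fun h => ⟨h.2.symm, h.1.symm⟩, fun h => ⟨h.2.symm, h.1.symm⟩⟩ :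
      j k = i l ∧ j l = i k ↔ i k = j l ∧ i l = j k) rfl rfl,
      if_congr (⟨fun h => ⟨h.1.symm, h.2.symm⟩, fun h => ⟨h.1.symm, h.2.symm⟩⟩ :
      j k = i k ∧ j l = i l ↔ i k = j k ∧ i l = j l) rfl rfl]
  have hE : ∑ p, ∑ q, ∑ r, P 0 p * P 1 q * P 2 r * (leviCivita p q r : ℂ) =
      2 * Complex.I * ((if a 0 = b 2 ∧ a 1 = b 0 ∧ a 2 = b 1 then 1 else 0) -
        (if a 0 = b 1 ∧ a 1 = b 2 ∧ a 2 = b 0 then 1 else 0)) := by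
    simp only [hP]
    exact sum_leviCivita_pauli _ _ _ _ _ _
  -- `Q` takes its matrix indices in the order opposite to `P`, which exchanges the two
  -- three-cycles. The resulting sign compensates `(2i)² = -4`.
  have hF : ∑ p, ∑ q, ∑ r, Q 0 p * Q 1 q * Q 2 r * (leviCivita p q r : ℂ) =
      2 * Complex.I * ((if i 0 = j 1 ∧ i 1 = j 2 ∧ i 2 = j 0 then 1 else 0) -
        (if i 0 = j 2 ∧ i 1 = j 0 ∧ i 2 = j 1 then 1 else 0)) := by
    simp only [hQ]
    rw [sum_leviCivita_pauli,
      if_congr (⟨fun h => ⟨h.2.1.symm, h.2.2.symm, h.1.symm⟩,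
        fun h => ⟨h.2.2.symm, h.1.symm, h.2.1.symm⟩⟩ :
        j 0 = i 2 ∧ j 1 = i 0 ∧ j 2 = i 1 ↔ i 0 = j 1 ∧ i 1 = j 2 ∧ i 2 = j 0) rfl rfl,
      if_congr (⟨fun h => ⟨h.2.2.symm, h.1.symm, h.2.1.symm⟩,
        fun h => ⟨h.2.1.symm, h.2.2.symm, h.1.symm⟩⟩ :
        j 0 = i 1 ∧ j 1 = i 2 ∧ j 2 = i 0 ↔ i 0 = j 2 ∧ i 1 = j 0 ∧ i 2 = j 1) rfl rfl]
  rw [sum_pair_mul (P 1) (P 2) (Q 1) (Q 2), sum_pair_mul (P 0) (P 2) (Q 0) (Q 2),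
    sum_pair_mul (P 0) (P 1) (Q 0) (Q 1),
    sum_triple_mul (P 0) (P 1) (P 2) (Q 0) (Q 1) (Q 2) fun p q r => (leviCivita p q r : ℂ),
    hE, hF, hV, hV, hV, hW, hW, hW]
  simp only [hx, hy]
  have m0 := congrArg₂ (· * ·) x0 y0
  have m1 := congrArg₂ (· * ·) x1 y1
  have m2 := congrArg₂ (· * ·) x2 y2
  have m3 := congrArg₂ (· * ·) x3 y3
  have m4 := congrArg₂ (· * ·) x4 y4
  beta_reduce at m0 m1 m2 m3 m4
  generalize (if a 0 = b 2 ∧ a 1 = b 0 ∧ a 2 = b 1 then (1 : ℂ) else 0) = u at *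
  generalize (if a 0 = b 1 ∧ a 1 = b 2 ∧ a 2 = b 0 then (1 : ℂ) else 0) = u' at *
  generalize (if i 0 = j 2 ∧ i 1 = j 0 ∧ i 2 = j 1 then (1 : ℂ) else 0) = v at *
  generalize (if i 0 = j 1 ∧ i 1 = j 2 ∧ i 2 = j 0 then (1 : ℂ) else 0) = v' at *
  linear_combination (1 / 8 : ℂ) * m0 + (1 / 120 : ℂ) * (m1 + m2 + m3) + (1 / 240 : ℂ) * m4 -
    (1 / 240 : ℂ) * (u - u') * (v - v') * Complex.I_mul_I

end Design

/-! ### The finite set of channels and its design property. -/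

section FinalDesign

/-- The channels of the two-qubit Clifford group. -/
def designChannels : Finset (SuperOp (Fin 2)) := allCodes.map ⟨blochMap, blochMap_injective⟩

/-- The weight of a channel: the pair count of its Bloch code. -/
def designWeight (Φ : SuperOp (Fin 2)) : ℕ := pairCount (Function.invFun blochMap Φ)

theorem designWeight_blochMap (c : Fin 3 → BlochColumn) :
    designWeight (blochMap c) = pairCount c := by
  rw [designWeight, Function.leftInverse_invFun blochMap_injective]

theorem coe_designChannels :
    (designChannels : Set (SuperOp (Fin 2))) = blochMap '' (allCodes : Set _) := by
  rw [designChannels, Finset.coe_map, Function.Embedding.coeFn_mk]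

theorem sum_designChannels {M : Type} [AddCommMonoid M] (F : SuperOp (Fin 2) → M) :
    ∑ Φ ∈ designChannels, F Φ = ∑ c ∈ allCodes, F (blochMap c) := by
  rw [designChannels, Finset.sum_map, Function.Embedding.coeFn_mk]

theorem exists_unitary_of_mem {Φ : SuperOp (Fin 2)} (hΦ : Φ ∈ designChannels) :
    ∃ U : Matrix.unitaryGroup (Fin 2 × Fin 2) ℂ,
      Φ = unistochastic (U : Matrix (Fin 2 × Fin 2) (Fin 2 × Fin 2) ℂ) := by
  have h : Φ ∈ unistochastic '' cliffordTwo := by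
    rw [unistochastic_image_cliffordTwo, ← coe_designChannels]
    exact hΦ
  obtain ⟨C, hC, rfl⟩ := h
  exact ⟨⟨C, (Matrix.mem_specialUnitaryGroup_iff.1 (mem_cliffordTwo_iff.1 hC).1).1⟩, rfl⟩

theorem isWeightedUnistochasticDesign_designChannels :
    IsWeightedUnistochasticDesign 3 designChannels fun Φ => (designWeight Φ : ℝ) := by
  refine ⟨?_, ?_, ?_⟩
  · rw [designChannels, Finset.map_nonempty]
    exact ⟨zeroCode, Finset.mem_union_right _ (Finset.mem_singleton_self _)⟩
  · intro Φ hΦ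
    refine ⟨?_, exists_unitary_of_mem hΦ⟩
    have h : Φ ∈ (designChannels : Set (SuperOp (Fin 2))) := hΦ
    rw [coe_designChannels] at h
    obtain ⟨c, hc, rfl⟩ := h
    beta_reduce
    rw [designWeight_blochMap]
    exact_mod_cast pairCount_pos hc
  · intro ρ i j
    -- Both sides are linear in `ρ`, so the comparison reduces to matrix units, where it is the
    -- moment identity for Bloch codes.
    rw [integral_unistochastic_unitaryTensorPow]
    simp only [integral_prod_unistochastic]
    have hW : ((∑ Φ ∈ designChannels, (designWeight Φ : ℝ) : ℝ) : ℂ) = 480 := by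
      rw [sum_designChannels]
      simp only [designWeight_blochMap]
      push_cast
      exact sum_pairCount
    rw [hW, sum_designChannels]
    simp only [designWeight_blochMap, tensorPow_apply, Complex.ofReal_natCast, Finset.mul_sum]
    rw [Finset.sum_comm]
    refine Finset.sum_congr rfl fun a _ => ?_
    rw [Finset.sum_comm]
    refine Finset.sum_congr rfl fun b _ => ?_
    have h := sum_pairCount_prod_blochMap a b i j
    have h2 := congrArg (ρ a b * ·) h
    simp only [Finset.mul_sum] at h2
    refine Eq.trans (Finset.sum_congr rfl fun c _ => ?_) (h2.trans ?_)
    · ring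
    · norm_num
end FinalDesign

end Unistochastic

end

theorem mainTheorem10 :
    (∀ (d t : ℕ), 1 ≤ d → ∀ a b i j : Fin t → Fin d,
      ∫ U : Matrix.unitaryGroup (Fin d × Fin d) ℂ,
        Unistochastic.choi (Unistochastic.tensorPow t (Unistochastic.unistochastic
          (U : Matrix (Fin d × Fin d) (Fin d × Fin d) ℂ))) (i, a) (j, b)
          ∂(Unistochastic.unitaryHaar (Fin d × Fin d)) =
      ((d : ℂ) ^ (2 * t))⁻¹ *
        ∑ σ : Equiv.Perm (Fin t), ∑ τ : Equiv.Perm (Fin t),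
          Unistochastic.Wg (σ * τ⁻¹) (d ^ 2) *
            (d : ℂ) ^ (Unistochastic.numCycles σ + Unistochastic.numCycles τ) *
            ∏ n : Fin t,
              ((if a n = b (σ n) then (1 : ℂ) else 0) * (if i n = j (τ n) then (1 : ℂ) else 0))) ∧
    ∃ (S : Finset (Unistochastic.SuperOp (Fin 2))) (w : Unistochastic.SuperOp (Fin 2) → ℕ),
      (S : Set (Unistochastic.SuperOp (Fin 2))) =
        Unistochastic.cliffordChannels ∪ Unistochastic.rankTwoMixedUnitary ∪
          {Unistochastic.depolarising (Fin 2)} ∧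
      S.card = 43 ∧
      Unistochastic.cliffordChannels.ncard = 24 ∧
      Unistochastic.rankTwoMixedUnitary.ncard = 18 ∧
      (∀ Φ ∈ Unistochastic.cliffordChannels, w Φ = 1) ∧
      (∀ Φ ∈ Unistochastic.rankTwoMixedUnitary, w Φ = 12) ∧
      w (Unistochastic.depolarising (Fin 2)) = 240 ∧
      Unistochastic.unistochastic '' Unistochastic.cliffordTwo = (S : Set _) ∧
      (∀ Φ ∈ S,
        (Unistochastic.unitaryChannel ''
          {C | C ∈ Unistochastic.cliffordTwo ∧ Unistochastic.unistochastic C = Φ}).ncard =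
            24 * w Φ) ∧
      Unistochastic.IsWeightedUnistochasticDesign 3 S (fun Φ => (w Φ : ℝ)) := by
  refine ⟨fun d t _ a b i j => Unistochastic.integral_choi_tensorPow a b i j, ?_⟩
  open Unistochastic in
  have hlocal : ∀ Φ ∈ cliffordChannels, designWeight Φ = 1 := by
    rw [cliffordChannels_eq]
    rintro _ ⟨c, hc, rfl⟩
    rw [designWeight_blochMap, pairCount_local hc]
  open Unistochastic in
  have hrank : ∀ Φ ∈ rankTwoMixedUnitary, designWeight Φ = 12 := by
    rw [rankTwoMixedUnitary_eq]
    rintro _ ⟨c, hc, rfl⟩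
    rw [designWeight_blochMap, pairCount_rank hc]
  open Unistochastic in
  refine ⟨designChannels, designWeight, ?_, ?_, ?_, ?_, hlocal, hrank, ?_, ?_, ?_,
    isWeightedUnistochasticDesign_designChannels⟩
  · rw [coe_designChannels, cliffordChannels_eq, rankTwoMixedUnitary_eq, depolarising_eq,
      allCodes, Finset.coe_union, Finset.coe_union, Finset.coe_singleton, Set.image_union,
      Set.image_union, Set.image_singleton]
  · rw [designChannels, Finset.card_map, card_allCodes]
  · rw [cliffordChannels_eq, Set.ncard_image_of_injective _ blochMap_injective,
      Set.ncard_coe_finset, card_localCodes]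
  · rw [rankTwoMixedUnitary_eq, Set.ncard_image_of_injective _ blochMap_injective,
      Set.ncard_coe_finset, card_rankCodes]
  · rw [depolarising_eq, designWeight_blochMap, pairCount_zero]
  · rw [unistochastic_image_cliffordTwo, coe_designChannels]
  · intro Φ hΦ
    obtain ⟨c, -, rfl⟩ : Φ ∈ blochMap '' (allCodes : Set _) := by
      rw [← coe_designChannels]
      exact hΦ
    rw [designWeight_blochMap, ncard_fiber]
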